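/- **Setting.** Let $X$ be a separable ordered real Banach space whose positive cone $X_+=\{g\in X: 0\le g\}$ is closed and generating ($X=X_+-X_+$), and whose norm is additive on $X_+$, i.e. $\|g+h\|=\|g\|+\|h\|$ for $g,h\in X_+$. Let $\mathbb R_+=[0,\infty)$ with Lebesgue measure; "a.a. $t$" and "measurable" refer to it. For a linear operator $T:\mathcal D(T)\subset X\to X$ let $T^0=I$, $\mathcal D(T^0)=X$, $\mathcal D(T^{k+1})=\{g\in\mathcal D(T^k):T^kg\in\mathcal D(T)\}$, $T^{k+1}g=T(T^kg)$, and put $\mathcal D_+(T^k)=\mathcal D(T^k)\cap X_+$, $\mathcal D_+(T^\infty)=\bigcap_{k}\mathcal D(T^k)\cap X_+$. A map $\Gamma$ is isotone if $g\le h$ implies $\Gamma g\le\Gamma h$ on its domain. **Nonlinear operators.** Let $\mathcal D\subset X_+$ be non-empty, dense in $X_+$, and positively saturated ($h\in\mathcal D$, $0\le g\le h$ imply $g\in\mathcal D$). Let $Q^{\pm}:\mathbb R_+\times\mathcal D\to X_+$ be such that $t\mapsto Q^\pm(t,g(t))$ is measurable for every measurable $g:\mathbb R_+\to X_+$ with $g(t)\in\mathcal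 D$ a.e., and such that for a.a. $t\ge0$ each of $Q^\pm(t,\cdot)$ is isotone and closed with respect to the order: if $g_n\in\mathcal D$ is an increasing sequence with $g_n\to g$ and $Q^\pm(t,g_n)\to h$ in $X$, then $g\in\mathcal D$ and $Q^\pm(t,g)=h$. **Assumptions.** Let $\Lambda:\mathcal D(\Lambda)\subset X\to X$ be a linear operator such that $-\Lambda$ is the infinitesimal generator of a positive $C_0$ semigroup on $X$, $\mathcal D_+(\Lambda)\subset\mathcal D$, and $Q^\pm(t,\mathcal D_+(\Lambda^k))\subset\mathcal D_+(\Lambda^{k-1})$ for a.a. $t\ge0$, $k=2,3$. Assume: - $(A_0)$ there is $\lambda_0>0$ with $\lambda_0g\le\Lambda g$ for all $g\in\mathcal D_+(\Lambda)$; - $(A_1)$ there is a nonnegative, non-decreasing, convex function $a:\mathbb R_+\to\mathbb R_+$ such that for a.a. $t\ge0$: $0\le Q^-(t,g)\le a(\|\Lambda g\|)\Lambda g$ for all $g\in\mathcal D_+(\Lambda)$, and $\mathcal D_+(\Lambda)\ni g\mapsto a(\|\Lambda g\|)\Lambda g-Q^-(t,g)$ is isotone; - $(A_2)$ for a.a.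 $t\ge0$, $\Delta(t,g):=\|\Lambda Q^-(t,g)\|-\|\Lambda Q^+(t,g)\|\ge0$ for all $g\in\mathcal D_+(\Lambda^2)$, and $\mathcal D_+(\Lambda^2)\ni g\mapsto\Delta(t,g)$ is isotone; - $(A_3)$ there are a nonnegative non-decreasing $\rho:\mathbb R_+\to\mathbb R_+$ and an operator $\Lambda_1:\mathcal D(\Lambda_1)\subset X_+\to X_+$, linear (additive and positively homogeneous) on the convex cone $\mathcal D(\Lambda_1)$ and closed (its graph is closed in $X\times X$), with $\mathcal D_+(\Lambda)\subset\mathcal D(\Lambda_1)$, such that for a.a. $t\ge0$: $\|\Lambda_1Q^-(t,g)\|-\|\Lambda_1Q^+(t,g)\|\ge0$ for all $g\in\mathcal D_+(\Lambda^2)$, and $\|\Lambda^2Q^+(t,g)\|\le\|\Lambda^2Q^-(t,g)\|+\rho(\|\Lambda_1g\|)\,\|\Lambda^2g\|$ for all $g\in\mathcal D_+(\Lambda^3)$. **Corollary 3.1.** Let $\{U^t\}_{t\in\mathbb R}$ be a $C_0$ group of positive linear operators on $X$, isometric on $X_+$ ($\|U^tg\|=\|g\|$ for $g\in X_+$), with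 infinitesimal generator $A$. Suppose $U^t\mathcal D(\Lambda)=\mathcal D(\Lambda)$ and $U^t\mathcal D(\Lambda_1)=\mathcal D(\Lambda_1)$ for all $t\in\mathbb R$, and that for each $t>0$, $U^t\Lambda=\Lambda U^t$ on $\mathcal D(\Lambda)$ and $U^t\Lambda_1=\Lambda_1U^t$ on $\mathcal D(\Lambda_1)$. Suppose further that $Q^+(t,\mathcal D_+(\Lambda^\infty))\subset\mathcal D_+(\Lambda^\infty)$ for a.a. $t\ge0$, and that $t\mapsto\Lambda^kQ^+(t,U^tg)$ is locally Bochner integrable on $\mathbb R_+$ for every $g\in\mathcal D_+(\Lambda^\infty)$ and $k=1,2,\dots$. Let $f_0\in\mathcal D_+(\Lambda^2)$. Then the Cauchy problem $$\frac{d}{dt}f(t)=Af+Q^+(t,f(t))-Q^-(t,f(t)),\qquad f(0)=f_0,\quad t\ge0,$$ has a positive global mild solution, i.e. a continuous $f:\mathbb R_+\to X_+$ with $$f(t)=U^tf_0+\int_0^tU^{t-s}\bigl[Q^+(s,f(s))-Q^-(s,f(s))\bigr]ds\qquad\text{for all }t\ge0$$ (Bochner integral), such that $f(t)\in\mathcal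 D_+(\Lambda^2)$ for all $t\ge0$ and $\|\Lambda^2f(\cdot)\|$ is locally bounded on $\mathbb R_+$; and it is the unique positive mild solution with these two properties. Moreover $\Lambda f\in C(\mathbb R_+;X_+)$, the function $s\mapsto\Delta(s,f(s))$ is locally integrable, and for all $t\ge0$ $$\|\Lambda f(t)\|+\int_0^t\Delta(s,f(s))\,ds=\|\Lambda f_0\|,\qquad \|\Lambda^2f(t)\|\le\|\Lambda^2f_0\|\exp\bigl(\rho(\|\Lambda_1f_0\|)\,t\bigr).$$ -/

import Mathlib

open Set Filter Topology MeasureTheory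
open scoped NNReal

noncomputable section

namespace OrderedEvolution

variable {X : Type*} [NormedAddCommGroup X] [NormedSpace ℝ X]

/-! ### Semigroups, groups, generators -/

/-- `{S^t}_{t ≥ 0}` is a `C₀` semigroup of bounded operators on `X`
(the values at negative times are irrelevant). -/
structure IsC0Semigroup (S : ℝ → X →L[ℝ] X) : Prop where
  zero : S 0 = ContinuousLinearMap.id ℝ X
  add : ∀ s t : ℝ, 0 ≤ s → 0 ≤ t → S (s + t) = (S s).comp (S t)
  tendsto : ∀ g : X, Tendsto (fun t : ℝ => S t g) (𝓝[>] 0) (𝓝 g)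

/-- `{U^t}_{t ∈ ℝ}` is a `C₀` group of bounded operators on `X`. -/
structure IsC0Group (U : ℝ → X →L[ℝ] X) : Prop where
  zero : U 0 = ContinuousLinearMap.id ℝ X
  add : ∀ s t : ℝ, U (s + t) = (U s).comp (U t)
  tendsto : ∀ g : X, Tendsto (fun t : ℝ => U t g) (𝓝 0) (𝓝 g)

/-- `G` is the infinitesimal generator of the semigroup `S`: its domain consists of exactly those
`g` for which `t⁻¹ (S^t g - g)` converges as `t → 0+`, and `G g` is this limit. -/
def IsSemigroupGenerator (S : ℝ → X →L[ℝ] X) (G : X →ₗ.[ℝ] X) : Prop :=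
  ∀ g h : X, (g, h) ∈ G.graph ↔
    Tendsto (fun t : ℝ => t⁻¹ • (S t g - g)) (𝓝[>] 0) (𝓝 h)

/-- `A` is the infinitesimal generator of the group `U` (limit as `t → 0`, `t ≠ 0`). -/
def IsGroupGenerator (U : ℝ → X →L[ℝ] X) (A : X →ₗ.[ℝ] X) : Prop :=
  ∀ g h : X, (g, h) ∈ A.graph ↔
    Tendsto (fun t : ℝ => t⁻¹ • (U t g - g)) (𝓝[≠] 0) (𝓝 h)

/-! ### Partially defined operators and their powers -/

open Classical in
/-- The value `T g` for `g` in the domain of `T` (and `0` otherwise). -/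
def ev (T : X →ₗ.[ℝ] X) (g : X) : X := if h : g ∈ T.domain then T ⟨g, h⟩ else 0

/-- The value `T^k g`, meaningful for `g` in the domain of `T^k`. -/
def evPow (T : X →ₗ.[ℝ] X) : ℕ → X → X
  | 0 => fun g => g
  | k + 1 => fun g => ev T (evPow T k g)

/-- The domain of `T^k`: `𝒟(T^0) = X` and
`𝒟(T^(k+1)) = {g ∈ 𝒟(T^k) : T^k g ∈ 𝒟(T)}`. -/
def domPow (T : X →ₗ.[ℝ] X) : ℕ → Set X
  | 0 => univ
  | k + 1 => {g | g ∈ domPow T k ∧ evPow T k g ∈ T.domain}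

open Classical in
/-- The value `Γ g` of an operator defined on a convex cone `C` (and `0` off `C`). -/
def evCone {C : Submodule ℝ≥0 X} (Γ : C →ₗ[ℝ≥0] X) (g : X) : X :=
  if h : g ∈ C then Γ ⟨g, h⟩ else 0

variable [PartialOrder X]

/-- `𝒟₊(T^k) = 𝒟(T^k) ∩ X₊`. -/
def domPowPos (T : X →ₗ.[ℝ] X) (k : ℕ) : Set X := {g | g ∈ domPow T k ∧ 0 ≤ g}

/-- `𝒟₊(T^∞) = (⋂ₖ 𝒟(T^k)) ∩ X₊`. -/
def domTopPos (T : X →ₗ.[ℝ] X) : Set X := {g | (∀ k : ℕ, g ∈ domPow T k) ∧ 0 ≤ g}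

/-! ### Order notions -/

/-- A positively saturated set. -/
def PSaturated (M : Set X) : Prop :=
  M.Nonempty ∧ ∀ h ∈ M, ∀ g : X, 0 ≤ g → g ≤ h → g ∈ M

/-- The operator `Γ` with domain `M` is closed with respect to the order. -/
def OClosed (Γ : X → X) (M : Set X) : Prop :=
  ∀ (u : ℕ → X) (g h : X), (∀ n, u n ∈ M) → Monotone u →
    Tendsto u atTop (𝓝 g) → Tendsto (fun n => Γ (u n)) atTop (𝓝 h) → g ∈ M ∧ Γ g = h

/-! ### Assumptions on the equation -/

/-- The standing assumptions on the space: the positive cone is closed and generating, and the norm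
is additive on it. -/
structure SpaceAssumptions (X : Type*) [NormedAddCommGroup X] [PartialOrder X] : Prop where
  isClosed_cone : IsClosed {g : X | 0 ≤ g}
  generating : ∀ x : X, ∃ g h : X, 0 ≤ g ∧ 0 ≤ h ∧ x = g - h
  norm_add : ∀ g h : X, 0 ≤ g → 0 ≤ h → ‖g + h‖ = ‖g‖ + ‖h‖

/-- Lebesgue measure on `ℝ₊ = [0, ∞)`. -/
def lebPos : Measure ℝ := volume.restrict (Ici (0 : ℝ))

/-- The general assumptions on one of the nonlinear operators `Q⁺`, `Q⁻`, which is a map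
`ℝ₊ × 𝒟 → X₊` (its values elsewhere are irrelevant). -/
structure GeneralAssumptions (𝒟 : Set X) (Q : ℝ → X → X) : Prop where
  nonneg : ∀ t : ℝ, 0 ≤ t → ∀ g ∈ 𝒟, 0 ≤ Q t g
  measurable : ∀ g : ℝ → X, AEStronglyMeasurable g lebPos → (∀ t : ℝ, 0 ≤ t → 0 ≤ g t) →
    (∀ᵐ t ∂lebPos, g t ∈ 𝒟) → AEStronglyMeasurable (fun t => Q t (g t)) lebPos
  isotone : ∀ᵐ t ∂lebPos, MonotoneOn (Q t) 𝒟
  oclosed : ∀ᵐ t ∂lebPos, OClosed (Q t) 𝒟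

/-- The common domain `𝒟` of `Q^±(t, ·)` is a dense, p-saturated part of `X₊`. -/
structure DomainAssumptions (𝒟 : Set X) : Prop where
  nonneg : ∀ g ∈ 𝒟, 0 ≤ g
  dense : ∀ g : X, 0 ≤ g → g ∈ closure 𝒟
  psaturated : PSaturated 𝒟

/-- `-Λ` generates a positive `C₀` semigroup, `𝒟₊(Λ) ⊆ 𝒟` and
`Q^±(t, 𝒟₊(Λ^k)) ⊆ 𝒟₊(Λ^(k-1))` for a.a. `t ≥ 0` and `k = 2, 3`. -/
structure OperatorAssumption (𝒟 : Set X) (Qp Qm : ℝ → X → X) (Λ : X →ₗ.[ℝ] X) : Prop where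
  generator : ∃ S : ℝ → X →L[ℝ] X, IsC0Semigroup S ∧
    (∀ t : ℝ, 0 ≤ t → ∀ g : X, 0 ≤ g → 0 ≤ S t g) ∧ IsSemigroupGenerator S (-Λ)
  dom_subset : domPowPos Λ 1 ⊆ 𝒟
  mapsTo_plus : ∀ k ∈ ({2, 3} : Set ℕ), ∀ᵐ t ∂lebPos,
    MapsTo (Qp t) (domPowPos Λ k) (domPowPos Λ (k - 1))
  mapsTo_minus : ∀ k ∈ ({2, 3} : Set ℕ), ∀ᵐ t ∂lebPos,
    MapsTo (Qm t) (domPowPos Λ k) (domPowPos Λ (k - 1))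

/-- Strict positivity of `Λ`: `λ₀ g ≤ Λ g` on `𝒟₊(Λ)`. -/
structure AssumptionA0 (Λ : X →ₗ.[ℝ] X) (lam0 : ℝ) : Prop where
  pos : 0 < lam0
  le : ∀ g ∈ domPowPos Λ 1, lam0 • g ≤ ev Λ g

/-- Control of the loss term `Q⁻` by `Λ`. -/
structure AssumptionA1 (Qm : ℝ → X → X) (Λ : X →ₗ.[ℝ] X) (a : ℝ → ℝ) : Prop where
  nonneg : ∀ x : ℝ, 0 ≤ x → 0 ≤ a x
  mono : MonotoneOn a (Ici 0)
  convex : ConvexOn ℝ (Ici 0) a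
  bound : ∀ᵐ t ∂lebPos, ∀ g ∈ domPowPos Λ 1, 0 ≤ Qm t g ∧ Qm t g ≤ a ‖ev Λ g‖ • ev Λ g
  isotone : ∀ᵐ t ∂lebPos, MonotoneOn (fun g => a ‖ev Λ g‖ • ev Λ g - Qm t g) (domPowPos Λ 1)

/-- `Δ(t, g) = ‖Λ Q⁻(t, g)‖ - ‖Λ Q⁺(t, g)‖`. -/
def Delta (Qp Qm : ℝ → X → X) (Λ : X →ₗ.[ℝ] X) (t : ℝ) (g : X) : ℝ :=
  ‖ev Λ (Qm t g)‖ - ‖ev Λ (Qp t g)‖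

/-- Dissipation: `Δ(t, ·)` is nonnegative and isotone on `𝒟₊(Λ²)`. -/
structure AssumptionA2 (Qp Qm : ℝ → X → X) (Λ : X →ₗ.[ℝ] X) : Prop where
  nonneg : ∀ᵐ t ∂lebPos, ∀ g ∈ domPowPos Λ 2, 0 ≤ Delta Qp Qm Λ t g
  isotone : ∀ᵐ t ∂lebPos, MonotoneOn (Delta Qp Qm Λ t) (domPowPos Λ 2)

/-- The Povzner-type assumption. Here `Λ₁ : 𝒟(Λ₁) ⊆ X₊ → X₊` is closed and linear (additive and
positively homogeneous) on the convex cone `D₁ = 𝒟(Λ₁)`. -/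
structure AssumptionA3 (Qp Qm : ℝ → X → X) (Λ : X →ₗ.[ℝ] X) (D₁ : Submodule ℝ≥0 X)
    (Λ₁ : D₁ →ₗ[ℝ≥0] X) (ρ : ℝ → ℝ) : Prop where
  rho_nonneg : ∀ x : ℝ, 0 ≤ x → 0 ≤ ρ x
  rho_mono : MonotoneOn ρ (Ici 0)
  dom_nonneg : ∀ g ∈ D₁, 0 ≤ g
  nonneg : ∀ g : D₁, 0 ≤ Λ₁ g
  closed : IsClosed {p : X × X | ∃ g : D₁, (g : X) = p.1 ∧ Λ₁ g = p.2}
  dom_subset : domPowPos Λ 1 ⊆ (D₁ : Set X)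
  dissipative : ∀ᵐ t ∂lebPos, ∀ g ∈ domPowPos Λ 2,
    0 ≤ ‖evCone Λ₁ (Qm t g)‖ - ‖evCone Λ₁ (Qp t g)‖
  povzner : ∀ᵐ t ∂lebPos, ∀ g ∈ domPowPos Λ 3,
    ‖evPow Λ 2 (Qp t g)‖ ≤ ‖evPow Λ 2 (Qm t g)‖ + ρ ‖evCone Λ₁ g‖ * ‖evPow Λ 2 g‖

/-! ### Solutions -/

/-- `f` is a positive mild solution on `ℝ₊` of
`df/dt = A f + Q⁺(t, f) - Q⁻(t, f)`, `f(0) = f₀`, where `A` generates the group `U`. -/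
structure IsMildSolution (U : ℝ → X →L[ℝ] X) (𝒟 : Set X) (Qp Qm : ℝ → X → X) (f₀ : X)
    (f : ℝ → X) : Prop where
  continuousOn : ContinuousOn f (Ici 0)
  nonneg : ∀ t : ℝ, 0 ≤ t → 0 ≤ f t
  mem_dom : ∀ᵐ t ∂lebPos, f t ∈ 𝒟
  integrable : ∀ t : ℝ, 0 ≤ t →
    IntervalIntegrable (fun s => U (t - s) (Qp s (f s) - Qm s (f s))) volume 0 t
  eq : ∀ t : ℝ, 0 ≤ t →
    f t = U t f₀ + ∫ s in (0 : ℝ)..t, U (t - s) (Qp s (f s) - Qm s (f s))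

/-- The class in which the mild solution is unique: `f(t) ∈ 𝒟₊(Λ²)` for all `t ≥ 0`, and
`‖Λ² f(·)‖` is locally bounded on `ℝ₊`. -/
structure IsRegularMildSolution (U : ℝ → X →L[ℝ] X) (𝒟 : Set X) (Qp Qm : ℝ → X → X)
    (Λ : X →ₗ.[ℝ] X) (f₀ : X) (f : ℝ → X) : Prop where
  mild : IsMildSolution U 𝒟 Qp Qm f₀ f
  mem : ∀ t : ℝ, 0 ≤ t → f t ∈ domPowPos Λ 2
  locBdd : ∀ T : ℝ, BddAbove ((fun t => ‖evPow Λ 2 (f t)‖) '' Icc 0 T)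

end OrderedEvolution

end

/-!
The group is removed by the substitution `f(t) = Uᵗ φ(t)`: since `U` commutes with `Λ` and `Λ₁` and
preserves order and norm on the cone, `φ` has to solve `φ' = P⁺(t, φ) - P⁻(t, φ)` with
`P^±(t, g) = U⁻ᵗ Q^±(t, Uᵗ g)`, and these operators satisfy the same hypotheses
(`ReducedModel`, `reducedModel_pull`, `mild_eq_iff`). By `(A₀)` the operator `Λ` has a bounded
positive inverse `R`, and `𝒟₊(Λᵏ) = Rᵏ X₊` (`exists_resolventSystem`, `domPowPos_eq_conePow`).
On the closed generating cone the additive norm is the restriction of a bounded linear functional,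
and so is `x ↦ ‖Λ₁ R x‖ =: κ(x)` (`exists_mass`, `exists_functional`);
increasing norm-bounded sequences converge.

Existence. Formally every solution satisfies `‖Λ φ(t)‖ + ∫₀ᵗ Δ(s, φ(s)) ds = M`, where
`M = ‖Λ f₀‖`. The equation is therefore rewritten as
`φ' + a(M) Λ φ = P⁺(t, φ) + [a(‖Λ φ‖ + ∫₀ᵗ Δ(s, φ(s)) ds) Λ φ - P⁻(t, φ)]`,
whose right-hand side is nonnegative and isotone: this is where `(A₁)`, the convexity of `a`, and
the isotonicity of `Δ` enter (`source_mono`). Its mild form with respect to the semigroup of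
`-a(M) Λ` is iterated from zero, with increasing smooth data below `f₀` (`exists_smooth_approx`).
The iterates increase, keep `‖Λ φₙ₊₁‖ + ∫ Δ(s, φₙ) ≤ M`, do not increase `κ(Λ φ)`, and obey
`‖Λ² φₙ(t)‖ ≤ ‖Λ² f₀‖ exp(ρ(‖Λ₁ f₀‖) t)` by the Povzner-type estimate (`admissible_step`). Their
limit solves the rewritten equation, and its defect `M - (‖Λ φ‖ + ∫ Δ)` is bounded by a multiple of
its own integral, because a convex `a` has bounded difference quotients below `M`. By Gronwall the
defect vanishes, so the limit solves the original equation (`exists_minimal_solution`).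

Uniqueness. A regular solution `F` satisfies the conservation law (`energy_eq`), hence also the
rewritten equation, and dominates every iterate, hence the solution `φ` constructed above. As both
have the same conserved quantity and `Δ` is isotone, `‖Λ F‖ ≤ ‖Λ φ‖`, which together with `φ ≤ F`
forces `F = φ` (`eq_of_le`).
-/

set_option linter.unusedSectionVars false

noncomputable section

namespace OrderedEvolution

section

variable {X : Type*} [NormedAddCommGroup X] [NormedSpace ℝ X] [PartialOrder X]
  [IsOrderedAddMonoid X]

/-! ### Ordered Banach spaces with a norm that is additive on the cone -/

theorem SpaceAssumptions.orderClosedTopology (hX : SpaceAssumptions X) :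
    OrderClosedTopology X where
  isClosed_le' := by
    have : {p : X × X | p.1 ≤ p.2} = (fun p : X × X => p.2 - p.1) ⁻¹' {g : X | 0 ≤ g} := by
      ext p; simp
    rw [this]
    exact hX.isClosed_cone.preimage (by fun_prop)

theorem SpaceAssumptions.norm_sub (hX : SpaceAssumptions X) {g h : X} (hg : 0 ≤ g) (hgh : g ≤ h) :
    ‖h - g‖ = ‖h‖ - ‖g‖ := by
  have := hX.norm_add g (h - g) hg (sub_nonneg.2 hgh)
  rw [add_sub_cancel] at this
  linarith

theorem SpaceAssumptions.norm_le (hX : SpaceAssumptions X) {g h : X} (hg : 0 ≤ g) (hgh : g ≤ h) :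
    ‖g‖ ≤ ‖h‖ := by
  have := hX.norm_sub hg hgh
  linarith [norm_nonneg (h - g)]

/-- A function that is additive and positively homogeneous on the cone is the restriction of a
linear map. -/
theorem SpaceAssumptions.exists_linear_extension {Y : Type*} [AddCommGroup Y] [Module ℝ Y]
    [IsOrderedModule ℝ X]
    (hX : SpaceAssumptions X) (φ : X → Y) (hadd : ∀ g h, 0 ≤ g → 0 ≤ h → φ (g + h) = φ g + φ h)
    (hsmul : ∀ (r : ℝ) g, 0 ≤ r → 0 ≤ g → φ (r • g) = r • φ g) :
    ∃ ψ : X →ₗ[ℝ] Y, ∀ g, 0 ≤ g → ψ g = φ g := by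
  choose p q hp hq hpq using hX.generating
  have key : ∀ x g h : X, 0 ≤ g → 0 ≤ h → x = g - h → φ (p x) - φ (q x) = φ g - φ h := by
    intro x g h hg hh hx
    have h1 : p x + h = g + q x := by
      have := (hpq x).symm.trans hx
      rw [sub_eq_sub_iff_add_eq_add] at this
      rw [this]
    have h2 := congrArg φ h1
    rw [hadd _ _ (hp x) hh, hadd _ _ hg (hq x)] at h2
    rw [sub_eq_sub_iff_add_eq_add, h2]
  have h0 : φ 0 = 0 := by simpa using hsmul 0 0 le_rfl le_rfl
  refine ⟨{ toFun := fun x => φ (p x) - φ (q x), map_add' := ?_, map_smul' := ?_ }, ?_⟩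
  · intro x y
    rw [key (x + y) (p x + p y) (q x + q y) (add_nonneg (hp x) (hp y)) (add_nonneg (hq x) (hq y))
      (by conv_lhs => rw [hpq x, hpq y]
          abel), hadd _ _ (hp x) (hp y), hadd _ _ (hq x) (hq y)]
    abel
  · intro r x
    rcases le_total 0 r with hr | hr
    · rw [key (r • x) (r • p x) (r • q x) (smul_nonneg hr (hp x)) (smul_nonneg hr (hq x))
        (by conv_lhs => rw [hpq x]
            rw [smul_sub]), hsmul _ _ hr (hp x), hsmul _ _ hr (hq x)]
      simp [smul_sub]
    · have hr' : 0 ≤ -r := neg_nonneg.2 hr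
      rw [key (r • x) ((-r) • q x) ((-r) • p x) (smul_nonneg hr' (hq x)) (smul_nonneg hr' (hp x))
        (by conv_lhs => rw [hpq x]
            rw [smul_sub, neg_smul, neg_smul]; abel), hsmul _ _ hr' (hp x), hsmul _ _ hr' (hq x)]
      simp only [RingHom.id_apply]
      module
  · intro g hg
    have := key g g 0 hg le_rfl (by simp)
    simpa [h0] using this

variable [IsOrderedModule ℝ X]

/-- The norm on the cone extends to a continuous linear functional on the space. -/
theorem SpaceAssumptions.exists_mass (hX : SpaceAssumptions X) :
    ∃ ℓ : X →L[ℝ] ℝ, ∀ g, 0 ≤ g → ℓ g = ‖g‖ := by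
  obtain ⟨ψ, hψ⟩ := hX.exists_linear_extension (fun g => ‖g‖) hX.norm_add (by
    intro r g hr _
    simp [norm_smul, abs_of_nonneg hr])
  refine ⟨ψ.mkContinuous 1 ?_, hψ⟩
  intro x
  obtain ⟨g, h, hg, hh, rfl⟩ := hX.generating x
  rw [map_sub, hψ g hg, hψ h hh, one_mul]
  exact abs_norm_sub_norm_le g h

/-- An increasing sequence in the cone with bounded norms converges. -/
theorem SpaceAssumptions.exists_tendsto_of_monotone [CompleteSpace X] (hX : SpaceAssumptions X)
    {u : ℕ → X} (hu : Monotone u) (h0 : ∀ n, 0 ≤ u n) {C : ℝ} (hC : ∀ n, ‖u n‖ ≤ C) :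
    ∃ g, Tendsto u atTop (𝓝 g) := by
  have hmono : Monotone fun n => ‖u n‖ := fun m n hmn => hX.norm_le (h0 m) (hu hmn)
  have hcau : CauchySeq fun n => ‖u n‖ :=
    (tendsto_atTop_ciSup hmono ⟨C, by rintro _ ⟨n, rfl⟩; exact hC n⟩).cauchySeq
  have : CauchySeq u := by
    rw [Metric.cauchySeq_iff'] at hcau ⊢
    intro ε hε
    obtain ⟨N, hN⟩ := hcau ε hε
    refine ⟨N, fun n hn => ?_⟩
    have h1 := hN n hn
    rw [dist_eq_norm, hX.norm_sub (h0 N) (hu hn)]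
    rw [Real.dist_eq] at h1
    exact lt_of_le_of_lt (le_abs_self _) h1
  exact cauchySeq_tendsto_of_complete this

/-- A decreasing sequence in the cone converges. -/
theorem SpaceAssumptions.exists_tendsto_of_antitone [CompleteSpace X] (hX : SpaceAssumptions X)
    {u : ℕ → X} (hu : Antitone u) (h0 : ∀ n, 0 ≤ u n) :
    ∃ g, Tendsto u atTop (𝓝 g) := by
  obtain ⟨g, hg⟩ := hX.exists_tendsto_of_monotone (u := fun n => u 0 - u n) (C := ‖u 0‖)
    (fun m n hmn => sub_le_sub_left (hu hmn) _) (fun n => sub_nonneg.2 (hu (Nat.zero_le n)))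
    (fun n => hX.norm_le (sub_nonneg.2 (hu (Nat.zero_le n))) (sub_le_self _ (h0 n)))
  refine ⟨u 0 - g, ?_⟩
  have := (tendsto_const_nhds (x := u 0)).sub hg
  simpa using this

/-- Approximate decomposition, by the Baire category theorem. -/
theorem SpaceAssumptions.exists_approx_decomposition [CompleteSpace X] (hX : SpaceAssumptions X) :
    ∃ C : ℝ, 0 ≤ C ∧ ∀ (x : X) (ε : ℝ), 0 < ε →
      ∃ g h : X, 0 ≤ g ∧ 0 ≤ h ∧ ‖g‖ ≤ C * ‖x‖ ∧ ‖h‖ ≤ C * ‖x‖ ∧ ‖x - (g - h)‖ ≤ ε := by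
  let B : ℕ → Set X := fun n => {x | ∃ g h : X, 0 ≤ g ∧ 0 ≤ h ∧ ‖g‖ ≤ n ∧ ‖h‖ ≤ n ∧ x = g - h}
  have hcover : ⋃ n, closure (B n) = univ := by
    rw [eq_univ_iff_forall]
    intro x
    obtain ⟨g, h, hg, hh, hx⟩ := hX.generating x
    obtain ⟨n, hn⟩ := exists_nat_ge (max ‖g‖ ‖h‖)
    exact mem_iUnion.2 ⟨n, subset_closure ⟨g, h, hg, hh, (le_max_left _ _).trans hn,
      (le_max_right _ _).trans hn, hx⟩⟩
  obtain ⟨n, x₀, hx₀⟩ := nonempty_interior_of_iUnion_of_closed (fun n => isClosed_closure) hcover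
  rw [mem_interior_iff_mem_nhds, Metric.mem_nhds_iff] at hx₀
  obtain ⟨r, hr, hball⟩ := hx₀
  have happ : ∀ y : X, ‖y‖ < r → ∀ ε : ℝ, 0 < ε →
      ∃ g h : X, 0 ≤ g ∧ 0 ≤ h ∧ ‖g‖ ≤ n ∧ ‖h‖ ≤ n ∧ ‖y - (g - h)‖ ≤ ε := by
    intro y hy ε hε
    have h1 : x₀ + y ∈ closure (B n) := hball (by simpa [dist_eq_norm] using hy)
    have h2 : x₀ - y ∈ closure (B n) := hball (by simpa [dist_eq_norm] using hy)
    rw [Metric.mem_closure_iff] at h1 h2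
    obtain ⟨_, ⟨g₁, h₁, hg₁, hh₁, hgn₁, hhn₁, rfl⟩, hd₁⟩ := h1 ε hε
    obtain ⟨_, ⟨g₂, h₂, hg₂, hh₂, hgn₂, hhn₂, rfl⟩, hd₂⟩ := h2 ε hε
    have half : ∀ u v : X, ‖u‖ ≤ n → ‖v‖ ≤ n → ‖(1 / 2 : ℝ) • (u + v)‖ ≤ n := by
      intro u v hu hv
      rw [norm_smul]
      have := norm_add_le u v
      norm_num
      linarith
    refine ⟨(1 / 2 : ℝ) • (g₁ + h₂), (1 / 2 : ℝ) • (h₁ + g₂),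
      smul_nonneg (by norm_num) (add_nonneg hg₁ hh₂),
      smul_nonneg (by norm_num) (add_nonneg hh₁ hg₂),
      half _ _ hgn₁ hhn₂, half _ _ hhn₁ hgn₂, ?_⟩
    have : y - ((1 / 2 : ℝ) • (g₁ + h₂) - (1 / 2 : ℝ) • (h₁ + g₂)) =
        (1 / 2 : ℝ) • ((x₀ + y - (g₁ - h₁)) - (x₀ - y - (g₂ - h₂))) := by
      module
    rw [this, norm_smul]
    rw [dist_eq_norm] at hd₁ hd₂
    have := norm_sub_le (x₀ + y - (g₁ - h₁)) (x₀ - y - (g₂ - h₂))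
    norm_num
    linarith
  refine ⟨n * (2 / r), by positivity, fun x ε hε => ?_⟩
  rcases eq_or_ne x 0 with rfl | hx
  · exact ⟨0, 0, le_rfl, le_rfl, by simp, by simp, by simpa using hε.le⟩
  have hxn : 0 < ‖x‖ := norm_pos_iff.2 hx
  have hs : 0 < 2 * ‖x‖ / r := by positivity
  obtain ⟨g, h, hg, hh, hgn, hhn, hd⟩ := happ ((2 * ‖x‖ / r)⁻¹ • x) (by
    rw [norm_smul, norm_inv, Real.norm_of_nonneg hs.le]
    field_simp
    norm_num) ((2 * ‖x‖ / r)⁻¹ * ε) (by positivity)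
  refine ⟨(2 * ‖x‖ / r) • g, (2 * ‖x‖ / r) • h, smul_nonneg hs.le hg, smul_nonneg hs.le hh,
    ?_, ?_, ?_⟩
  · rw [norm_smul, Real.norm_of_nonneg hs.le]
    calc 2 * ‖x‖ / r * ‖g‖ ≤ 2 * ‖x‖ / r * n := by gcongr
      _ = n * (2 / r) * ‖x‖ := by ring
  · rw [norm_smul, Real.norm_of_nonneg hs.le]
    calc 2 * ‖x‖ / r * ‖h‖ ≤ 2 * ‖x‖ / r * n := by gcongr
      _ = n * (2 / r) * ‖x‖ := by ring
  · have : x - ((2 * ‖x‖ / r) • g - (2 * ‖x‖ / r) • h) =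
        (2 * ‖x‖ / r) • ((2 * ‖x‖ / r)⁻¹ • x - (g - h)) := by
      rw [smul_sub, smul_inv_smul₀ hs.ne', smul_sub]
    rw [this, norm_smul, Real.norm_of_nonneg hs.le]
    calc 2 * ‖x‖ / r * ‖(2 * ‖x‖ / r)⁻¹ • x - (g - h)‖
        ≤ 2 * ‖x‖ / r * ((2 * ‖x‖ / r)⁻¹ * ε) := by gcongr
      _ = ε := by rw [mul_inv_cancel_left₀ hs.ne']

/-- Every element is the difference of two positive ones whose norms are controlled by its own
(the theorem of Krein and Šmulian on generating closed cones). -/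
theorem SpaceAssumptions.exists_decomposition [CompleteSpace X] (hX : SpaceAssumptions X) :
    ∃ C : ℝ, 0 ≤ C ∧ ∀ x : X,
      ∃ g h : X, 0 ≤ g ∧ 0 ≤ h ∧ ‖g‖ ≤ C * ‖x‖ ∧ ‖h‖ ≤ C * ‖x‖ ∧ x = g - h := by
  have := hX.orderClosedTopology
  obtain ⟨C, hC, happ⟩ := hX.exists_approx_decomposition
  refine ⟨C * 2, by positivity, fun x => ?_⟩
  rcases eq_or_ne x 0 with rfl | hx
  · exact ⟨0, 0, le_rfl, le_rfl, by simp, by simp, by simp⟩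
  have hxn : 0 < ‖x‖ := norm_pos_iff.2 hx
  have hε : ∀ k : ℕ, 0 < ‖x‖ * (1 / 2 : ℝ) ^ (k + 1) := fun k => by positivity
  choose G H hG hH hGn hHn hd using happ
  -- the successive remainders of the approximation
  let y : ℕ → X := fun k => Nat.rec x (fun k z => z - (G z _ (hε k) - H z _ (hε k))) k
  have hy0 : y 0 = x := rfl
  have hys : ∀ k, y (k + 1) = y k - (G (y k) _ (hε k) - H (y k) _ (hε k)) := fun k => rfl
  have hyn : ∀ k, ‖y k‖ ≤ ‖x‖ * (1 / 2 : ℝ) ^ k := by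
    intro k
    cases k with
    | zero => simp [hy0]
    | succ k => rw [hys]; exact hd _ _ _
  let g : ℕ → X := fun k => G (y k) _ (hε k)
  let h : ℕ → X := fun k => H (y k) _ (hε k)
  have hgeo : HasSum (fun k : ℕ => C * (‖x‖ * (1 / 2 : ℝ) ^ k)) (C * (‖x‖ * 2)) :=
    (hasSum_geometric_two.mul_left _).mul_left _
  have hgn : ∀ k, ‖g k‖ ≤ C * (‖x‖ * (1 / 2 : ℝ) ^ k) := fun k =>
    (hGn _ _ _).trans (by gcongr; exact hyn k)
  have hhn : ∀ k, ‖h k‖ ≤ C * (‖x‖ * (1 / 2 : ℝ) ^ k) := fun k =>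
    (hHn _ _ _).trans (by gcongr; exact hyn k)
  have hgs : Summable g := Summable.of_norm_bounded hgeo.summable hgn
  have hhs : Summable h := Summable.of_norm_bounded hgeo.summable hhn
  refine ⟨∑' k, g k, ∑' k, h k, tsum_nonneg fun k => hG _ _ _, tsum_nonneg fun k => hH _ _ _,
    ?_, ?_, ?_⟩
  · calc ‖∑' k, g k‖ ≤ C * (‖x‖ * 2) := tsum_of_norm_bounded hgeo hgn
      _ = C * 2 * ‖x‖ := by ring
  · calc ‖∑' k, h k‖ ≤ C * (‖x‖ * 2) := tsum_of_norm_bounded hgeo hhn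
      _ = C * 2 * ‖x‖ := by ring
  · have hpart : ∀ n, ∑ k ∈ Finset.range n, (g k - h k) = x - y n := by
      intro n
      induction n with
      | zero => simp [hy0]
      | succ n ih => rw [Finset.sum_range_succ, ih, hys]; abel
    have hy : Tendsto y atTop (𝓝 0) := by
      refine squeeze_zero_norm hyn ?_
      have := (tendsto_pow_atTop_nhds_zero_of_lt_one (r := (1 / 2 : ℝ)) (by norm_num)
        (by norm_num)).const_mul ‖x‖
      simpa using this
    have h1 := (hgs.hasSum.sub hhs.hasSum).tendsto_sum_nat
    simp only [hpart] at h1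
    have h2 : Tendsto (fun n => x - y n) atTop (𝓝 (x - 0)) := tendsto_const_nhds.sub hy
    rw [sub_zero] at h2
    exact tendsto_nhds_unique h2 h1

/-- Operators that contract the norm on the cone are uniformly bounded. -/
theorem SpaceAssumptions.exists_norm_bound [CompleteSpace X] (hX : SpaceAssumptions X) :
    ∃ C : ℝ, 0 ≤ C ∧ ∀ T : X →L[ℝ] X, (∀ g, 0 ≤ g → ‖T g‖ ≤ ‖g‖) → ∀ x, ‖T x‖ ≤ C * ‖x‖ := by
  obtain ⟨C, hC, hdec⟩ := hX.exists_decomposition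
  refine ⟨2 * C, by positivity, fun T hT x => ?_⟩
  obtain ⟨g, h, hg, hh, hgn, hhn, hx⟩ := hdec x
  calc ‖T x‖ = ‖T g - T h‖ := by rw [← map_sub, ← hx]
    _ ≤ ‖T g‖ + ‖T h‖ := norm_sub_le _ _
    _ ≤ ‖g‖ + ‖h‖ := add_le_add (hT g hg) (hT h hh)
    _ ≤ 2 * C * ‖x‖ := by linarith

/-- A nonnegative function that is additive and positively homogeneous on the cone is the
restriction of a continuous linear functional: positivity forces continuity. -/
theorem SpaceAssumptions.exists_functional [CompleteSpace X] (hX : SpaceAssumptions X)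
    (φ : X → ℝ) (hpos : ∀ g, 0 ≤ g → 0 ≤ φ g)
    (hadd : ∀ g h, 0 ≤ g → 0 ≤ h → φ (g + h) = φ g + φ h)
    (hsmul : ∀ (r : ℝ) g, 0 ≤ r → 0 ≤ g → φ (r • g) = r • φ g) :
    ∃ κ : X →L[ℝ] ℝ, ∀ g, 0 ≤ g → κ g = φ g := by
  have := hX.orderClosedTopology
  obtain ⟨ψ, hψ⟩ := hX.exists_linear_extension φ hadd hsmul
  have hψmono : ∀ g h : X, g ≤ h → ψ g ≤ ψ h := by
    intro g h hgh
    have := hpos _ (sub_nonneg.2 hgh)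
    rw [← hψ _ (sub_nonneg.2 hgh), map_sub] at this
    linarith
  -- otherwise a convergent series of positive elements would have an infinite value
  have hbdd : ∃ K : ℝ, 0 ≤ K ∧ ∀ g, 0 ≤ g → ψ g ≤ K * ‖g‖ := by
    by_contra! hcon
    have hx : ∀ n : ℕ, ∃ g : X, 0 ≤ g ∧ ‖g‖ ≤ (1 / 2 : ℝ) ^ n ∧ 1 ≤ ψ g := by
      intro n
      obtain ⟨g, hg, hgn⟩ := hcon (2 ^ n) (by positivity)
      have hψg : 0 < ψ g := lt_of_le_of_lt (by positivity) hgn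
      refine ⟨(ψ g)⁻¹ • g, smul_nonneg (by positivity) hg, ?_, ?_⟩
      · rw [norm_smul, norm_inv, Real.norm_of_nonneg hψg.le, inv_mul_le_iff₀ hψg, one_div,
          inv_pow, ← div_eq_mul_inv, le_div_iff₀ (by positivity)]
        linarith
      · rw [map_smul, smul_eq_mul, inv_mul_cancel₀ hψg.ne']
    choose g hg hgn hg1 using hx
    have hgs : Summable g := Summable.of_norm_bounded hasSum_geometric_two.summable hgn
    obtain ⟨N, hN⟩ := exists_nat_gt (ψ (∑' k, g k))
    have h1 : ψ (∑ k ∈ Finset.range N, g k) ≤ ψ (∑' k, g k) :=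
      hψmono _ _ (hgs.sum_le_tsum _ fun k _ => hg k)
    have h2 : (N : ℝ) ≤ ψ (∑ k ∈ Finset.range N, g k) := by
      rw [map_sum]
      calc (N : ℝ) = ∑ k ∈ Finset.range N, (1 : ℝ) := by simp
        _ ≤ _ := Finset.sum_le_sum fun k _ => hg1 k
    linarith
  obtain ⟨K, hK, hbd⟩ := hbdd
  obtain ⟨C, hC, hdec⟩ := hX.exists_decomposition
  refine ⟨ψ.mkContinuous (K * C) ?_, hψ⟩
  intro x
  obtain ⟨g, h, hg, hh, hgn, hhn, rfl⟩ := hdec x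
  set r := ‖g - h‖
  have h1 := hbd g hg
  have h2 := hbd h hh
  have h3 : 0 ≤ ψ g := by rw [hψ g hg]; exact hpos g hg
  have h4 : 0 ≤ ψ h := by rw [hψ h hh]; exact hpos h hh
  have h5 : K * ‖g‖ ≤ K * (C * r) := by gcongr
  have h6 : K * ‖h‖ ≤ K * (C * r) := by gcongr
  rw [map_sub, Real.norm_eq_abs, abs_le]
  constructor <;> nlinarith

end

section

/-! ### Locally integrable functions on the half-line -/

/-- Bochner integrability on `[0, T]` for every `T ≥ 0`; the values at negative times are
irrelevant. -/
def LocIntegrable {E : Type*} [NormedAddCommGroup E] (f : ℝ → E) : Prop :=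
  ∀ T : ℝ, 0 ≤ T → IntervalIntegrable f volume 0 T

section LocIntegrable

variable {E F : Type*} [NormedAddCommGroup E] [NormedSpace ℝ E] [NormedAddCommGroup F]
  [NormedSpace ℝ F]

theorem LocIntegrable.add {f g : ℝ → E} (hf : LocIntegrable f) (hg : LocIntegrable g) :
    LocIntegrable (fun t => f t + g t) := fun T hT => (hf T hT).add (hg T hT)

theorem LocIntegrable.sub {f g : ℝ → E} (hf : LocIntegrable f) (hg : LocIntegrable g) :
    LocIntegrable (fun t => f t - g t) := fun T hT => (hf T hT).sub (hg T hT)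

theorem LocIntegrable.const_smul {f : ℝ → E} (hf : LocIntegrable f) (r : ℝ) :
    LocIntegrable (fun t => r • f t) := fun T hT => (hf T hT).smul r

theorem locIntegrable_const (x : E) : LocIntegrable (fun _ => x) :=
  fun _ _ => intervalIntegrable_const

theorem _root_.IntervalIntegrable.clm_comp {f : ℝ → E} {a b : ℝ}
    (hf : IntervalIntegrable f volume a b) (A : E →L[ℝ] F) :
    IntervalIntegrable (fun t => A (f t)) volume a b :=
  ⟨A.integrable_comp hf.1, A.integrable_comp hf.2⟩

theorem LocIntegrable.clm_comp {f : ℝ → E} (hf : LocIntegrable f) (A : E →L[ℝ] F) :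
    LocIntegrable (fun t => A (f t)) := fun T hT => (hf T hT).clm_comp A

theorem LocIntegrable.congr {f g : ℝ → E} (hf : LocIntegrable f) (h : ∀ t, 0 ≤ t → f t = g t) :
    LocIntegrable g := by
  intro T hT
  refine (hf T hT).congr ?_
  rw [uIoc_of_le hT]
  intro t ht
  exact h t ht.1.le

theorem _root_.ContinuousOn.locIntegrable {f : ℝ → E} (hf : ContinuousOn f (Ici 0)) :
    LocIntegrable f := by
  intro T hT
  refine (hf.mono ?_).intervalIntegrable
  rw [uIcc_of_le hT]
  exact fun t ht => ht.1

theorem lebPos_ae_iff {p : ℝ → Prop} : (∀ᵐ t ∂lebPos, p t) ↔ ∀ᵐ t : ℝ, 0 ≤ t → p t := by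
  rw [lebPos, ae_restrict_iff' measurableSet_Ici]
  rfl

theorem restrict_le_lebPos {T : ℝ} (hT : 0 ≤ T) :
    volume.restrict (uIoc 0 T) ≤ (lebPos : Measure ℝ) := by
  refine Measure.restrict_mono ?_ le_rfl
  rw [uIoc_of_le hT]
  exact fun t ht => ht.1.le

theorem LocIntegrable.aestronglyMeasurable {f : ℝ → E} (hf : LocIntegrable f) :
    AEStronglyMeasurable f lebPos := by
  have h0 : AEStronglyMeasurable f (volume.restrict (⋃ n : ℕ, Ioc (0 : ℝ) n)) := by
    rw [aestronglyMeasurable_iUnion_iff]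
    exact fun n => (hf n n.cast_nonneg).aestronglyMeasurable
  have hU : ⋃ n : ℕ, Ioc (0 : ℝ) n = Ioi 0 := by
    ext t
    simp only [mem_iUnion, mem_Ioc, mem_Ioi]
    exact ⟨fun ⟨_, h⟩ => h.1, fun h => (exists_nat_ge t).imp fun _ hn => ⟨h, hn⟩⟩
  rw [hU] at h0
  rwa [lebPos, ← Measure.restrict_congr_set Ioi_ae_eq_Ici]

theorem intervalIntegrable_of_norm_le {f : ℝ → E} {g : ℝ → ℝ} {T : ℝ} (hT : 0 ≤ T)
    (hf : AEStronglyMeasurable f lebPos) (hg : IntervalIntegrable g volume 0 T)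
    (h : ∀ t ∈ Icc 0 T, ‖f t‖ ≤ g t) : IntervalIntegrable f volume 0 T := by
  refine hg.mono_fun' (hf.mono_measure (restrict_le_lebPos hT)) ?_
  refine (ae_restrict_iff' measurableSet_uIoc).2 (Eventually.of_forall fun t ht => ?_)
  rw [uIoc_of_le hT] at ht
  exact h t ⟨ht.1.le, ht.2⟩

theorem LocIntegrable.norm {f : ℝ → E} (hf : LocIntegrable f) : LocIntegrable (fun t => ‖f t‖) :=
  fun T hT => (hf T hT).norm

theorem LocIntegrable.continuousOn_integral {f : ℝ → E} (hf : LocIntegrable f) :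
    ContinuousOn (fun t => ∫ s in (0 : ℝ)..t, f s) (Ici 0) := by
  intro t ht
  have ht' : (0 : ℝ) ≤ t + 1 := by have : (0 : ℝ) ≤ t := ht; linarith
  have h1 := intervalIntegral.continuousOn_primitive_interval
    ((intervalIntegrable_iff' (f := f) (μ := volume)).1 (hf (t + 1) ht'))
  rw [uIcc_of_le ht'] at h1
  have h2 := h1 t ⟨ht, by linarith⟩
  refine h2.mono_of_mem_nhdsWithin ?_
  have : Icc (0 : ℝ) (t + 1) = Ici 0 ∩ Iic (t + 1) := by ext; simp
  rw [this]
  exact inter_mem self_mem_nhdsWithin (mem_nhdsWithin_of_mem_nhds (Iic_mem_nhds (by linarith)))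

variable [PartialOrder E] [IsOrderedAddMonoid E] [IsOrderedModule ℝ E] [OrderClosedTopology E]

theorem integral_mono_cone {f g : ℝ → E} {T : ℝ} (hT : 0 ≤ T) (hf : IntervalIntegrable f volume 0 T)
    (hg : IntervalIntegrable g volume 0 T) (h : ∀ t ∈ Icc 0 T, f t ≤ g t) :
    ∫ t in (0 : ℝ)..T, f t ≤ ∫ t in (0 : ℝ)..T, g t := by
  rw [intervalIntegral.integral_of_le hT, intervalIntegral.integral_of_le hT]
  exact setIntegral_mono_on hf.1 hg.1 measurableSet_Ioc fun t ht => h t ⟨ht.1.le, ht.2⟩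

theorem integral_nonneg_cone {f : ℝ → E} {T : ℝ} (hT : 0 ≤ T) (h : ∀ t ∈ Icc 0 T, 0 ≤ f t) :
    0 ≤ ∫ t in (0 : ℝ)..T, f t := by
  rw [intervalIntegral.integral_of_le hT]
  exact integral_nonneg_of_ae ((ae_restrict_iff' measurableSet_Ioc).2
    (Eventually.of_forall fun t ht => h t ⟨ht.1.le, ht.2⟩))

theorem integral_mono_right_cone {f : ℝ → E} {t T : ℝ} (ht : 0 ≤ t) (htT : t ≤ T)
    (hf : IntervalIntegrable f volume 0 T) (h : ∀ s ∈ Icc 0 T, 0 ≤ f s) :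
    ∫ s in (0 : ℝ)..t, f s ≤ ∫ s in (0 : ℝ)..T, f s := by
  rw [intervalIntegral.integral_of_le ht, intervalIntegral.integral_of_le (ht.trans htT)]
  refine setIntegral_mono_set hf.1 ?_ (Ioc_subset_Ioc_right htT).eventuallyLE
  exact (ae_restrict_iff' measurableSet_Ioc).2
    (Eventually.of_forall fun s hs => h s ⟨hs.1.le, hs.2⟩)

end LocIntegrable

/-! ### Positive semigroups with a strictly positive generator -/

variable {X : Type*} [NormedAddCommGroup X] [NormedSpace ℝ X]

/-- The domain and the values of `Λ` are read off the difference quotients of the semigroup. -/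
theorem IsSemigroupGenerator.mem_iff {S : ℝ → X →L[ℝ] X} {Λ : X →ₗ.[ℝ] X}
    (h : IsSemigroupGenerator S (-Λ)) (g y : X) :
    (g ∈ Λ.domain ∧ ev Λ g = y) ↔
      Tendsto (fun t : ℝ => t⁻¹ • (S t g - g)) (𝓝[>] 0) (𝓝 (-y)) := by
  rw [← h g (-y), LinearPMap.mem_graph_iff]
  constructor
  · rintro ⟨hg, rfl⟩
    exact ⟨⟨g, hg⟩, rfl, by simp [ev, hg]⟩
  · rintro ⟨⟨z, hz⟩, rfl, h2⟩
    have hz' : z ∈ Λ.domain := hz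
    exact ⟨hz', by simpa [ev, hz'] using h2⟩

namespace IsC0Semigroup

variable {S : ℝ → X →L[ℝ] X} (hS : IsC0Semigroup S)
include hS

theorem tendsto_nhdsGE (x : X) : Tendsto (fun s => S s x) (𝓝[≥] 0) (𝓝 x) := by
  have hIci : 𝓝[≥] (0 : ℝ) = 𝓝[>] 0 ⊔ pure 0 := by
    rw [← Ioi_insert, nhdsWithin_insert, sup_comm]
  rw [hIci]
  refine (hS.tendsto x).sup ?_
  rw [tendsto_pure_left]
  intro s hs
  simpa [hS.zero] using mem_of_mem_nhds hs

theorem exists_norm_le_near_zero [CompleteSpace X] :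
    ∃ δ > (0 : ℝ), ∃ C : ℝ, 1 ≤ C ∧ ∀ t ∈ Icc 0 δ, ‖S t‖ ≤ C := by
  by_contra! hcon
  have hx : ∀ n : ℕ, ∃ t ∈ Icc (0 : ℝ) (1 / ((n : ℝ) + 1)), (n : ℝ) + 1 < ‖S t‖ := fun n =>
    hcon _ (by positivity) _ (by linarith [n.cast_nonneg (α := ℝ)])
  choose τ hτ hn using hx
  have hτ0 : Tendsto τ atTop (𝓝 0) :=
    squeeze_zero (fun n => (hτ n).1) (fun n => (hτ n).2) tendsto_one_div_add_atTop_nhds_zero_nat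
  have hτ1 : Tendsto τ atTop (𝓝[≥] 0) :=
    tendsto_nhdsWithin_iff.2 ⟨hτ0, Eventually.of_forall fun n => (hτ n).1⟩
  obtain ⟨C, hC⟩ := banach_steinhaus (g := fun n => S (τ n)) (fun x => by
    have h1 := hS.tendsto_nhdsGE x
    obtain ⟨M, hM⟩ := (h1.comp hτ1).norm.bddAbove_range
    exact ⟨M, fun n => hM ⟨n, rfl⟩⟩)
  obtain ⟨n, hn'⟩ := exists_nat_gt C
  linarith [hC n, hn n]

theorem exists_norm_le [CompleteSpace X] (T : ℝ) : ∃ C : ℝ, ∀ t ∈ Icc 0 T, ‖S t‖ ≤ C := by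
  obtain ⟨δ, hδ, C, hC, hb⟩ := hS.exists_norm_le_near_zero
  have hstep : ∀ n : ℕ, ∀ t ∈ Icc (0 : ℝ) (n * δ), ‖S t‖ ≤ C ^ (n + 1) := by
    intro n
    induction n with
    | zero =>
      intro t ht
      have : t ∈ Icc 0 δ := ⟨ht.1, ht.2.trans (by simpa using hδ.le)⟩
      simpa using hb t this
    | succ n ih =>
      intro t ht
      rcases le_total t δ with h | h
      · exact (hb t ⟨ht.1, h⟩).trans (le_self_pow₀ hC (by omega))
      · have h1 : S t = (S (t - δ)).comp (S δ) := by
          rw [← hS.add _ _ (by linarith) hδ.le, sub_add_cancel]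
        rw [h1, pow_succ]
        refine (ContinuousLinearMap.opNorm_comp_le _ _).trans ?_
        have h2 := ht.2
        push_cast at h2
        exact mul_le_mul (ih _ ⟨by linarith, by linarith⟩) (hb δ ⟨hδ.le, le_rfl⟩)
          (norm_nonneg _) (by positivity)
  obtain ⟨n, hn⟩ := exists_nat_ge (T / δ)
  refine ⟨C ^ (n + 1), fun t ht => hstep n t ⟨ht.1, ht.2.trans ?_⟩⟩
  rwa [div_le_iff₀ hδ] at hn

theorem continuousOn [CompleteSpace X] (x : X) : ContinuousOn (fun t => S t x) (Ici 0) := by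
  intro t ht
  obtain ⟨C, hC⟩ := hS.exists_norm_le (t + 1)
  have ht0 : (0 : ℝ) ≤ t := ht
  have h0 := hS.tendsto_nhdsGE x
  have h1' : Tendsto (fun s => |s - t|) (𝓝 t) (𝓝[≥] 0) := by
    refine tendsto_nhdsWithin_iff.2 ⟨?_, Eventually.of_forall fun s => abs_nonneg (s - t)⟩
    have : Tendsto (fun s => |s - t|) (𝓝 t) (𝓝 |t - t|) := by
      exact (Continuous.tendsto (by fun_prop) t)
    simpa using this
  have h2 : Tendsto (fun s => C * ‖S |s - t| x - x‖) (𝓝[Ici 0] t) (𝓝 0) := by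
    have := (((h0.comp h1').sub_const x).norm.const_mul C).mono_left
      (nhdsWithin_le_nhds (a := t) (s := Ici 0))
    simpa using this
  refine tendsto_iff_norm_sub_tendsto_zero.2 (squeeze_zero' ?_ ?_ h2)
  · exact Eventually.of_forall fun _ => norm_nonneg _
  · filter_upwards [self_mem_nhdsWithin, mem_nhdsWithin_of_mem_nhds (Iio_mem_nhds
      (show t < t + 1 by linarith))] with s hs hs1
    have hs0 : (0 : ℝ) ≤ s := hs
    have hs1' : s < t + 1 := hs1
    have key : ∀ p q : ℝ, 0 ≤ p → p ≤ t + 1 → p ≤ q →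
        ‖S q x - S p x‖ ≤ C * ‖S (q - p) x - x‖ := by
      intro p q hp hpt hpq
      have : S q x = S p (S (q - p) x) := by
        have := hS.add p (q - p) hp (by linarith)
        rw [add_sub_cancel] at this
        rw [this]; rfl
      rw [this, ← map_sub]
      exact (S p).le_of_opNorm_le (hC p ⟨hp, hpt⟩) _
    rcases le_total s t with h | h
    · rw [abs_of_nonpos (by linarith), norm_sub_rev, neg_sub]
      exact key s t hs0 hs1'.le h
    · rw [abs_of_nonneg (by linarith)]
      exact key t s ht0 (by linarith) h

end IsC0Semigroup

end

section

variable {X : Type*} [NormedAddCommGroup X] [NormedSpace ℝ X]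

theorem continuous_uncurry_of_norm_le {S : ℝ → X →L[ℝ] X} (hc : ∀ x, Continuous fun t => S t x)
    {C : ℝ} (hC : ∀ t x, ‖S t x‖ ≤ C * ‖x‖) : Continuous fun p : ℝ × X => S p.1 p.2 := by
  rw [continuous_iff_continuousAt]
  rintro ⟨t, x⟩
  refine tendsto_iff_norm_sub_tendsto_zero.2 (squeeze_zero (fun _ => norm_nonneg _)
    (g := fun p : ℝ × X => C * ‖p.2 - x‖ + ‖S p.1 x - S t x‖) ?_ ?_)
  · rintro ⟨s, y⟩
    have : S s y - S t x = S s (y - x) + (S s x - S t x) := by rw [map_sub]; abel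
    simp only [this]
    exact (norm_add_le _ _).trans (add_le_add_left (hC _ _) _)
  · have h1 : Continuous fun p : ℝ × X => C * ‖p.2 - x‖ + ‖S p.1 x - S t x‖ := by
      have := (hc x).comp (continuous_fst (X := ℝ) (Y := X))
      have h2 : Continuous fun p : ℝ × X => S p.1 x := this
      fun_prop
    simpa using h1.tendsto (t, x)

/-- The mean `h⁻¹ ∫₀ʰ Sˢ x ds` tends to `x`. -/
theorem tendsto_average {S : ℝ → X →L[ℝ] X} [CompleteSpace X]
    (h0 : S 0 = ContinuousLinearMap.id ℝ X) {x : X}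
    (hc : ContinuousOn (fun t => S t x) (Ici 0)) :
    Tendsto (fun h : ℝ => h⁻¹ • ∫ s in (0 : ℝ)..h, S s x) (𝓝[>] 0) (𝓝 x) := by
  have h2 : HasDerivWithinAt (fun u => ∫ s in (0 : ℝ)..u, S s x) (S 0 x) (Ici 0) 0 :=
    intervalIntegral.integral_hasDerivWithinAt_right (by simp)
      (t := Ioi 0)
      (ContinuousOn.stronglyMeasurableAtFilter_nhdsWithin (hc.mono Ioi_subset_Ici_self)
        measurableSet_Ioi 0)
      ((hc 0 self_mem_Ici).mono Ioi_subset_Ici_self)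
  have h3 := hasDerivWithinAt_iff_tendsto_slope.1 h2
  rw [h0] at h3
  have h4 : Ici (0 : ℝ) \ {0} = Ioi 0 := by
    ext t; simp [lt_iff_le_and_ne, eq_comm]
  rw [h4] at h3
  refine h3.congr fun h => ?_
  simp [slope]

section Generator

variable [CompleteSpace X] {S : ℝ → X →L[ℝ] X} {Λ : X →ₗ.[ℝ] X} (hS : IsC0Semigroup S)
  (hG : IsSemigroupGenerator S (-Λ))
include hS hG

theorem generator_apply_semigroup {g : X} (hg : g ∈ Λ.domain) {t : ℝ} (ht : 0 ≤ t) :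
    S t g ∈ Λ.domain ∧ ev Λ (S t g) = S t (ev Λ g) := by
  rw [hG.mem_iff]
  have h := ((S t).continuous.tendsto _).comp ((hG.mem_iff g _).1 ⟨hg, rfl⟩)
  rw [map_neg] at h
  refine h.congr' ?_
  filter_upwards [self_mem_nhdsWithin] with s hs
  have hs' : (0 : ℝ) < s := hs
  have h1 : S s (S t g) = S t (S s g) := by
    have h2 := hS.add s t hs'.le ht
    have h3 := hS.add t s ht hs'.le
    rw [add_comm, h3] at h2
    exact (congrArg (fun A : X →L[ℝ] X => A g) h2).symm
  simp [h1, map_sub]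

theorem hasDerivWithinAt_semigroup {g : X} (hg : g ∈ Λ.domain) {t : ℝ} (ht : 0 ≤ t) :
    HasDerivWithinAt (fun s => S s g) (-S t (ev Λ g)) (Ioi t) t := by
  rw [hasDerivWithinAt_iff_tendsto_slope' self_notMem_Ioi]
  have h := ((S t).continuous.tendsto _).comp ((hG.mem_iff g _).1 ⟨hg, rfl⟩)
  rw [map_neg] at h
  have h1 : Tendsto (fun s : ℝ => s - t) (𝓝[>] t) (𝓝[>] 0) := by
    refine tendsto_nhdsWithin_iff.2 ⟨?_, ?_⟩
    · have : Tendsto (fun s : ℝ => s - t) (𝓝 t) (𝓝 (t - t)) :=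
        Continuous.tendsto (by fun_prop) t
      rw [sub_self] at this
      exact this.mono_left nhdsWithin_le_nhds
    · filter_upwards [self_mem_nhdsWithin] with s hs
      exact sub_pos.2 (mem_Ioi.1 hs)
  refine (h.comp h1).congr' ?_
  filter_upwards [self_mem_nhdsWithin] with s hs
  have hs' : t < s := hs
  have h2 : S s g = S t (S (s - t) g) := by
    have h3 := hS.add t (s - t) ht (by linarith)
    rw [add_sub_cancel] at h3
    rw [h3]; rfl
  simp [slope, h2, map_sub]

theorem average_mem_domain (x : X) {h : ℝ} (hh : 0 ≤ h) :
    ∫ s in (0 : ℝ)..h, S s x ∈ Λ.domain := by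
  have hLI : LocIntegrable fun t => S t x := (hS.continuousOn x).locIntegrable
  refine ((hG.mem_iff _ (x - S h x)).2 ?_).1
  have h1 := tendsto_average hS.zero (hS.continuousOn x)
  have h2 := ((S h).continuous.tendsto _).comp h1
  rw [neg_sub]
  refine (h2.sub h1).congr' ?_
  filter_upwards [self_mem_nhdsWithin] with τ hτ
  have hτ' : (0 : ℝ) < τ := hτ
  have e1 : S τ (∫ s in (0 : ℝ)..h, S s x) = ∫ s in τ..(h + τ), S s x := by
    rw [← ContinuousLinearMap.intervalIntegral_comp_comm _ (hLI h hh)]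
    have := intervalIntegral.integral_comp_add_right (a := 0) (b := h) (fun s => S s x) τ
    rw [zero_add] at this
    rw [← this]
    refine intervalIntegral.integral_congr fun s hs => ?_
    rw [uIcc_of_le hh] at hs
    have h3 := hS.add τ s hτ'.le hs.1
    simp only [add_comm s τ, h3]; rfl
  have e2 : S h (∫ s in (0 : ℝ)..τ, S s x) = ∫ s in h..(τ + h), S s x := by
    rw [← ContinuousLinearMap.intervalIntegral_comp_comm _ (hLI τ hτ'.le)]
    have := intervalIntegral.integral_comp_add_right (a := 0) (b := τ) (fun s => S s x) h
    rw [zero_add] at this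
    rw [← this]
    refine intervalIntegral.integral_congr fun s hs => ?_
    rw [uIcc_of_le hτ'.le] at hs
    have h3 := hS.add h s hh hs.1
    simp only [add_comm s h, h3]; rfl
  have e3 := intervalIntegral.integral_add_adjacent_intervals (hLI τ hτ'.le)
    ((hLI τ hτ'.le).symm.trans (hLI (h + τ) (by linarith)))
  have e4 := intervalIntegral.integral_add_adjacent_intervals (hLI h hh)
    ((hLI h hh).symm.trans (hLI (h + τ) (by linarith)))
  simp only [Function.comp_apply, map_smul, e1, e2, ← smul_sub, add_comm τ h]
  congr 1
  rw [sub_eq_sub_iff_add_eq_add]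
  exact (add_comm _ _).trans (e4.trans (e3.symm.trans (add_comm _ _)))

end Generator

variable [PartialOrder X] [IsOrderedAddMonoid X] [IsOrderedModule ℝ X]

section Decay

variable [CompleteSpace X] {S : ℝ → X →L[ℝ] X} {Λ : X →ₗ.[ℝ] X} (hS : IsC0Semigroup S)
  (hG : IsSemigroupGenerator S (-Λ)) (hX : SpaceAssumptions X)
  (hpos : ∀ t : ℝ, 0 ≤ t → ∀ g : X, 0 ≤ g → 0 ≤ S t g) {lam0 : ℝ} (hA0 : AssumptionA0 Λ lam0)
include hS hG hX hpos hA0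

/-- Strict positivity of `Λ` makes the semigroup decay exponentially, in the order sense. -/
theorem semigroup_exp_le {g : X} (hg0 : 0 ≤ g) {t : ℝ} (ht : 0 ≤ t) :
    Real.exp (lam0 * t) • S t g ≤ g := by
  have := hX.orderClosedTopology
  -- on the domain, `e^{λ₀ t} Sᵗ g` has a nonpositive derivative
  have hdom : ∀ g : X, 0 ≤ g → g ∈ Λ.domain → Real.exp (lam0 * t) • S t g ≤ g := by
    intro g hg0 hg
    have hc : ContinuousOn (fun s : ℝ => Real.exp (lam0 * s) • S s g) (Ici 0) :=
      (Continuous.continuousOn (by fun_prop)).smul (hS.continuousOn g)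
    have hc' : ContinuousOn (fun s : ℝ => Real.exp (lam0 * s) • (lam0 • S s g - S s (ev Λ g)))
        (Ici 0) :=
      (Continuous.continuousOn (by fun_prop)).smul
        (((hS.continuousOn g).const_smul lam0).sub (hS.continuousOn _))
    have h1 := intervalIntegral.integral_eq_sub_of_hasDeriv_right (a := 0) (b := t)
      (f := fun s : ℝ => Real.exp (lam0 * s) • S s g)
      (f' := fun s : ℝ => Real.exp (lam0 * s) • (lam0 • S s g - S s (ev Λ g)))
      (hc.mono (by rw [uIcc_of_le ht]; exact fun s hs => hs.1))
      (by
        intro s hs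
        rw [min_eq_left ht] at hs
        have hd := hasDerivWithinAt_semigroup hS hG hg hs.1.le
        have he : HasDerivAt (fun s : ℝ => Real.exp (lam0 * s)) (Real.exp (lam0 * s) * lam0) s := by
          simpa using ((hasDerivAt_id s).const_mul lam0).exp
        have := he.hasDerivWithinAt.smul hd
        refine this.congr_deriv ?_
        module)
      (hc'.locIntegrable t ht)
    have h2 : 0 ≤ ∫ s in (0 : ℝ)..t,
        -(Real.exp (lam0 * s) • (lam0 • S s g - S s (ev Λ g))) := by
      refine integral_nonneg_cone ht fun s hs => ?_
      rw [← smul_neg, neg_sub]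
      refine smul_nonneg (Real.exp_pos _).le (sub_nonneg.2 ?_)
      obtain ⟨hm, he⟩ := generator_apply_semigroup hS hG hg hs.1
      rw [← he]
      exact hA0.le _ ⟨⟨trivial, hm⟩, hpos s hs.1 g hg0⟩
    rw [intervalIntegral.integral_neg, h1] at h2
    simpa [hS.zero] using h2
  have h1 := tendsto_average hS.zero (hS.continuousOn g)
  have h2 : Tendsto (fun h : ℝ => Real.exp (lam0 * t) • S t (h⁻¹ • ∫ s in (0 : ℝ)..h, S s g))
      (𝓝[>] 0) (𝓝 (Real.exp (lam0 * t) • S t g)) :=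
    ((((S t).continuous.tendsto _).comp h1)).const_smul _
  refine le_of_tendsto_of_tendsto h2 h1 ?_
  filter_upwards [self_mem_nhdsWithin] with h hh
  have hh' : (0 : ℝ) < h := hh
  exact hdom _ (smul_nonneg (by positivity)
    (integral_nonneg_cone hh'.le fun s hs => hpos s hs.1 g hg0))
    (Λ.domain.smul_mem _ (average_mem_domain hS hG g hh'.le))

theorem semigroup_le {g : X} (hg0 : 0 ≤ g) {t : ℝ} (ht : 0 ≤ t) :
    S t g ≤ Real.exp (-(lam0 * t)) • g := by
  have h := semigroup_exp_le hS hG hX hpos hA0 hg0 ht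
  have h2 := smul_le_smul_of_nonneg_left h (Real.exp_pos (-(lam0 * t))).le
  rwa [smul_smul, ← Real.exp_add, neg_add_cancel, Real.exp_zero, one_smul] at h2

end Decay

/-- A positive contraction semigroup `S` together with the inverse `R` of the negative of its
generator: `R` is bounded and positive, and `∫₀ᵗ Sˢ x ds = R (x - Sᵗ x)`. At negative times `S` is
the identity, which makes it continuous on the whole line. -/
structure ResolventSystem (S : ℝ → X →L[ℝ] X) (R : X →L[ℝ] X) (lam0 : ℝ) : Prop where
  lam_pos : 0 < lam0
  zero : S 0 = ContinuousLinearMap.id ℝ X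
  add : ∀ s t : ℝ, 0 ≤ s → 0 ≤ t → ∀ x, S (s + t) x = S s (S t x)
  continuous : Continuous fun p : ℝ × X => S p.1 p.2
  pos : ∀ (t : ℝ) (g : X), 0 ≤ g → 0 ≤ S t g
  le : ∀ (t : ℝ) (g : X), 0 ≤ g → S t g ≤ g
  comm : ∀ (t : ℝ) (x : X), S t (R x) = R (S t x)
  R_pos : ∀ g : X, 0 ≤ g → 0 ≤ R g
  R_le : ∀ g : X, 0 ≤ g → lam0 • R g ≤ g
  integral : ∀ t : ℝ, 0 ≤ t → ∀ x, ∫ s in (0 : ℝ)..t, S s x = R (x - S t x)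
  injective : Function.Injective R

/-- Under strict positivity, `Λ` is the inverse of the bounded operator `R = ∫₀^∞ Sˢ ds`. -/
theorem exists_resolventSystem [CompleteSpace X] {S : ℝ → X →L[ℝ] X} {Λ : X →ₗ.[ℝ] X}
    (hS : IsC0Semigroup S) (hG : IsSemigroupGenerator S (-Λ)) (hX : SpaceAssumptions X)
    (hpos : ∀ t : ℝ, 0 ≤ t → ∀ g : X, 0 ≤ g → 0 ≤ S t g) {lam0 : ℝ}
    (hA0 : AssumptionA0 Λ lam0) :
    ∃ (S' : ℝ → X →L[ℝ] X) (R : X →L[ℝ] X), ResolventSystem S' R lam0 ∧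
      ∀ g y, (g ∈ Λ.domain ∧ ev Λ g = y) ↔ g = R y := by
  have := hX.orderClosedTopology
  have hl := hA0.pos
  obtain ⟨C, hC, hbd⟩ := hX.exists_norm_bound
  have hdecay : ∀ t, 0 ≤ t → ∀ x, ‖S t x‖ ≤ C * Real.exp (-lam0 * t) * ‖x‖ := by
    intro t ht x
    have h1 := hbd (Real.exp (lam0 * t) • S t) (fun g hg => by
      refine hX.norm_le ?_ (semigroup_exp_le hS hG hX hpos hA0 hg ht)
      exact smul_nonneg (Real.exp_pos _).le (hpos t ht g hg)) x
    rw [smul_apply, norm_smul, Real.norm_of_nonneg (Real.exp_pos _).le] at h1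
    have h2 := mul_le_mul_of_nonneg_left h1 (Real.exp_pos (-lam0 * t)).le
    rw [← mul_assoc, ← Real.exp_add, neg_mul, neg_add_cancel, Real.exp_zero, one_mul] at h2
    rw [neg_mul]
    linarith
  have hcont := fun x => hS.continuousOn x
  have hLI : ∀ x, LocIntegrable fun t => S t x := fun x => (hcont x).locIntegrable
  have hexp : IntegrableOn (fun t => Real.exp (-lam0 * t)) (Ioi 0) := exp_neg_integrableOn_Ioi 0 hl
  have hint : ∀ x, IntegrableOn (fun t => S t x) (Ioi 0) := by
    intro x
    refine ((hexp.const_mul C).mul_const ‖x‖).mono'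
      (((hcont x).mono Ioi_subset_Ici_self).aestronglyMeasurable measurableSet_Ioi) ?_
    exact (ae_restrict_iff' measurableSet_Ioi).2
      (Eventually.of_forall fun t ht => hdecay t (le_of_lt ht) x)
  let R : X →L[ℝ] X := LinearMap.mkContinuous
    { toFun := fun x => ∫ t in Ioi (0 : ℝ), S t x
      map_add' := fun x y => by
        simp only [map_add]
        exact integral_add (hint x) (hint y)
      map_smul' := fun r x => by
        simp only [map_smul, RingHom.id_apply]
        exact integral_smul r _ }
    (C * ∫ t in Ioi (0 : ℝ), Real.exp (-lam0 * t)) (by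
      intro x
      have h1 : ‖∫ t in Ioi (0 : ℝ), S t x‖ ≤
          ∫ t in Ioi (0 : ℝ), C * Real.exp (-lam0 * t) * ‖x‖ :=
        norm_integral_le_of_norm_le ((hexp.const_mul C).mul_const ‖x‖)
          ((ae_restrict_iff' measurableSet_Ioi).2
            (Eventually.of_forall fun t ht => hdecay t (le_of_lt ht) x))
      rw [integral_mul_const, integral_const_mul] at h1
      exact h1)
  have hR : ∀ x, R x = ∫ t in Ioi (0 : ℝ), S t x := fun x => rfl
  have hRlim : ∀ x, Tendsto (fun T : ℝ => ∫ t in (0 : ℝ)..T, S t x) atTop (𝓝 (R x)) := fun x =>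
    intervalIntegral_tendsto_integral_Ioi 0 (hint x) tendsto_id
  have hcomm : ∀ t, 0 ≤ t → ∀ x, S t (R x) = R (S t x) := by
    intro t ht x
    rw [hR, hR, ← (S t).integral_comp_comm (hint x)]
    refine setIntegral_congr_fun measurableSet_Ioi fun s hs => ?_
    have h2 := hS.add s t (le_of_lt hs) ht
    have h3 := hS.add t s ht (le_of_lt hs)
    rw [add_comm, h3] at h2
    exact congrArg (fun A : X →L[ℝ] X => A x) h2
  have hintegral : ∀ t, 0 ≤ t → ∀ x, ∫ s in (0 : ℝ)..t, S s x = R (x - S t x) := by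
    intro t ht x
    have h1 : Tendsto (fun T : ℝ => (∫ s in (0 : ℝ)..(T + t), S s x) -
        ∫ s in (0 : ℝ)..t, S s x) atTop (𝓝 (R x - ∫ s in (0 : ℝ)..t, S s x)) :=
      ((hRlim x).comp (tendsto_atTop_add_const_right _ t tendsto_id)).sub_const _
    have h2 := hRlim (S t x)
    have h3 : R (S t x) = R x - ∫ s in (0 : ℝ)..t, S s x := by
      refine tendsto_nhds_unique h2 (h1.congr' ?_)
      filter_upwards [eventually_ge_atTop 0] with T hT
      rw [intervalIntegral.integral_interval_sub_left (hLI x _ (by linarith)) (hLI x t ht)]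
      have h4 := intervalIntegral.integral_comp_add_right (a := 0) (b := T) (fun s => S s x) t
      rw [zero_add] at h4
      rw [← h4]
      refine intervalIntegral.integral_congr fun s hs => ?_
      rw [uIcc_of_le hT] at hs
      have h5 := hS.add s t hs.1 ht
      simp only [h5]; rfl
    rw [map_sub, h3]; abel
  have hmem : ∀ x, R x ∈ Λ.domain ∧ ev Λ (R x) = x := by
    intro x
    rw [hG.mem_iff]
    refine ((tendsto_average hS.zero (hcont x)).neg).congr' ?_
    filter_upwards [self_mem_nhdsWithin] with h hh
    have hh' : (0 : ℝ) < h := hh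
    rw [hintegral h hh'.le, hcomm h hh'.le, ← smul_neg, map_sub, neg_sub]
  have hS0 : ∀ x, Tendsto (fun t => S t x) atTop (𝓝 0) := by
    intro x
    refine squeeze_zero_norm' (a := fun t => C * Real.exp (-lam0 * t) * ‖x‖) ?_ ?_
    · filter_upwards [eventually_ge_atTop 0] with t ht using hdecay t ht x
    · have h1 : Tendsto (fun t : ℝ => Real.exp (-lam0 * t)) atTop (𝓝 0) := by
        refine Real.tendsto_exp_atBot.comp ?_
        exact (tendsto_id.const_mul_atTop_of_neg (by linarith : -lam0 < 0))
      simpa using (h1.const_mul C).mul_const ‖x‖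
  have hinv : ∀ g ∈ Λ.domain, R (ev Λ g) = g := by
    intro g hg
    have h1 : ∀ t, 0 ≤ t → g - S t g = R (ev Λ g) - R (S t (ev Λ g)) := by
      intro t ht
      have h2 := intervalIntegral.integral_eq_sub_of_hasDeriv_right (a := 0) (b := t)
        (f := fun s : ℝ => S s g) (f' := fun s => -S s (ev Λ g))
        ((hcont g).mono (by rw [uIcc_of_le ht]; exact fun s hs => hs.1))
        (fun s hs => hasDerivWithinAt_semigroup hS hG hg (by
          rw [min_eq_left ht] at hs; exact hs.1.le))
        (hLI _ t ht).neg
      rw [intervalIntegral.integral_neg, hintegral t ht] at h2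
      simp only [hS.zero, ContinuousLinearMap.id_apply] at h2
      rw [← map_sub, ← neg_sub, ← h2, neg_neg]
    have h2 : Tendsto (fun t => g - S t g) atTop (𝓝 (g - 0)) := (hS0 g).const_sub g
    have h3 : Tendsto (fun t => R (ev Λ g) - R (S t (ev Λ g))) atTop (𝓝 (R (ev Λ g) - R 0)) :=
      ((R.continuous.tendsto _).comp (hS0 _)).const_sub _
    rw [map_zero, sub_zero] at h3
    rw [sub_zero] at h2
    refine tendsto_nhds_unique (h3.congr' ?_) h2
    filter_upwards [eventually_ge_atTop 0] with t ht using (h1 t ht).symm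
  have hRpos : ∀ g, 0 ≤ g → 0 ≤ R g := by
    intro g hg
    rw [hR]
    exact integral_nonneg_of_ae ((ae_restrict_iff' measurableSet_Ioi).2
      (Eventually.of_forall fun t ht => hpos t (le_of_lt ht) g hg))
  have hSle : ∀ t, 0 ≤ t → ∀ g, 0 ≤ g → S t g ≤ g := by
    intro t ht g hg
    refine (semigroup_le hS hG hX hpos hA0 hg ht).trans ?_
    have h1 : Real.exp (-(lam0 * t)) ≤ 1 := by
      rw [Real.exp_le_one_iff]
      have : 0 ≤ lam0 * t := by positivity
      linarith
    simpa using smul_le_smul_of_nonneg_right h1 hg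
  refine ⟨fun t => S (max t 0), R, ?_, ?_⟩
  · refine ⟨hl, by simpa using hS.zero, ?_, ?_, ?_, ?_, ?_, hRpos, ?_, ?_, ?_⟩
    · intro s t hs ht x
      rw [max_eq_left hs, max_eq_left ht, max_eq_left (add_nonneg hs ht), hS.add s t hs ht]
      rfl
    · refine continuous_uncurry_of_norm_le (S := fun t => S (max t 0)) (fun x => ?_) (C := C)
        fun t x => ?_
      · exact (hcont x).comp_continuous (by fun_prop) fun t => le_max_right t 0
      · refine hbd _ (fun g hg => ?_) x
        exact hX.norm_le (hpos _ (le_max_right _ _) g hg) (hSle _ (le_max_right _ _) g hg)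
    · exact fun t g hg => hpos _ (le_max_right _ _) g hg
    · exact fun t g hg => hSle _ (le_max_right _ _) g hg
    · exact fun t x => hcomm _ (le_max_right _ _) x
    · intro g hg
      have h1 := hA0.le (R g) ⟨⟨trivial, (hmem g).1⟩, hRpos g hg⟩
      rwa [(hmem g).2] at h1
    · intro t ht x
      rw [max_eq_left ht, ← hintegral t ht x]
      refine intervalIntegral.integral_congr fun s hs => ?_
      rw [uIcc_of_le ht] at hs
      simp only [max_eq_left hs.1]
    · intro x y hxy
      rw [← (hmem x).2, ← (hmem y).2, hxy]
  · intro g y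
    constructor
    · rintro ⟨hg, rfl⟩
      exact (hinv g hg).symm
    · rintro rfl
      exact hmem y

end

section

variable {X : Type*} [NormedAddCommGroup X] [NormedSpace ℝ X]

/-! ### The scale of cones `Rᵏ X₊` -/

theorem pow_succ_apply (R : X →L[ℝ] X) (k : ℕ) (x : X) : (R ^ (k + 1)) x = (R ^ k) (R x) := by
  rw [pow_succ]; rfl

theorem pow_succ_apply' (R : X →L[ℝ] X) (k : ℕ) (x : X) : (R ^ (k + 1)) x = R ((R ^ k) x) := by
  rw [pow_succ']; rfl

variable [PartialOrder X]

/-- The cone `Rᵏ X₊`, which is `𝒟₊(Λᵏ)` when `R` is the inverse of `Λ`. -/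
def conePow (R : X →L[ℝ] X) (k : ℕ) : Set X := {g | ∃ x, 0 ≤ x ∧ (R ^ k) x = g}

/-- The cone of smooth positive elements, `⋂ₖ Rᵏ X₊`. -/
def coneTop (R : X →L[ℝ] X) : Set X := {g | ∀ k, g ∈ conePow R k}

variable [IsOrderedAddMonoid X] [IsOrderedModule ℝ X]

namespace ResolventSystem

variable {S : ℝ → X →L[ℝ] X} {R : X →L[ℝ] X} {lam0 : ℝ} (hR : ResolventSystem S R lam0)
include hR

theorem continuous_apply (x : X) : Continuous fun t => S t x :=
  hR.continuous.comp (by fun_prop : Continuous fun t : ℝ => (t, x))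

theorem mono (t : ℝ) {g h : X} (hgh : g ≤ h) : S t g ≤ S t h := by
  have := hR.pos t _ (sub_nonneg.2 hgh)
  rwa [map_sub, sub_nonneg] at this

theorem R_mono {g h : X} (hgh : g ≤ h) : R g ≤ R h := by
  have := hR.R_pos _ (sub_nonneg.2 hgh)
  rwa [map_sub, sub_nonneg] at this

theorem pow_pos (k : ℕ) {x : X} (hx : 0 ≤ x) : 0 ≤ (R ^ k) x := by
  induction k with
  | zero => simpa using hx
  | succ k ih => rw [pow_succ_apply']; exact hR.R_pos _ ih

theorem pow_mono (k : ℕ) {x y : X} (hxy : x ≤ y) : (R ^ k) x ≤ (R ^ k) y := by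
  have := hR.pow_pos k (sub_nonneg.2 hxy)
  rwa [map_sub, sub_nonneg] at this

theorem comm_pow (k : ℕ) (t : ℝ) (x : X) : S t ((R ^ k) x) = (R ^ k) (S t x) := by
  induction k with
  | zero => simp
  | succ k ih => rw [pow_succ_apply', pow_succ_apply', hR.comm, ih]

theorem norm_apply_le (hX : SpaceAssumptions X) [CompleteSpace X] :
    ∃ C, 0 ≤ C ∧ ∀ t x, ‖S t x‖ ≤ C * ‖x‖ := by
  obtain ⟨C, hC, h⟩ := hX.exists_norm_bound
  exact ⟨C, hC, fun t x => h (S t) (fun g hg => hX.norm_le (hR.pos t g hg) (hR.le t g hg)) x⟩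

variable [CompleteSpace X] (hX : SpaceAssumptions X)
include hX

/-- The difference quotients `h⁻¹ (R x - Sʰ R x) = h⁻¹ ∫₀ʰ Sˢ x ds` recover `x` from `R x`. -/
theorem tendsto_quotient (x : X) :
    Tendsto (fun h : ℝ => h⁻¹ • (R x - S h (R x))) (𝓝[>] 0) (𝓝 x) := by
  refine (tendsto_average hR.zero (hR.continuous_apply x).continuousOn).congr' ?_
  filter_upwards [self_mem_nhdsWithin] with h hh
  rw [hR.integral h (le_of_lt hh), map_sub, hR.comm]

theorem nonneg_of_R_nonneg {x : X} (h : 0 ≤ R x) : 0 ≤ x := by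
  have := hX.orderClosedTopology
  refine ge_of_tendsto (hR.tendsto_quotient hX x) ?_
  filter_upwards [self_mem_nhdsWithin] with t ht
  have ht' : (0 : ℝ) < t := ht
  exact smul_nonneg (by positivity) (sub_nonneg.2 (hR.le t _ h))

theorem le_of_R_le {x y : X} (h : R x ≤ R y) : x ≤ y := by
  refine sub_nonneg.1 (hR.nonneg_of_R_nonneg hX ?_)
  rw [map_sub]
  exact sub_nonneg.2 h

theorem nonneg_of_pow_nonneg (k : ℕ) {x : X} (h : 0 ≤ (R ^ k) x) : 0 ≤ x := by
  induction k with
  | zero => simpa using h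
  | succ k ih =>
    rw [pow_succ_apply'] at h
    exact ih (hR.nonneg_of_R_nonneg hX h)

theorem le_of_pow_le (k : ℕ) {x y : X} (h : (R ^ k) x ≤ (R ^ k) y) : x ≤ y := by
  refine sub_nonneg.1 (hR.nonneg_of_pow_nonneg hX k ?_)
  rw [map_sub]
  exact sub_nonneg.2 h

theorem average_le {x : X} (hx : 0 ≤ x) {h : ℝ} (hh : 0 < h) :
    h⁻¹ • R (x - S h x) ≤ x := by
  have := hX.orderClosedTopology
  rw [← hR.integral h hh.le]
  have h1 : ∫ s in (0 : ℝ)..h, S s x ≤ ∫ s in (0 : ℝ)..h, x :=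
    integral_mono_cone hh.le ((hR.continuous_apply x).intervalIntegrable _ _)
      intervalIntegrable_const fun s _ => hR.le s x hx
  rw [intervalIntegral.integral_const, sub_zero] at h1
  have h2 := smul_le_smul_of_nonneg_left h1 (inv_nonneg.2 hh.le)
  rwa [smul_smul, inv_mul_cancel₀ hh.ne', one_smul] at h2

/-- The range of `R` on the cone is positively saturated: below `R x` the difference quotients at
the dyadic times `2⁻ⁿ` increase and are bounded by `x`. -/
theorem exists_of_le_R {g x : X} (hg : 0 ≤ g) (hx : 0 ≤ x) (hgx : g ≤ R x) :
    ∃ y, 0 ≤ y ∧ y ≤ x ∧ R y = g := by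
  have := hX.orderClosedTopology
  let τ : ℕ → ℝ := fun n => (1 / 2 : ℝ) ^ n
  have hτ : ∀ n, 0 < τ n := fun n => by positivity
  have hτs : ∀ n, τ n = τ (n + 1) + τ (n + 1) := fun n => by simp only [τ, pow_succ]; ring
  let y : ℕ → X := fun n => (τ n)⁻¹ • (g - S (τ n) g)
  have hy0 : ∀ n, 0 ≤ y n := fun n =>
    smul_nonneg (inv_nonneg.2 (hτ n).le) (sub_nonneg.2 (hR.le _ g hg))
  have hyx : ∀ n, y n ≤ x := by
    intro n
    refine le_trans ?_ (hR.average_le hX hx (hτ n))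
    refine smul_le_smul_of_nonneg_left ?_ (inv_nonneg.2 (hτ n).le)
    have h1 := hR.le (τ n) (R x - g) (sub_nonneg.2 hgx)
    rw [map_sub, hR.comm] at h1
    rw [map_sub, sub_le_sub_iff]
    have h2 := add_le_add_right h1 (R (S (τ n) x) + S (τ n) g - R (S (τ n) x) + g)
    have e1 : R (S (τ n) x) + S (τ n) g - R (S (τ n) x) + g + (R (S (τ n) x) - S (τ n) g) =
      g + R (S (τ n) x) := by abel
    have e2 : R (S (τ n) x) + S (τ n) g - R (S (τ n) x) + g + (R x - g) = R x + S (τ n) g := by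
      abel
    rwa [e1, e2] at h2
  have hmono : Monotone y := by
    refine monotone_nat_of_le_succ fun n => ?_
    have h1 : S (τ n) g = S (τ (n + 1)) (S (τ (n + 1)) g) := by
      rw [← hR.add _ _ (hτ _).le (hτ _).le, ← hτs]
    have h2 : (τ n)⁻¹ = (τ (n + 1))⁻¹ * (1 / 2) := by
      rw [hτs n, ← two_mul, mul_inv]; ring
    have h3 := hR.le (τ (n + 1)) (g - S (τ (n + 1)) g) (sub_nonneg.2 (hR.le _ g hg))
    rw [map_sub] at h3
    simp only [y]
    rw [h2, mul_smul]
    refine smul_le_smul_of_nonneg_left ?_ (inv_nonneg.2 (hτ _).le)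
    have h4 : g - S (τ n) g ≤ (g - S (τ (n + 1)) g) + (g - S (τ (n + 1)) g) := by
      rw [h1]
      calc g - S (τ (n + 1)) (S (τ (n + 1)) g)
          = (g - S (τ (n + 1)) g) + (S (τ (n + 1)) g - S (τ (n + 1)) (S (τ (n + 1)) g)) := by abel
        _ ≤ _ := add_le_add_right h3 _
    calc (1 / 2 : ℝ) • (g - S (τ n) g)
        ≤ (1 / 2 : ℝ) • ((g - S (τ (n + 1)) g) + (g - S (τ (n + 1)) g)) :=
          smul_le_smul_of_nonneg_left h4 (by norm_num)
      _ = g - S (τ (n + 1)) g := by module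
  obtain ⟨z, hz⟩ := hX.exists_tendsto_of_monotone hmono hy0
    (C := ‖x‖) fun n => hX.norm_le (hy0 n) (hyx n)
  refine ⟨z, ge_of_tendsto' hz hy0, le_of_tendsto' hz hyx, ?_⟩
  have h1 := (R.continuous.tendsto _).comp hz
  have hτ0 : Tendsto τ atTop (𝓝[>] 0) := tendsto_nhdsWithin_iff.2
    ⟨tendsto_pow_atTop_nhds_zero_of_lt_one (by norm_num) (by norm_num),
      Eventually.of_forall fun n => hτ n⟩
  have h2 := (tendsto_average hR.zero (hR.continuous_apply g).continuousOn).comp hτ0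
  refine tendsto_nhds_unique h1 (h2.congr fun n => ?_)
  simp only [Function.comp_apply, y]
  rw [hR.integral _ (hτ n).le, map_smul]

theorem exists_of_le_pow (k : ℕ) {g x : X} (hg : 0 ≤ g) (hx : 0 ≤ x) (hgx : g ≤ (R ^ k) x) :
    ∃ y, 0 ≤ y ∧ y ≤ x ∧ (R ^ k) y = g := by
  induction k generalizing g with
  | zero => exact ⟨g, hg, by simpa using hgx, by simp⟩
  | succ k ih =>
    rw [pow_succ_apply'] at hgx
    obtain ⟨y, hy, hyx, rfl⟩ := hR.exists_of_le_R hX hg (hR.pow_pos k hx) hgx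
    obtain ⟨z, hz, hzx, rfl⟩ := ih hy hyx
    exact ⟨z, hz, hzx, pow_succ_apply' R k z⟩

theorem conePow_of_le {k : ℕ} {g h : X} (hg : 0 ≤ g) (hgh : g ≤ h) (hh : h ∈ conePow R k) :
    g ∈ conePow R k := by
  obtain ⟨x, hx, rfl⟩ := hh
  obtain ⟨y, hy, -, rfl⟩ := hR.exists_of_le_pow hX k hg hx hgh
  exact ⟨y, hy, rfl⟩

omit hX [CompleteSpace X] in
theorem conePow_nonneg {k : ℕ} {g : X} (hg : g ∈ conePow R k) : 0 ≤ g := by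
  obtain ⟨x, hx, rfl⟩ := hg
  exact hR.pow_pos k hx

omit hX [CompleteSpace X] in
theorem conePow_antitone {k l : ℕ} (hkl : k ≤ l) : conePow R l ⊆ conePow R k := by
  rintro _ ⟨x, hx, rfl⟩
  refine ⟨(R ^ (l - k)) x, hR.pow_pos _ hx, ?_⟩
  conv_rhs => rw [← Nat.add_sub_cancel' hkl, pow_add]
  rfl

/-! ### Approximation from below by smooth elements -/

/-- One factor of the regularization: `h⁻¹ ∫₀ʰ Sˢ x ds`, written through `R`. -/
theorem tendsto_average_R (x : X) :
    Tendsto (fun h : ℝ => h⁻¹ • R (x - S h x)) (𝓝[>] 0) (𝓝 x) := by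
  refine (tendsto_average hR.zero (hR.continuous_apply x).continuousOn).congr' ?_
  filter_upwards [self_mem_nhdsWithin] with h hh
  rw [hR.integral h (le_of_lt hh)]

/-- Every positive element is the limit of an increasing sequence of smooth positive elements: the
infinite products of the averaging operators over the times `2⁻ⁿ, 2⁻ⁿ⁻¹, …`. -/
theorem exists_smooth_approx {x : X} (hx : 0 ≤ x) :
    ∃ u : ℕ → X, Monotone u ∧ (∀ n, u n ∈ coneTop R) ∧ (∀ n, u n ≤ x) ∧
      Tendsto u atTop (𝓝 x) := by
  have := hX.orderClosedTopology
  let τ : ℕ → ℝ := fun n => (1 / 2 : ℝ) ^ n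
  have hτ : ∀ n, 0 < τ n := fun n => by positivity
  let A : ℕ → X →L[ℝ] X := fun n => (τ n)⁻¹ • R.comp (ContinuousLinearMap.id ℝ X - S (τ n))
  have hA : ∀ n x, A n x = (τ n)⁻¹ • R (x - S (τ n) x) := fun n x => rfl
  have hApos : ∀ n x, 0 ≤ x → 0 ≤ A n x := fun n x hx =>
    smul_nonneg (inv_nonneg.2 (hτ n).le) (hR.R_pos _ (sub_nonneg.2 (hR.le _ x hx)))
  have hAle : ∀ n x, 0 ≤ x → A n x ≤ x := fun n x hx => hR.average_le hX hx (hτ n)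
  have hAmono : ∀ n x y, x ≤ y → A n x ≤ A n y := by
    intro n x y hxy
    have := hApos n _ (sub_nonneg.2 hxy)
    rwa [map_sub, sub_nonneg] at this
  -- the finite products `A n ∘ ⋯ ∘ A (n + k - 1)`
  let T : ℕ → ℕ → X → X := fun k => Nat.rec (fun _ z => z) (fun _ f n z => A n (f (n + 1) z)) k
  have hT0 : ∀ n z, T 0 n z = z := fun n z => rfl
  have hTs : ∀ k n z, T (k + 1) n z = A n (T k (n + 1) z) := fun k n z => rfl
  have hTpos : ∀ k n z, 0 ≤ z → 0 ≤ T k n z := by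
    intro k
    induction k with
    | zero => intro n z hz; exact hz
    | succ k ih => intro n z hz; rw [hTs]; exact hApos _ _ (ih _ _ hz)
  have hTmono : ∀ k n y z, y ≤ z → T k n y ≤ T k n z := by
    intro k
    induction k with
    | zero => intro n y z hz; exact hz
    | succ k ih => intro n y z hz; rw [hTs, hTs]; exact hAmono _ _ _ (ih _ _ _ hz)
  have hTle : ∀ k n z, 0 ≤ z → T k n z ≤ z := by
    intro k
    induction k with
    | zero => intro n z hz; exact le_rfl
    | succ k ih =>
      intro n z hz
      rw [hTs]
      exact (hAle _ _ (hTpos _ _ _ hz)).trans (ih _ _ hz)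
  have hTanti : ∀ n z, 0 ≤ z → Antitone fun k => T k n z := by
    intro n z hz
    refine antitone_nat_of_succ_le fun k => ?_
    induction k generalizing n with
    | zero => exact hTle 1 n z hz
    | succ k ih => rw [hTs (k + 1), hTs k]; exact hAmono _ _ _ (ih _)
  have hlim : ∀ n z, 0 ≤ z → ∃ w, Tendsto (fun k => T k n z) atTop (𝓝 w) := fun n z hz =>
    hX.exists_tendsto_of_antitone (hTanti n z hz) fun k => hTpos k n z hz
  choose! u hu using fun n => hlim n x hx
  have hu0 : ∀ n, 0 ≤ u n := fun n => ge_of_tendsto' (hu n) fun k => hTpos k n x hx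
  have hux : ∀ n, u n ≤ x := fun n => le_of_tendsto' (hu n) fun k => hTle k n x hx
  have hrec : ∀ n, u n = A n (u (n + 1)) := by
    intro n
    refine tendsto_nhds_unique ((tendsto_add_atTop_iff_nat 1).2 (hu n)) ?_
    exact ((A n).continuous.tendsto _).comp (hu (n + 1))
  have hmono : Monotone u := monotone_nat_of_le_succ fun n => by
    rw [hrec n]; exact hAle _ _ (hu0 _)
  have htop : ∀ k n, u n ∈ conePow R k := by
    intro k
    induction k with
    | zero => intro n; exact ⟨u n, hu0 n, by simp⟩
    | succ k ih =>
      intro n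
      obtain ⟨z, hz, hzu⟩ := ih (n + 1)
      refine ⟨(τ n)⁻¹ • (z - S (τ n) z), smul_nonneg (inv_nonneg.2 (hτ n).le)
        (sub_nonneg.2 (hR.le _ z hz)), ?_⟩
      rw [hrec n, hA, ← hzu, hR.comm_pow, ← map_sub, map_smul, pow_succ_apply']
  refine ⟨u, hmono, fun n k => htop k n, hux, ?_⟩
  -- on the range of `R` the product over `k` factors loses at most `2 · 2⁻ⁿ z`
  have hAR : ∀ n z, 0 ≤ z → R z - τ n • z ≤ A n (R z) := by
    intro n z hz
    have h1 : ∀ s, 0 ≤ s → R z - s • z ≤ S s (R z) := by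
      intro s hs
      have h2 : ∫ r in (0 : ℝ)..s, S r z ≤ ∫ r in (0 : ℝ)..s, z :=
        integral_mono_cone hs ((hR.continuous_apply z).intervalIntegrable _ _)
          intervalIntegrable_const fun r _ => hR.le r z hz
      rw [intervalIntegral.integral_const, sub_zero, hR.integral s hs, map_sub, ← hR.comm] at h2
      exact sub_le_comm.1 h2
    have h3 : ∫ s in (0 : ℝ)..(τ n), (R z - τ n • z) ≤ ∫ s in (0 : ℝ)..(τ n), S s (R z) := by
      refine integral_mono_cone (hτ n).le intervalIntegrable_const
        ((hR.continuous_apply _).intervalIntegrable _ _) fun s hs => ?_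
      refine le_trans ?_ (h1 s hs.1)
      exact sub_le_sub_left (smul_le_smul_of_nonneg_right hs.2 hz) _
    rw [intervalIntegral.integral_const, sub_zero, hR.integral _ (hτ n).le] at h3
    have h4 := smul_le_smul_of_nonneg_left h3 (inv_nonneg.2 (hτ n).le)
    rwa [smul_smul, inv_mul_cancel₀ (hτ n).ne', one_smul] at h4
  have hTR : ∀ k n z, 0 ≤ z → R z - (2 * τ n) • z ≤ T k n (R z) := by
    intro k
    induction k with
    | zero =>
      intro n z hz
      exact sub_le_self _ (smul_nonneg (by have := hτ n; linarith) hz)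
    | succ k ih =>
      intro n z hz
      have e : 2 * τ (n + 1) = τ n := by simp only [τ, pow_succ]; ring
      have h1 := hAmono n _ _ (ih (n + 1) z hz)
      rw [e, map_sub, map_smul] at h1
      rw [hTs]
      refine le_trans ?_ h1
      have h2 := smul_le_smul_of_nonneg_left (hAle n z hz) (hτ n).le
      calc R z - (2 * τ n) • z = (R z - τ n • z) - τ n • z := by module
        _ ≤ _ := sub_le_sub (hAR n z hz) h2
  obtain ⟨w, hw⟩ := hX.exists_tendsto_of_monotone hmono hu0
    (C := ‖x‖) fun n => hX.norm_le (hu0 n) (hux n)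
  have hwx : w ≤ x := le_of_tendsto' hw hux
  have hτ0 : Tendsto τ atTop (𝓝 0) :=
    tendsto_pow_atTop_nhds_zero_of_lt_one (by norm_num) (by norm_num)
  have hxw : x ≤ w := by
    refine le_of_tendsto (hR.tendsto_average_R hX x) ?_
    filter_upwards [self_mem_nhdsWithin] with h hh
    have hh' : (0 : ℝ) < h := hh
    set z := h⁻¹ • (x - S h x) with hz_def
    have hz : 0 ≤ z := smul_nonneg (inv_nonneg.2 hh'.le) (sub_nonneg.2 (hR.le h x hx))
    have hzR : h⁻¹ • R (x - S h x) = R z := by rw [hz_def, map_smul]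
    have hzx : R z ≤ x := by rw [← hzR]; exact hR.average_le hX hx hh'
    rw [hzR]
    have h1 : ∀ n, R z - (2 * τ n) • z ≤ u n := fun n =>
      ge_of_tendsto' (hu n) fun k => (hTR k n z hz).trans (hTmono _ _ _ _ hzx)
    have h2 : Tendsto (fun n => R z - (2 * τ n) • z) atTop (𝓝 (R z - (2 * (0 : ℝ)) • z)) :=
      ((hτ0.const_mul 2).smul_const z).const_sub _
    simp only [mul_zero, zero_smul, sub_zero] at h2
    exact le_of_tendsto_of_tendsto' h2 hw h1
  rwa [le_antisymm hwx hxw] at hw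

end ResolventSystem

end

section

variable {X : Type*} [NormedAddCommGroup X] [NormedSpace ℝ X]

/-! ### Mild and integrated forms of the linear equation -/

/-- Interchange of the order of integration over a triangle. -/
theorem integral_triangle {E F : Type*} [NormedAddCommGroup E] [NormedSpace ℝ E]
    [NormedAddCommGroup F] {k : ℝ → ℝ → E} {y : ℝ → F} {C t : ℝ}
    (ht : 0 ≤ t)
    (hk : AEStronglyMeasurable (Function.uncurry k)
      ((volume.restrict (Ioc 0 t)).prod (volume.restrict (Ioc 0 t))))
    (hy : IntervalIntegrable y volume 0 t) (hb : ∀ s r, ‖k s r‖ ≤ C * ‖y r‖) :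
    IntervalIntegrable (fun s => ∫ r in (0 : ℝ)..s, k s r) volume 0 t ∧
      ∫ s in (0 : ℝ)..t, ∫ r in (0 : ℝ)..s, k s r = ∫ r in (0 : ℝ)..t, ∫ s in r..t, k s r := by
  let μ : Measure ℝ := volume.restrict (Ioc 0 t)
  let K : ℝ × ℝ → E := {p : ℝ × ℝ | p.2 ≤ p.1}.indicator (Function.uncurry k)
  have hmeas : MeasurableSet {p : ℝ × ℝ | p.2 ≤ p.1} :=
    measurableSet_le measurable_snd measurable_fst
  have hKint : Integrable K (μ.prod μ) := by
    have hyi : Integrable y μ := hy.1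
    have h1 : Integrable (fun p : ℝ × ℝ => C * ‖y p.2‖) (μ.prod μ) :=
      (hyi.norm.comp_snd μ).const_mul C
    refine h1.mono' (hk.indicator hmeas) (Eventually.of_forall fun p => ?_)
    simp only [K, indicator]
    split_ifs
    · exact hb _ _
    · rw [norm_zero]; exact (norm_nonneg _).trans (hb p.1 p.2)
  have hin : ∀ s ∈ Ioc 0 t, ∫ r in (0 : ℝ)..s, k s r = ∫ r, K (s, r) ∂μ := by
    intro s hs
    have h1 : (fun r => K (s, r)) = (Iic s).indicator (k s) := by
      ext r; simp [K, indicator]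
    rw [h1, integral_indicator measurableSet_Iic, Measure.restrict_restrict measurableSet_Iic,
      intervalIntegral.integral_of_le hs.1.le]
    congr 2
    ext r
    simp only [mem_Ioc, mem_inter_iff, mem_Iic]
    exact ⟨fun h => ⟨h.2, h.1, h.2.trans hs.2⟩, fun h => ⟨h.2.1, h.1⟩⟩
  have hout : ∀ r ∈ Ioc 0 t, ∫ s in r..t, k s r = ∫ s, K (s, r) ∂μ := by
    intro r hr
    have h1 : (fun s => K (s, r)) = (Ici r).indicator (fun s => k s r) := by
      ext s; simp [K, indicator]
    rw [h1, integral_indicator measurableSet_Ici, Measure.restrict_restrict measurableSet_Ici,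
      intervalIntegral.integral_of_le hr.2, ← integral_Icc_eq_integral_Ioc]
    congr 2
    ext s
    simp only [mem_Icc, mem_Ioc, mem_inter_iff, mem_Ici]
    exact ⟨fun h => ⟨h.1, hr.1.trans_le h.1, h.2⟩, fun h => ⟨h.1, h.2.2⟩⟩
  constructor
  · rw [intervalIntegrable_iff_integrableOn_Ioc_of_le ht]
    have h1 : Integrable (fun s => ∫ r, K (s, r) ∂μ) μ := hKint.integral_prod_left
    exact h1.congr ((ae_restrict_iff' measurableSet_Ioc).2
      (Eventually.of_forall fun s hs => (hin s hs).symm))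
  · rw [intervalIntegral.integral_of_le ht, intervalIntegral.integral_of_le ht,
      setIntegral_congr_fun measurableSet_Ioc hin, setIntegral_congr_fun measurableSet_Ioc hout]
    exact integral_integral_swap (f := fun s r => K (s, r)) hKint

/-- The mild solution `Sᶜᵗ x + ∫₀ᵗ Sᶜ⁽ᵗ⁻ʳ⁾ y(r) dr` of the linear equation `z' + c Λ z = y`,
`z(0) = x`. -/
def mildSol (S : ℝ → X →L[ℝ] X) (c : ℝ) (x : X) (y : ℝ → X) (t : ℝ) : X :=
  S (c * t) x + ∫ r in (0 : ℝ)..t, S (c * (t - r)) (y r)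

variable [PartialOrder X] [IsOrderedAddMonoid X] [IsOrderedModule ℝ X] [CompleteSpace X]

namespace ResolventSystem

variable {S : ℝ → X →L[ℝ] X} {R : X →L[ℝ] X} {lam0 : ℝ} (hR : ResolventSystem S R lam0)
include hR

theorem smul_integral {c t : ℝ} (hc : 0 ≤ c) (ht : 0 ≤ t) (x : X) :
    c • ∫ s in (0 : ℝ)..t, S (c * s) x = R (x - S (c * t) x) := by
  rw [intervalIntegral.smul_integral_comp_mul_left (fun s => S s x) c, mul_zero,
    hR.integral _ (mul_nonneg hc ht)]

variable (hX : SpaceAssumptions X)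
include hX

/-- A strongly measurable integrand stays so under a continuous family of operators. -/
theorem aestronglyMeasurable_apply {α : Type*} [MeasurableSpace α] {μ : Measure α}
    {φ : α → ℝ} (hφ : AEStronglyMeasurable φ μ) {y : α → X} (hy : AEStronglyMeasurable y μ) :
    AEStronglyMeasurable (fun p => S (φ p) (y p)) μ :=
  hR.continuous.comp_aestronglyMeasurable (hφ.prodMk hy)

theorem intervalIntegrable_apply {φ : ℝ → ℝ} (hφ : Continuous φ) {y : ℝ → X} {a b : ℝ}
    (hy : IntervalIntegrable y volume a b) :
    IntervalIntegrable (fun r => S (φ r) (y r)) volume a b := by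
  obtain ⟨C, hC, hb⟩ := hR.norm_apply_le hX
  refine (hy.norm.const_mul C).mono_fun' ?_ (Eventually.of_forall fun r => hb _ _)
  exact hR.aestronglyMeasurable_apply hX hφ.aestronglyMeasurable hy.def'.aestronglyMeasurable

/-- The convolution `w(t) = ∫₀ᵗ Sᶜ⁽ᵗ⁻ʳ⁾ y(r) dr` satisfies `c ∫₀ᵗ w = R (∫₀ᵗ y - w(t))`. -/
theorem smul_integral_convolution {c : ℝ} (hc : 0 ≤ c) {y : ℝ → X} (hy : LocIntegrable y)
    {t : ℝ} (ht : 0 ≤ t) :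
    IntervalIntegrable (fun s => ∫ r in (0 : ℝ)..s, S (c * (s - r)) (y r)) volume 0 t ∧
    c • ∫ s in (0 : ℝ)..t, ∫ r in (0 : ℝ)..s, S (c * (s - r)) (y r) =
      R ((∫ r in (0 : ℝ)..t, y r) - ∫ r in (0 : ℝ)..t, S (c * (t - r)) (y r)) := by
  obtain ⟨C, hC, hb⟩ := hR.norm_apply_le hX
  obtain ⟨h1, h2⟩ := integral_triangle (k := fun s r => S (c * (s - r)) (y r)) (C := C) ht
    (hR.aestronglyMeasurable_apply hX
      (Continuous.aestronglyMeasurable (by fun_prop : Continuous fun p : ℝ × ℝ => c * (p.1 - p.2)))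
      (hy t ht).1.aestronglyMeasurable.comp_snd)
    (hy t ht) (fun s r => hb _ _)
  refine ⟨h1, ?_⟩
  have hyS := hR.intervalIntegrable_apply hX (φ := fun r => c * (t - r)) (by fun_prop) (hy t ht)
  rw [h2, ← intervalIntegral.integral_smul, ← intervalIntegral.integral_sub (hy t ht) hyS,
    ← ContinuousLinearMap.intervalIntegral_comp_comm R ((hy t ht).sub hyS)]
  refine intervalIntegral.integral_congr fun r hr => ?_
  rw [uIcc_of_le ht] at hr
  have h3 := intervalIntegral.integral_comp_sub_right (a := r) (b := t)
    (fun s => S (c * s) (y r)) r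
  rw [sub_self] at h3
  simp only [h3]
  exact hR.smul_integral hc (by linarith [hr.2]) _

/-- The dual form of `smul_integral_convolution`, with the primitive of `y` inside. -/
theorem smul_integral_apply_primitive {c : ℝ} (hc : 0 ≤ c) {y : ℝ → X} (hy : LocIntegrable y)
    {t : ℝ} (ht : 0 ≤ t) :
    c • ∫ s in (0 : ℝ)..t, S (c * (t - s)) (∫ r in (0 : ℝ)..s, y r) =
      R ((∫ r in (0 : ℝ)..t, y r) - ∫ r in (0 : ℝ)..t, S (c * (t - r)) (y r)) := by
  obtain ⟨C, hC, hb⟩ := hR.norm_apply_le hX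
  obtain ⟨h1, h2⟩ := integral_triangle (k := fun s r => S (c * (t - s)) (y r)) (C := C) ht
    (hR.aestronglyMeasurable_apply hX
      (Continuous.aestronglyMeasurable (by fun_prop : Continuous fun p : ℝ × ℝ => c * (t - p.1)))
      (hy t ht).1.aestronglyMeasurable.comp_snd)
    (hy t ht) (fun s r => hb _ _)
  have hyS := hR.intervalIntegrable_apply hX (φ := fun r => c * (t - r)) (by fun_prop) (hy t ht)
  have h0 : ∫ s in (0 : ℝ)..t, S (c * (t - s)) (∫ r in (0 : ℝ)..s, y r) =
      ∫ s in (0 : ℝ)..t, ∫ r in (0 : ℝ)..s, S (c * (t - s)) (y r) := by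
    refine intervalIntegral.integral_congr fun s hs => ?_
    rw [uIcc_of_le ht] at hs
    exact (ContinuousLinearMap.intervalIntegral_comp_comm _ (hy s hs.1)).symm
  rw [h0, h2, ← intervalIntegral.integral_smul, ← intervalIntegral.integral_sub (hy t ht) hyS,
    ← ContinuousLinearMap.intervalIntegral_comp_comm R ((hy t ht).sub hyS)]
  refine intervalIntegral.integral_congr fun r hr => ?_
  rw [uIcc_of_le ht] at hr
  have h3 := intervalIntegral.integral_comp_sub_left (a := r) (b := t)
    (fun s => S (c * s) (y r)) t
  rw [sub_self] at h3
  simp only [h3]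
  exact hR.smul_integral hc (by linarith [hr.2]) _

theorem locIntegrable_mildSol {c : ℝ} (hc : 0 ≤ c) (x : X) {y : ℝ → X} (hy : LocIntegrable y) :
    LocIntegrable (mildSol S c x y) := by
  intro t ht
  have h1 : Continuous fun s => S (c * s) x :=
    hR.continuous.comp (by fun_prop : Continuous fun s : ℝ => (c * s, x))
  exact (h1.intervalIntegrable _ _).add (hR.smul_integral_convolution hX hc hy ht).1

/-- The mild solution satisfies the integrated equation. -/
theorem mildSol_identity {c : ℝ} (hc : 0 ≤ c) (x : X) {y : ℝ → X} (hy : LocIntegrable y)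
    {t : ℝ} (ht : 0 ≤ t) :
    R (mildSol S c x y t) + c • ∫ s in (0 : ℝ)..t, mildSol S c x y s =
      R (x + ∫ s in (0 : ℝ)..t, y s) := by
  have h1 : Continuous fun s => S (c * s) x :=
    hR.continuous.comp (by fun_prop : Continuous fun s : ℝ => (c * s, x))
  obtain ⟨h2, h3⟩ := hR.smul_integral_convolution hX hc hy ht
  simp only [mildSol]
  rw [intervalIntegral.integral_add (h1.intervalIntegrable _ _) h2, smul_add, h3,
    hR.smul_integral hc ht, ← map_add, ← map_add]
  congr 1
  abel

/-- The integrated equation has no other locally integrable solution than the mild one. -/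
theorem eq_mildSol_of_identity {c : ℝ} (hc : 0 ≤ c) {x : X} {y z : ℝ → X} (hy : LocIntegrable y)
    (hz : LocIntegrable z)
    (h : ∀ t, 0 ≤ t → R (z t) + c • ∫ s in (0 : ℝ)..t, z s = R (x + ∫ s in (0 : ℝ)..t, y s))
    {t : ℝ} (ht : 0 ≤ t) : z t = mildSol S c x y t := by
  have hm := hR.locIntegrable_mildSol hX hc x hy
  set d : ℝ → X := fun s => z s - mildSol S c x y s with hd_def
  have hd : LocIntegrable d := hz.sub hm
  have hd0 : ∀ s, 0 ≤ s → R (d s) = -(c • ∫ r in (0 : ℝ)..s, d r) := by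
    intro s hs
    have h1 := (h s hs).trans (hR.mildSol_identity hX hc x hy hs).symm
    simp only [hd_def]
    rw [intervalIntegral.integral_sub (hz s hs) (hm s hs), map_sub, smul_sub, neg_sub]
    rw [sub_eq_sub_iff_add_eq_add, h1]
    abel
  have h2 := hR.smul_integral_apply_primitive hX hc hd ht
  have hdS := hR.intervalIntegrable_apply hX (φ := fun r => c * (t - r)) (by fun_prop) (hd t ht)
  have h3 : c • ∫ s in (0 : ℝ)..t, S (c * (t - s)) (∫ r in (0 : ℝ)..s, d r) =
      -R (∫ r in (0 : ℝ)..t, S (c * (t - r)) (d r)) := by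
    rw [← ContinuousLinearMap.intervalIntegral_comp_comm R hdS, ← intervalIntegral.integral_smul,
      ← intervalIntegral.integral_neg]
    refine intervalIntegral.integral_congr fun s hs => ?_
    rw [uIcc_of_le ht] at hs
    rw [← map_smul, ← hR.comm, hd0 s hs.1, map_neg, neg_neg]
  rw [h3, map_sub, eq_comm, sub_eq_neg_self] at h2
  have h4 : ∫ r in (0 : ℝ)..t, d r = 0 := hR.injective (by rw [h2, map_zero])
  have h5 : d t = 0 := hR.injective (by rw [hd0 t ht, h4, smul_zero, neg_zero, map_zero])
  exact sub_eq_zero.1 h5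

theorem mildSol_mono {c : ℝ} {x x' : X} {y y' : ℝ → X}
    (hy : LocIntegrable y) (hy' : LocIntegrable y') (hx : x ≤ x')
    (hyy : ∀ t, 0 ≤ t → y t ≤ y' t) {t : ℝ} (ht : 0 ≤ t) :
    mildSol S c x y t ≤ mildSol S c x' y' t := by
  have := hX.orderClosedTopology
  refine add_le_add (hR.mono _ hx) (integral_mono_cone ht
    (hR.intervalIntegrable_apply hX (by fun_prop) (hy t ht))
    (hR.intervalIntegrable_apply hX (by fun_prop) (hy' t ht)) fun s hs => ?_)
  exact hR.mono _ (hyy s hs.1)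

theorem mildSol_nonneg {c : ℝ} {x : X} {y : ℝ → X} (hx : 0 ≤ x)
    (hy : ∀ t, 0 ≤ t → 0 ≤ y t) {t : ℝ} (ht : 0 ≤ t) : 0 ≤ mildSol S c x y t := by
  have := hX.orderClosedTopology
  exact add_nonneg (hR.pos _ _ hx)
    (integral_nonneg_cone ht fun s hs => hR.pos _ _ (hy s hs.1))

theorem mildSol_le {c : ℝ} {x : X} {y y' : ℝ → X} {T : ℝ}
    (hy : LocIntegrable y) (hy' : IntervalIntegrable y' volume 0 T) (hx : 0 ≤ x)
    (hy0 : ∀ t ∈ Icc 0 T, 0 ≤ y t) (hyy : ∀ t ∈ Icc 0 T, y t ≤ y' t) {t : ℝ} (ht : t ∈ Icc 0 T) :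
    mildSol S c x y t ≤ x + ∫ s in (0 : ℝ)..T, y' s := by
  have := hX.orderClosedTopology
  have hT : 0 ≤ T := ht.1.trans ht.2
  refine add_le_add (hR.le _ _ hx) ?_
  calc ∫ r in (0 : ℝ)..t, S (c * (t - r)) (y r) ≤ ∫ r in (0 : ℝ)..t, y r := by
        refine integral_mono_cone ht.1 (hR.intervalIntegrable_apply hX (by fun_prop) (hy t ht.1))
          (hy t ht.1) fun s hs => hR.le _ _ (hy0 s ⟨hs.1, hs.2.trans ht.2⟩)
    _ ≤ ∫ r in (0 : ℝ)..T, y r := integral_mono_right_cone ht.1 ht.2 (hy T hT) hy0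
    _ ≤ ∫ r in (0 : ℝ)..T, y' r := integral_mono_cone hT (hy T hT) hy' hyy

omit hX in
theorem mildSol_pow {c : ℝ} (k : ℕ) (hX : SpaceAssumptions X) (x : X) {y : ℝ → X}
    (hy : LocIntegrable y) {t : ℝ} (ht : 0 ≤ t) :
    mildSol S c ((R ^ k) x) (fun s => (R ^ k) (y s)) t = (R ^ k) (mildSol S c x y t) := by
  simp only [mildSol, hR.comm_pow, map_add]
  rw [ContinuousLinearMap.intervalIntegral_comp_comm _
    (hR.intervalIntegrable_apply hX (by fun_prop) (hy t ht))]

end ResolventSystem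

end

section

/-! ### The reduced equation -/

/-- `R` need only be a right inverse of `Λ`. -/
theorem evPow_pow_apply {X : Type*} [NormedAddCommGroup X] [NormedSpace ℝ X] {R : X →L[ℝ] X}
    {Λ : X →ₗ.[ℝ] X} (hev : ∀ x, ev Λ (R x) = x) (k : ℕ) (x : X) :
    evPow Λ k ((R ^ k) x) = x := by
  induction k generalizing x with
  | zero => rfl
  | succ k ih =>
    rw [pow_succ_apply]
    change ev Λ (evPow Λ k ((R ^ k) (R x))) = x
    rw [ih, hev]

/-- A convex function on the half-line has increasing increments. -/
theorem _root_.ConvexOn.increment_le {a : ℝ → ℝ} (ha : ConvexOn ℝ (Ici 0) a) {x x' y : ℝ}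
    (hx : 0 ≤ x) (hxx : x ≤ x') (hy : 0 ≤ y) : a (x + y) + a x' ≤ a x + a (x' + y) := by
  rcases eq_or_lt_of_le (add_nonneg (sub_nonneg.2 hxx) hy) with hD | hD
  · have h1 : y = 0 := by linarith [sub_nonneg.2 hxx]
    have h2 : x' = x := by linarith
    subst h1; subst h2; simp
  set D := x' - x + y with hDdef
  have hx1 : x ∈ Ici (0 : ℝ) := hx
  have hx2 : x' + y ∈ Ici (0 : ℝ) := by simp only [mem_Ici]; linarith
  have hα : 0 ≤ y / D := by positivity
  have hβ : 0 ≤ (x' - x) / D := div_nonneg (sub_nonneg.2 hxx) hD.le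
  have hsum : y / D + (x' - x) / D = 1 := by
    rw [← add_div, add_comm y]; exact div_self hD.ne'
  have e1 : (x' - x) / D * D = x' - x := div_mul_cancel₀ _ hD.ne'
  have e2 : y / D * D = y := div_mul_cancel₀ _ hD.ne'
  have h1 := ha.2 hx1 hx2 hα hβ hsum
  have h2 := ha.2 hx1 hx2 hβ hα (by rw [add_comm]; exact hsum)
  simp only [smul_eq_mul] at h1 h2
  have p1 : y / D * x + (x' - x) / D * (x' + y) = x' := by
    have : x' + y = x + D := by rw [hDdef]; ring
    rw [this, mul_add, e1, ← add_assoc, ← add_mul, hsum]; ring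
  have p2 : (x' - x) / D * x + y / D * (x' + y) = x + y := by
    have : x' + y = x + D := by rw [hDdef]; ring
    rw [this, mul_add, e2, ← add_assoc, ← add_mul, add_comm ((x' - x) / D), hsum]; ring
  rw [p1] at h1
  rw [p2] at h2
  calc a (x + y) + a x' ≤ ((x' - x) / D * a x + y / D * a (x' + y)) +
        (y / D * a x + (x' - x) / D * a (x' + y)) := add_le_add h2 h1
    _ = (y / D + (x' - x) / D) * (a x + a (x' + y)) := by ring
    _ = _ := by rw [hsum, one_mul]

variable {X : Type*} [NormedAddCommGroup X] [NormedSpace ℝ X] [PartialOrder X]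
  [IsOrderedAddMonoid X] [IsOrderedModule ℝ X]

/-- The hypotheses on the equation `df/dt = P⁺(t, f) - P⁻(t, f)` that remains when the group has
been removed by the substitution `f(t) ↦ U⁻ᵗ f(t)`. The domains `𝒟₊(Λᵏ)` are the cones `Rᵏ X₊`,
the conditions hold at every time, and `κ ∘ Λ` is the functional `g ↦ ‖Λ₁ g‖` on `𝒟₊(Λ)`. -/
structure ReducedModel (S : ℝ → X →L[ℝ] X) (R : X →L[ℝ] X) (lam0 : ℝ) (Λ : X →ₗ.[ℝ] X)
    (Pp Pm : ℝ → X → X) (a ρ : ℝ → ℝ) (κ : X →L[ℝ] ℝ) : Prop where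
  sys : ResolventSystem S R lam0
  ev_R : ∀ x, ev Λ (R x) = x
  nonneg_m : ∀ t, ∀ g ∈ conePow R 1, 0 ≤ Pm t g
  meas_p : ∀ g : ℝ → X, AEStronglyMeasurable g lebPos → (∀ t, 0 ≤ t → g t ∈ conePow R 1) →
    AEStronglyMeasurable (fun t => Pp t (g t)) lebPos
  meas_m : ∀ g : ℝ → X, AEStronglyMeasurable g lebPos → (∀ t, 0 ≤ t → g t ∈ conePow R 1) →
    AEStronglyMeasurable (fun t => Pm t (g t)) lebPos
  mono_p : ∀ t, MonotoneOn (Pp t) (conePow R 1)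
  mono_m : ∀ t, MonotoneOn (Pm t) (conePow R 1)
  closed_p : ∀ (t : ℝ) (u : ℕ → X) (g h : X), (∀ n, u n ∈ conePow R 1) → Monotone u →
    Tendsto u atTop (𝓝 g) → Tendsto (fun n => Pp t (u n)) atTop (𝓝 h) → Pp t g = h
  closed_m : ∀ (t : ℝ) (u : ℕ → X) (g h : X), (∀ n, u n ∈ conePow R 1) → Monotone u →
    Tendsto u atTop (𝓝 g) → Tendsto (fun n => Pm t (u n)) atTop (𝓝 h) → Pm t g = h
  maps_two : ∀ t, MapsTo (Pp t) (conePow R 2) (conePow R 1)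
  maps_top : ∀ t, MapsTo (Pp t) (coneTop R) (coneTop R)
  a_nonneg : ∀ x : ℝ, 0 ≤ x → 0 ≤ a x
  a_mono : MonotoneOn a (Ici 0)
  a_convex : ConvexOn ℝ (Ici 0) a
  bound : ∀ t, ∀ g ∈ conePow R 1, Pm t g ≤ a ‖ev Λ g‖ • ev Λ g
  bound_mono : ∀ t, MonotoneOn (fun g => a ‖ev Λ g‖ • ev Λ g - Pm t g) (conePow R 1)
  delta_nonneg : ∀ t, ∀ g ∈ conePow R 2, 0 ≤ Delta Pp Pm Λ t g
  delta_mono : ∀ t, MonotoneOn (Delta Pp Pm Λ t) (conePow R 2)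
  rho_nonneg : ∀ x : ℝ, 0 ≤ x → 0 ≤ ρ x
  rho_mono : MonotoneOn ρ (Ici 0)
  kappa_nonneg : ∀ x, 0 ≤ x → 0 ≤ κ x
  kappa_le : ∀ t, ∀ g ∈ conePow R 2, κ (ev Λ (Pp t g)) ≤ κ (ev Λ (Pm t g))
  povzner : ∀ t, ∀ g ∈ conePow R 3,
    ‖evPow Λ 2 (Pp t g)‖ ≤ ‖evPow Λ 2 (Pm t g)‖ + ρ (κ (ev Λ g)) * ‖evPow Λ 2 g‖
  integrable : ∀ k : ℕ, 1 ≤ k → ∀ g ∈ coneTop R, LocIntegrable fun t => evPow Λ k (Pp t g)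

/-- A measurable curve in `𝒟₊(Λ²)` whose image under `Λ²` is locally bounded. -/
structure RegularCurve (R : X →L[ℝ] X) (Λ : X →ₗ.[ℝ] X) (g : ℝ → X) : Prop where
  meas : AEStronglyMeasurable g lebPos
  mem : ∀ t, 0 ≤ t → g t ∈ conePow R 2
  bdd : ∀ T, 0 ≤ T → ∃ K, 0 ≤ K ∧ ∀ t ∈ Icc 0 T, ‖evPow Λ 2 (g t)‖ ≤ K

/-- A measurable positive curve that is locally bounded, in the order sense, by smooth elements. -/
structure SmoothCurve (R : X →L[ℝ] X) (g : ℝ → X) : Prop where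
  meas : AEStronglyMeasurable g lebPos
  nonneg : ∀ t, 0 ≤ t → 0 ≤ g t
  le : ∀ T, 0 ≤ T → ∃ G ∈ coneTop R, ∀ t ∈ Icc 0 T, g t ≤ G

/-- The coefficient `a(‖Λ g(t)‖ + ∫₀ᵗ Δ(s, h(s)) ds)` of the linear term in the iteration. -/
def rate (Λ : X →ₗ.[ℝ] X) (Pp Pm : ℝ → X → X) (a : ℝ → ℝ) (g h : ℝ → X) (t : ℝ) : ℝ :=
  a (‖ev Λ (g t)‖ + ∫ s in (0 : ℝ)..t, Delta Pp Pm Λ s (h s))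

/-- The source term `P⁺(t, g) + (rate · Λ g - P⁻(t, g))` of the iteration. -/
def source (Λ : X →ₗ.[ℝ] X) (Pp Pm : ℝ → X → X) (a : ℝ → ℝ) (g h : ℝ → X) (t : ℝ) : X :=
  Pp t (g t) + (rate Λ Pp Pm a g h t • ev Λ (g t) - Pm t (g t))

namespace ReducedModel

variable [CompleteSpace X] {S : ℝ → X →L[ℝ] X} {R : X →L[ℝ] X} {lam0 : ℝ} {Λ : X →ₗ.[ℝ] X}
  {Pp Pm : ℝ → X → X} {a ρ : ℝ → ℝ} {κ : X →L[ℝ] ℝ}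
  (hm : ReducedModel S R lam0 Λ Pp Pm a ρ κ)
include hm

/-! #### Powers of `Λ` on the cones -/

theorem evPow_pow (k : ℕ) (x : X) : evPow Λ k ((R ^ k) x) = x := evPow_pow_apply hm.ev_R k x

theorem pow_evPow {k : ℕ} {g : X} (hg : g ∈ conePow R k) : (R ^ k) (evPow Λ k g) = g := by
  obtain ⟨x, -, rfl⟩ := hg
  rw [hm.evPow_pow]

theorem evPow_nonneg {k : ℕ} {g : X} (hg : g ∈ conePow R k) : 0 ≤ evPow Λ k g := by
  obtain ⟨x, hx, rfl⟩ := hg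
  rwa [hm.evPow_pow]

theorem R_ev {g : X} (hg : g ∈ conePow R 1) : R (ev Λ g) = g := by
  obtain ⟨x, -, rfl⟩ := hg
  rw [pow_one, hm.ev_R]

theorem R_evPow_succ {k : ℕ} {g : X} (hg : g ∈ conePow R (k + 1)) :
    R (evPow Λ (k + 1) g) = evPow Λ k g := by
  obtain ⟨x, -, rfl⟩ := hg
  rw [hm.evPow_pow, pow_succ_apply, hm.evPow_pow]

theorem ev_nonneg {g : X} (hg : g ∈ conePow R 1) : 0 ≤ ev Λ g := by
  obtain ⟨x, hx, rfl⟩ := hg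
  rwa [pow_one, hm.ev_R]

theorem ev_mem {k : ℕ} {g : X} (hg : g ∈ conePow R (k + 1)) : ev Λ g ∈ conePow R k := by
  obtain ⟨x, hx, rfl⟩ := hg
  rw [pow_succ_apply', hm.ev_R]
  exact ⟨x, hx, rfl⟩

theorem evPow_ev {k : ℕ} {g : X} (hg : g ∈ conePow R (k + 1)) :
    evPow Λ k (ev Λ g) = evPow Λ (k + 1) g := by
  obtain ⟨x, hx, rfl⟩ := hg
  rw [hm.evPow_pow, pow_succ_apply', hm.ev_R, hm.evPow_pow]

theorem ev_zero : ev Λ 0 = 0 := by simpa using hm.ev_R 0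

theorem zero_mem (k : ℕ) : (0 : X) ∈ conePow R k := ⟨0, le_rfl, by simp⟩

theorem conePow_add {k : ℕ} {g h : X} (hg : g ∈ conePow R k) (hh : h ∈ conePow R k) :
    g + h ∈ conePow R k := by
  obtain ⟨x, hx, rfl⟩ := hg
  obtain ⟨y, hy, rfl⟩ := hh
  exact ⟨x + y, add_nonneg hx hy, map_add _ _ _⟩

theorem conePow_smul {k : ℕ} {g : X} (hg : g ∈ conePow R k) {r : ℝ} (hr : 0 ≤ r) :
    r • g ∈ conePow R k := by
  obtain ⟨x, hx, rfl⟩ := hg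
  exact ⟨r • x, smul_nonneg hr hx, map_smul _ _ _⟩

theorem coneTop_ev {g : X} (hg : g ∈ coneTop R) : ev Λ g ∈ coneTop R :=
  fun k => hm.ev_mem (hg (k + 1))

variable (hX : SpaceAssumptions X)
include hX

theorem evPow_mono {k : ℕ} {g h : X} (hg : g ∈ conePow R k) (hh : h ∈ conePow R k) (hgh : g ≤ h) :
    evPow Λ k g ≤ evPow Λ k h := by
  refine hm.sys.le_of_pow_le hX k ?_
  rwa [hm.pow_evPow hg, hm.pow_evPow hh]

theorem ev_mono {g h : X} (hg : g ∈ conePow R 1) (hh : h ∈ conePow R 1) (hgh : g ≤ h) :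
    ev Λ g ≤ ev Λ h := hm.evPow_mono hX (k := 1) hg hh hgh

theorem loss_mem {k : ℕ} {t : ℝ} {g : X} (hg : g ∈ conePow R (k + 1)) : Pm t g ∈ conePow R k := by
  have h1 : g ∈ conePow R 1 := hm.sys.conePow_antitone (by omega) hg
  exact hm.sys.conePow_of_le hX (hm.nonneg_m t g h1) (hm.bound t g h1)
    (hm.conePow_smul (hm.ev_mem hg) (hm.a_nonneg _ (norm_nonneg _)))

/-- `Λᵏ P⁻` is controlled by `Λᵏ⁺¹`. -/
theorem norm_evPow_loss_le {k : ℕ} {t : ℝ} {g : X} (hg : g ∈ conePow R (k + 1)) :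
    ‖evPow Λ k (Pm t g)‖ ≤ a ‖ev Λ g‖ * ‖evPow Λ (k + 1) g‖ := by
  have h1 : g ∈ conePow R 1 := hm.sys.conePow_antitone (by omega) hg
  have ha := hm.a_nonneg _ (norm_nonneg (ev Λ g))
  have h2 := hm.conePow_smul (hm.ev_mem hg) ha
  have h3 := hm.evPow_mono hX (hm.loss_mem hX hg) h2 (hm.bound t g h1)
  have h4 : evPow Λ k (a ‖ev Λ g‖ • ev Λ g) = a ‖ev Λ g‖ • evPow Λ (k + 1) g := by
    obtain ⟨x, hx, hxg⟩ := hg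
    rw [← hxg, hm.evPow_pow, pow_succ_apply', hm.ev_R, ← map_smul, hm.evPow_pow]
  rw [h4] at h3
  have h5 := hX.norm_le (hm.evPow_nonneg (hm.loss_mem hX hg)) h3
  rwa [norm_smul, Real.norm_of_nonneg ha] at h5

theorem norm_R_le {x : X} (hx : 0 ≤ x) : ‖R x‖ ≤ lam0⁻¹ * ‖x‖ := by
  have hl := hm.sys.lam_pos
  have h1 := hX.norm_le (smul_nonneg hl.le (hm.sys.R_pos x hx)) (hm.sys.R_le x hx)
  rw [norm_smul, Real.norm_of_nonneg hl.le] at h1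
  rw [← div_eq_inv_mul, le_div_iff₀ hl]
  linarith

theorem norm_le_ev {g : X} (hg : g ∈ conePow R 1) : ‖g‖ ≤ lam0⁻¹ * ‖ev Λ g‖ := by
  conv_lhs => rw [← hm.R_ev hg]
  exact hm.norm_R_le hX (hm.ev_nonneg hg)

theorem norm_gain_le {t : ℝ} {g : X} (hg : g ∈ conePow R 2) :
    ‖ev Λ (Pp t g)‖ ≤ ‖ev Λ (Pm t g)‖ := sub_nonneg.1 (hm.delta_nonneg t g hg)

theorem loss_zero (t : ℝ) : Pm t 0 = 0 := by
  have h1 := hm.bound t 0 (hm.zero_mem 1)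
  rw [hm.ev_zero, smul_zero] at h1
  exact le_antisymm h1 (hm.nonneg_m t 0 (hm.zero_mem 1))

theorem delta_zero (t : ℝ) : Delta Pp Pm Λ t 0 = 0 := by
  refine le_antisymm ?_ (hm.delta_nonneg t 0 (hm.zero_mem 2))
  simp only [Delta]
  rw [hm.loss_zero hX, hm.ev_zero, norm_zero, zero_sub]
  exact neg_nonpos.2 (norm_nonneg _)

/-! #### Measurability and integrability along curves -/

theorem aestronglyMeasurable_ev {α : Type*} [MeasurableSpace α] {μ : Measure α} {b : α → X}
    (hb : AEStronglyMeasurable b μ) (hmem : ∀ᵐ t ∂μ, b t ∈ conePow R 1) :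
    AEStronglyMeasurable (fun t => ev Λ (b t)) μ := by
  let τ : ℕ → ℝ := fun n => (1 / 2 : ℝ) ^ n
  have hτ0 : Tendsto τ atTop (𝓝[>] 0) := tendsto_nhdsWithin_iff.2
    ⟨tendsto_pow_atTop_nhds_zero_of_lt_one (by norm_num) (by norm_num),
      Eventually.of_forall fun n => (by positivity : (0 : ℝ) < (1 / 2 : ℝ) ^ n)⟩
  refine aestronglyMeasurable_of_tendsto_ae atTop
    (f := fun n t => (τ n)⁻¹ • (b t - S (τ n) (b t))) (fun n => ?_) ?_
  · exact (hb.sub ((S (τ n)).continuous.comp_aestronglyMeasurable hb)).const_smul _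
  · filter_upwards [hmem] with t ht
    have h1 := (hm.sys.tendsto_quotient hX (ev Λ (b t))).comp hτ0
    rwa [hm.R_ev ht] at h1

theorem aestronglyMeasurable_evPow {b : ℝ → X} (k : ℕ)
    (hb : AEStronglyMeasurable b lebPos) (hmem : ∀ t, 0 ≤ t → b t ∈ conePow R k) :
    AEStronglyMeasurable (fun t => evPow Λ k (b t)) lebPos := by
  induction k with
  | zero => exact hb
  | succ k ih =>
    refine hm.aestronglyMeasurable_ev hX
      (ih fun t ht => hm.sys.conePow_antitone (Nat.le_succ k) (hmem t ht)) ?_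
    refine lebPos_ae_iff.2 (Eventually.of_forall fun t ht => ?_)
    obtain ⟨x, hx, hxb⟩ := hmem t ht
    rw [← hxb, pow_succ_apply, hm.evPow_pow]
    exact ⟨x, hx, by rw [pow_one]⟩

omit hX in
theorem mem_one {g : ℝ → X} (hg : RegularCurve R Λ g) {t : ℝ} (ht : 0 ≤ t) :
    g t ∈ conePow R 1 := hm.sys.conePow_antitone (by omega) (hg.mem t ht)

theorem exists_norm_ev_le {g : ℝ → X} (hg : RegularCurve R Λ g) {T : ℝ} (hT : 0 ≤ T) :
    ∃ K, 0 ≤ K ∧ ∀ t ∈ Icc 0 T, ‖ev Λ (g t)‖ ≤ K := by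
  obtain ⟨K, hK, h⟩ := hg.bdd T hT
  have hl := inv_nonneg.2 hm.sys.lam_pos.le
  refine ⟨lam0⁻¹ * K, mul_nonneg hl hK, fun t ht => ?_⟩
  refine (hm.norm_le_ev hX (hm.ev_mem (k := 1) (hg.mem t ht.1))).trans ?_
  exact mul_le_mul_of_nonneg_left (h t ht) hl

theorem exists_norm_loss_le {g : ℝ → X} (hg : RegularCurve R Λ g) {T : ℝ} (hT : 0 ≤ T) :
    ∃ K, 0 ≤ K ∧ ∀ t ∈ Icc 0 T, ‖ev Λ (Pm t (g t))‖ ≤ K := by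
  obtain ⟨K, hK, h⟩ := hg.bdd T hT
  obtain ⟨K', hK', h'⟩ := hm.exists_norm_ev_le hX hg hT
  have ha := hm.a_nonneg K' hK'
  refine ⟨a K' * K, mul_nonneg ha hK, fun t ht => ?_⟩
  refine (hm.norm_evPow_loss_le hX (k := 1) (hg.mem t ht.1)).trans ?_
  exact mul_le_mul (hm.a_mono (norm_nonneg _) hK' (h' t ht)) (h t ht) (norm_nonneg _) ha

theorem locIntegrable_ev_loss {g : ℝ → X} (hg : RegularCurve R Λ g) :
    LocIntegrable fun t => ev Λ (Pm t (g t)) := by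
  intro T hT
  obtain ⟨K, hK, h⟩ := hm.exists_norm_loss_le hX hg hT
  refine intervalIntegrable_of_norm_le hT ?_ (intervalIntegrable_const (c := K)) h
  refine hm.aestronglyMeasurable_evPow hX 1 (hm.meas_m g hg.meas fun t ht => hm.mem_one hg ht) ?_
  exact fun t ht => hm.loss_mem hX (hg.mem t ht)

theorem locIntegrable_ev_gain {g : ℝ → X} (hg : RegularCurve R Λ g) :
    LocIntegrable fun t => ev Λ (Pp t (g t)) := by
  intro T hT
  obtain ⟨K, hK, h⟩ := hm.exists_norm_loss_le hX hg hT
  refine intervalIntegrable_of_norm_le hT ?_ (intervalIntegrable_const (c := K))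
    fun t ht => (hm.norm_gain_le hX (hg.mem t ht.1)).trans (h t ht)
  refine hm.aestronglyMeasurable_evPow hX 1 (hm.meas_p g hg.meas fun t ht => hm.mem_one hg ht) ?_
  exact fun t ht => hm.maps_two t (hg.mem t ht)

theorem locIntegrable_delta {g : ℝ → X} (hg : RegularCurve R Λ g) :
    LocIntegrable fun t => Delta Pp Pm Λ t (g t) :=
  (hm.locIntegrable_ev_loss hX hg).norm.sub (hm.locIntegrable_ev_gain hX hg).norm

omit hX in
theorem integral_delta_nonneg {g : ℝ → X} (hg : RegularCurve R Λ g) {t : ℝ} (ht : 0 ≤ t) :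
    0 ≤ ∫ s in (0 : ℝ)..t, Delta Pp Pm Λ s (g s) :=
  intervalIntegral.integral_nonneg ht fun s hs => hm.delta_nonneg s _ (hg.mem s hs.1)

theorem integral_delta_mono {g h : ℝ → X} (hg : RegularCurve R Λ g) (hh : RegularCurve R Λ h)
    (hgh : ∀ t, 0 ≤ t → g t ≤ h t) {t : ℝ} (ht : 0 ≤ t) :
    ∫ s in (0 : ℝ)..t, Delta Pp Pm Λ s (g s) ≤ ∫ s in (0 : ℝ)..t, Delta Pp Pm Λ s (h s) :=
  intervalIntegral.integral_mono_on ht (hm.locIntegrable_delta hX hg t ht)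
    (hm.locIntegrable_delta hX hh t ht) fun s hs =>
      hm.delta_mono s (hg.mem s hs.1) (hh.mem s hs.1) (hgh s hs.1)

/-- The coefficient is measurable because `a` is monotone; `a` may be discontinuous at `0`. -/
theorem aestronglyMeasurable_rate {g h : ℝ → X} (hg : RegularCurve R Λ g)
    (hh : RegularCurve R Λ h) : AEStronglyMeasurable (rate Λ Pp Pm a g h) lebPos := by
  have h1 : AEStronglyMeasurable (fun t => ‖ev Λ (g t)‖ + ∫ s in (0 : ℝ)..t, Delta Pp Pm Λ s (h s))
      lebPos :=
    (hm.aestronglyMeasurable_evPow hX 1 hg.meas fun t ht => hm.mem_one hg ht).norm.add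
      ((hm.locIntegrable_delta hX hh).continuousOn_integral.aestronglyMeasurable measurableSet_Ici)
  have hmono : Monotone fun x : ℝ => a (max x 0) := fun x y hxy =>
    hm.a_mono (mem_Ici.2 (le_max_right _ _)) (mem_Ici.2 (le_max_right _ _)) (max_le_max_right 0 hxy)
  have h2 := (hmono.measurable.comp_aemeasurable h1.aemeasurable).aestronglyMeasurable
  refine h2.congr (lebPos_ae_iff.2 (Eventually.of_forall fun t ht => ?_))
  simp only [Function.comp_apply, rate]
  rw [max_eq_left (add_nonneg (norm_nonneg _) (hm.integral_delta_nonneg hh ht))]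

omit hX in
theorem rate_le {g h : ℝ → X} (hh : RegularCurve R Λ h) {M t : ℝ} (ht : 0 ≤ t)
    (hM : ‖ev Λ (g t)‖ + ∫ s in (0 : ℝ)..t, Delta Pp Pm Λ s (h s) ≤ M) :
    rate Λ Pp Pm a g h t ≤ a M := by
  have h1 := add_nonneg (norm_nonneg (ev Λ (g t))) (hm.integral_delta_nonneg hh ht)
  exact hm.a_mono h1 (mem_Ici.2 (h1.trans hM)) hM

omit hX in
theorem le_rate {g h : ℝ → X} (hh : RegularCurve R Λ h) {t : ℝ} (ht : 0 ≤ t) :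
    a ‖ev Λ (g t)‖ ≤ rate Λ Pp Pm a g h t := by
  have h1 := hm.integral_delta_nonneg hh ht
  exact hm.a_mono (norm_nonneg _) (mem_Ici.2 (add_nonneg (norm_nonneg _) h1)) (by linarith)

omit hX in
theorem rate_nonneg {g h : ℝ → X} (hh : RegularCurve R Λ h) {t : ℝ} (ht : 0 ≤ t) :
    0 ≤ rate Λ Pp Pm a g h t :=
  (hm.a_nonneg _ (norm_nonneg _)).trans (hm.le_rate hh ht)

omit hX in
theorem loss_le_rate {g h : ℝ → X} (hg : RegularCurve R Λ g) (hh : RegularCurve R Λ h) {t : ℝ}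
    (ht : 0 ≤ t) : Pm t (g t) ≤ rate Λ Pp Pm a g h t • ev Λ (g t) :=
  (hm.bound t _ (hm.mem_one hg ht)).trans
    (smul_le_smul_of_nonneg_right (hm.le_rate hh ht) (hm.ev_nonneg (hm.mem_one hg ht)))

theorem source_mem {g h : ℝ → X} (hg : RegularCurve R Λ g) (hh : RegularCurve R Λ h) {t : ℝ}
    (ht : 0 ≤ t) : source Λ Pp Pm a g h t ∈ conePow R 1 := by
  refine hm.conePow_add (hm.maps_two t (hg.mem t ht)) ?_
  refine hm.sys.conePow_of_le hX (sub_nonneg.2 (hm.loss_le_rate hg hh ht))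
    (sub_le_self _ (hm.nonneg_m t _ (hm.mem_one hg ht))) ?_
  exact hm.conePow_smul (hm.ev_mem (k := 1) (hg.mem t ht)) (hm.rate_nonneg hh ht)

theorem source_nonneg {g h : ℝ → X} (hg : RegularCurve R Λ g) (hh : RegularCurve R Λ h) {t : ℝ}
    (ht : 0 ≤ t) : 0 ≤ source Λ Pp Pm a g h t := hm.sys.conePow_nonneg (hm.source_mem hX hg hh ht)

/-- `Λᵏ` of the source term, computed termwise. -/
theorem evPow_source {k : ℕ} {g h : ℝ → X} {t : ℝ} (hg : g t ∈ conePow R (k + 1))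
    (hP : Pp t (g t) ∈ conePow R k) :
    evPow Λ k (source Λ Pp Pm a g h t) = evPow Λ k (Pp t (g t)) +
      (rate Λ Pp Pm a g h t • evPow Λ (k + 1) (g t) - evPow Λ k (Pm t (g t))) := by
  have h1 := hm.pow_evPow hP
  have h2 := hm.pow_evPow (hm.loss_mem hX (t := t) hg)
  have h3 := hm.pow_evPow (hm.ev_mem hg)
  rw [hm.evPow_ev hg] at h3
  have : source Λ Pp Pm a g h t = (R ^ k) (evPow Λ k (Pp t (g t)) +
      (rate Λ Pp Pm a g h t • evPow Λ (k + 1) (g t) - evPow Λ k (Pm t (g t)))) := by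
    rw [map_add, map_sub, map_smul, h1, h2, h3]; rfl
  rw [this, hm.evPow_pow]

theorem ev_source {g h : ℝ → X} (hg : RegularCurve R Λ g) {t : ℝ} (ht : 0 ≤ t) :
    ev Λ (source Λ Pp Pm a g h t) = ev Λ (Pp t (g t)) +
      (rate Λ Pp Pm a g h t • evPow Λ 2 (g t) - ev Λ (Pm t (g t))) :=
  hm.evPow_source hX (k := 1) (hg.mem t ht) (hm.maps_two t (hg.mem t ht))

theorem locIntegrable_rate_smul {g h : ℝ → X} (hg : RegularCurve R Λ g) (hh : RegularCurve R Λ h)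
    {M : ℝ} (hM : ∀ t, 0 ≤ t → ‖ev Λ (g t)‖ + ∫ s in (0 : ℝ)..t, Delta Pp Pm Λ s (h s) ≤ M) :
    LocIntegrable fun t => rate Λ Pp Pm a g h t • evPow Λ 2 (g t) := by
  intro T hT
  obtain ⟨K, hK, h1⟩ := hg.bdd T hT
  refine intervalIntegrable_of_norm_le hT ((hm.aestronglyMeasurable_rate hX hg hh).smul
    (hm.aestronglyMeasurable_evPow hX 2 hg.meas hg.mem))
    (intervalIntegrable_const (c := a M * K)) fun t ht => ?_
  have h2 := hm.rate_le (a := a) hh ht.1 (hM t ht.1)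
  have h3 := hm.rate_nonneg (g := g) hh ht.1
  rw [norm_smul, Real.norm_of_nonneg h3]
  exact mul_le_mul h2 (h1 t ht) (norm_nonneg _) (h3.trans h2)

theorem locIntegrable_ev_source {g h : ℝ → X} (hg : RegularCurve R Λ g) (hh : RegularCurve R Λ h)
    {M : ℝ} (hM : ∀ t, 0 ≤ t → ‖ev Λ (g t)‖ + ∫ s in (0 : ℝ)..t, Delta Pp Pm Λ s (h s) ≤ M) :
    LocIntegrable fun t => ev Λ (source Λ Pp Pm a g h t) :=
  ((hm.locIntegrable_ev_gain hX hg).add ((hm.locIntegrable_rate_smul hX hg hh hM).sub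
    (hm.locIntegrable_ev_loss hX hg))).congr fun _ ht => (hm.ev_source hX hg ht).symm

/-- The source term is isotone in both arguments; this is where the convexity of `a` enters. -/
theorem source_mono {g h g' h' : ℝ → X} (hg : RegularCurve R Λ g) (hh : RegularCurve R Λ h)
    (hg' : RegularCurve R Λ g') (hh' : RegularCurve R Λ h') (hgg : ∀ t, 0 ≤ t → g t ≤ g' t)
    (hhh : ∀ t, 0 ≤ t → h t ≤ h' t) {t : ℝ} (ht : 0 ≤ t) :
    source Λ Pp Pm a g h t ≤ source Λ Pp Pm a g' h' t := by
  have m1 := hm.mem_one hg ht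
  have m2 := hm.mem_one hg' ht
  refine add_le_add (hm.mono_p t m1 m2 (hgg t ht)) ?_
  have h1 := hm.bound_mono t m1 m2 (hgg t ht)
  simp only at h1
  have hL := hm.ev_mono hX m1 m2 (hgg t ht)
  have hL0 := hm.ev_nonneg m1
  have hn := hX.norm_le hL0 hL
  have hi0 := hm.integral_delta_nonneg hh ht
  have hi := hm.integral_delta_mono hX hh hh' hhh ht
  have hinc := hm.a_convex.increment_le (norm_nonneg (ev Λ (g t))) hn hi0
  have hlast : a (‖ev Λ (g' t)‖ + ∫ s in (0 : ℝ)..t, Delta Pp Pm Λ s (h s)) ≤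
      rate Λ Pp Pm a g' h' t :=
    hm.a_mono (mem_Ici.2 (add_nonneg (norm_nonneg _) hi0))
      (mem_Ici.2 (add_nonneg (norm_nonneg _) (hi0.trans hi))) (by linarith)
  have hr : rate Λ Pp Pm a g h t - a ‖ev Λ (g t)‖ ≤
      rate Λ Pp Pm a g' h' t - a ‖ev Λ (g' t)‖ := by
    have : rate Λ Pp Pm a g h t =
      a (‖ev Λ (g t)‖ + ∫ s in (0 : ℝ)..t, Delta Pp Pm Λ s (h s)) := rfl
    linarith
  have hr0 : 0 ≤ rate Λ Pp Pm a g h t - a ‖ev Λ (g t)‖ := sub_nonneg.2 (hm.le_rate hh ht)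
  have h2 : (rate Λ Pp Pm a g h t - a ‖ev Λ (g t)‖) • ev Λ (g t) ≤
      (rate Λ Pp Pm a g' h' t - a ‖ev Λ (g' t)‖) • ev Λ (g' t) :=
    (smul_le_smul_of_nonneg_left hL hr0).trans
      (smul_le_smul_of_nonneg_right hr (hL0.trans hL))
  have e : ∀ (r q : ℝ) (x y : X), r • x - y = (q • x - y) + (r - q) • x := by
    intro r q x y; module
  rw [e _ (a ‖ev Λ (g t)‖), e (rate Λ Pp Pm a g' h' t) (a ‖ev Λ (g' t)‖)]
  exact add_le_add h1 h2

/-! #### Smooth curves -/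

theorem smooth_mem {g : ℝ → X} (hg : SmoothCurve R g) {t : ℝ} (ht : 0 ≤ t) : g t ∈ coneTop R := by
  obtain ⟨G, hG, hle⟩ := hg.le t ht
  exact fun k => hm.sys.conePow_of_le hX (hg.nonneg t ht) (hle t ⟨ht, le_rfl⟩) (hG k)

theorem _root_.OrderedEvolution.SmoothCurve.regular {g : ℝ → X} (hg : SmoothCurve R g) :
    RegularCurve R Λ g where
  meas := hg.meas
  mem t ht := hm.smooth_mem hX hg ht 2
  bdd T hT := by
    obtain ⟨G, hG, hle⟩ := hg.le T hT
    refine ⟨‖evPow Λ 2 G‖, norm_nonneg _, fun t ht => ?_⟩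
    have h1 := hm.smooth_mem hX hg ht.1 2
    exact hX.norm_le (hm.evPow_nonneg h1) (hm.evPow_mono hX h1 (hG 2) (hle t ht))

/-- Below a smooth bound `G` for `g`, the source term stays below a curve of smooth elements. -/
theorem source_le {g h : ℝ → X} (hg : SmoothCurve R g) (hh : RegularCurve R Λ h) {M t : ℝ}
    (ht : 0 ≤ t) {G : X} (hG : G ∈ coneTop R) (hgG : g t ≤ G)
    (hM : ‖ev Λ (g t)‖ + ∫ s in (0 : ℝ)..t, Delta Pp Pm Λ s (h s) ≤ M) :
    source Λ Pp Pm a g h t ≤ Pp t G + a M • ev Λ G := by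
  have m1 := hm.smooth_mem hX hg ht 1
  refine add_le_add (hm.mono_p t m1 (hG 1) hgG) ?_
  refine (sub_le_self _ (hm.nonneg_m t _ m1)).trans ?_
  have h1 := hm.rate_le (a := a) hh ht hM
  have h2 := hm.rate_nonneg (g := g) hh ht
  exact (smul_le_smul_of_nonneg_right h1 (hm.ev_nonneg m1)).trans
    (smul_le_smul_of_nonneg_left (hm.ev_mono hX m1 (hG 1) hgG) (h2.trans h1))

omit hX in
theorem majorant_mem {G : X} (hG : G ∈ coneTop R) {M : ℝ} (hM : 0 ≤ M) (t : ℝ) :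
    Pp t G + a M • ev Λ G ∈ coneTop R := fun k =>
  hm.conePow_add (hm.maps_top t hG k) (hm.conePow_smul (hm.coneTop_ev hG k) (hm.a_nonneg M hM))

omit hX in
theorem locIntegrable_majorant {G : X} (hG : G ∈ coneTop R) {M : ℝ} (k : ℕ) :
    LocIntegrable fun t => evPow Λ k (Pp t G + a M • ev Λ G) := by
  have h1 : ∀ t, Pp t G + a M • ev Λ G =
      (R ^ (k + 1)) (evPow Λ (k + 1) (Pp t G) + a M • evPow Λ (k + 1) (ev Λ G)) := by
    intro t
    rw [map_add, map_smul, hm.pow_evPow (hm.maps_top t hG (k + 1)),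
      hm.pow_evPow (hm.coneTop_ev hG (k + 1))]
  -- integrability at level `k + 1` is carried by `R` to level `k`, which covers `k = 0` as well
  refine (((hm.integrable (k + 1) (by omega) G hG).add
    (locIntegrable_const (a M • evPow Λ (k + 1) (ev Λ G)))).clm_comp R).congr fun t _ => ?_
  rw [h1, pow_succ_apply, hm.evPow_pow]

theorem source_mem_top {g h : ℝ → X} (hg : SmoothCurve R g) (hh : RegularCurve R Λ h) {M : ℝ}
    (hM : ∀ t, 0 ≤ t → ‖ev Λ (g t)‖ + ∫ s in (0 : ℝ)..t, Delta Pp Pm Λ s (h s) ≤ M) {t : ℝ}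
    (ht : 0 ≤ t) : source Λ Pp Pm a g h t ∈ coneTop R := by
  have hM0 : 0 ≤ M := (add_nonneg (norm_nonneg _) (hm.integral_delta_nonneg hh ht)).trans (hM t ht)
  have hG := hm.smooth_mem hX hg ht
  exact fun k => hm.sys.conePow_of_le hX (hm.source_nonneg hX (hg.regular hm hX) hh ht)
    (hm.source_le hX hg hh ht hG le_rfl (hM t ht)) (hm.majorant_mem hG hM0 t k)

theorem aestronglyMeasurable_source {g h : ℝ → X} (hg : RegularCurve R Λ g)
    (hh : RegularCurve R Λ h) : AEStronglyMeasurable (source Λ Pp Pm a g h) lebPos :=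
  (hm.meas_p g hg.meas fun _ ht => hm.mem_one hg ht).add
    (((hm.aestronglyMeasurable_rate hX hg hh).smul
      (hm.aestronglyMeasurable_evPow hX 1 hg.meas fun _ ht => hm.mem_one hg ht)).sub
      (hm.meas_m g hg.meas fun _ ht => hm.mem_one hg ht))

theorem locIntegrable_evPow_source {g h : ℝ → X} (hg : SmoothCurve R g) (hh : RegularCurve R Λ h)
    {M : ℝ} (hM : ∀ t, 0 ≤ t → ‖ev Λ (g t)‖ + ∫ s in (0 : ℝ)..t, Delta Pp Pm Λ s (h s) ≤ M)
    (k : ℕ) : LocIntegrable fun t => evPow Λ k (source Λ Pp Pm a g h t) := by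
  intro T hT
  obtain ⟨G, hG, hle⟩ := hg.le T hT
  have hM0 : 0 ≤ M := (add_nonneg (norm_nonneg _) (hm.integral_delta_nonneg hh hT)).trans (hM T hT)
  have hmem : ∀ t, 0 ≤ t → source Λ Pp Pm a g h t ∈ conePow R k := fun t ht =>
    hm.source_mem_top hX hg hh hM ht k
  refine intervalIntegrable_of_norm_le hT
    (hm.aestronglyMeasurable_evPow hX k (hm.aestronglyMeasurable_source hX (hg.regular hm hX) hh)
      hmem) (hm.locIntegrable_majorant (M := M) hG k T hT).norm fun t ht => ?_
  exact hX.norm_le (hm.evPow_nonneg (hmem t ht.1)) (hm.evPow_mono hX (hmem t ht.1)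
    (hm.majorant_mem hG hM0 t k) (hm.source_le hX hg hh ht.1 hG (hle t ht) (hM t ht.1)))

end ReducedModel

end

section

variable {X : Type*} [NormedAddCommGroup X] [NormedSpace ℝ X] [PartialOrder X]
  [IsOrderedAddMonoid X] [IsOrderedModule ℝ X]

/-! ### The monotone iteration -/

theorem mildSol_congr {S : ℝ → X →L[ℝ] X} {c : ℝ} {x : X} {y y' : ℝ → X}
    (h : ∀ t, 0 ≤ t → y t = y' t) {t : ℝ} (ht : 0 ≤ t) :
    mildSol S c x y t = mildSol S c x y' t := by
  simp only [mildSol]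
  congr 1
  refine intervalIntegral.integral_congr fun s hs => ?_
  rw [uIcc_of_le ht] at hs
  simp only [h s hs.1]

/-- A differential inequality for `φ ∘ R` along a mild solution, in integrated form. -/
theorem ResolventSystem.functional_mildSol_le [CompleteSpace X] {S : ℝ → X →L[ℝ] X}
    {R : X →L[ℝ] X} {lam0 : ℝ} (hR : ResolventSystem S R lam0) (hX : SpaceAssumptions X)
    (φ : X →L[ℝ] ℝ) {c : ℝ} (hc : 0 ≤ c) {x : X} {y : ℝ → X} (hy : LocIntegrable y) {e : ℝ → ℝ}
    (he : LocIntegrable e)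
    (h : ∀ s, 0 ≤ s → φ (R (y s)) ≤ c * φ (mildSol S c x y s) + e s) {t : ℝ} (ht : 0 ≤ t) :
    φ (R (mildSol S c x y t)) ≤ φ (R x) + ∫ s in (0 : ℝ)..t, e s := by
  have hz := hR.locIntegrable_mildSol hX hc x hy
  have h1 := congrArg φ (hR.mildSol_identity hX hc x hy ht)
  rw [map_add, map_add, map_add, map_smul, ← ContinuousLinearMap.intervalIntegral_comp_comm φ
    (hz t ht), ← ContinuousLinearMap.intervalIntegral_comp_comm R (hy t ht),
    ← ContinuousLinearMap.intervalIntegral_comp_comm φ ((hy t ht).clm_comp R), smul_eq_mul,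
    ← intervalIntegral.integral_const_mul] at h1
  have h2 : ∫ s in (0 : ℝ)..t, φ (R (y s)) ≤
      ∫ s in (0 : ℝ)..t, (c * φ (mildSol S c x y s) + e s) :=
    intervalIntegral.integral_mono_on ht (((hy t ht).clm_comp R).clm_comp φ)
      ((((hz t ht).clm_comp φ).const_mul c).add (he t ht)) fun s hs => h s hs.1
  rw [intervalIntegral.integral_add (((hz t ht).clm_comp φ).const_mul c) (he t ht)] at h2
  linarith

theorem integral_exp_mul (N r t : ℝ) :
    ∫ s in (0 : ℝ)..t, r * (N * Real.exp (r * s)) = N * Real.exp (r * t) - N := by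
  have h1 : ∀ s ∈ uIcc 0 t, HasDerivAt (fun s => N * Real.exp (r * s))
      (r * (N * Real.exp (r * s))) s := by
    intro s _
    have := (((hasDerivAt_id s).const_mul r).exp).const_mul N
    exact this.congr_deriv (by simp only [id]; ring)
  rw [intervalIntegral.integral_eq_sub_of_hasDerivAt h1
    (Continuous.intervalIntegrable (by fun_prop) _ _)]
  simp

/-- One step of the iteration: `u' + c Λ u = source g h`, `u(0) = f`, in mild form. -/
def step (S : ℝ → X →L[ℝ] X) (Λ : X →ₗ.[ℝ] X) (Pp Pm : ℝ → X → X) (a : ℝ → ℝ) (c : ℝ) (f : X)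
    (g h : ℝ → X) : ℝ → X := mildSol S c f (source Λ Pp Pm a g h)

/-- The a priori bounds that the iteration preserves, for two consecutive iterates `h ≤ g`. -/
structure Admissible (R : X →L[ℝ] X) (Λ : X →ₗ.[ℝ] X) (Pp Pm : ℝ → X → X) (ρ : ℝ → ℝ)
    (κ : X →L[ℝ] ℝ) (M K N : ℝ) (g h : ℝ → X) : Prop where
  smooth_left : SmoothCurve R g
  smooth_right : SmoothCurve R h
  le : ∀ t, 0 ≤ t → h t ≤ g t
  energy : ∀ t, 0 ≤ t → ‖ev Λ (g t)‖ + ∫ s in (0 : ℝ)..t, Delta Pp Pm Λ s (h s) ≤ M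
  kappa : ∀ t, 0 ≤ t → κ (ev Λ (g t)) ≤ K
  second : ∀ t, 0 ≤ t → ‖evPow Λ 2 (g t)‖ ≤ N * Real.exp (ρ K * t)

namespace ReducedModel

variable [CompleteSpace X] {S : ℝ → X →L[ℝ] X} {R : X →L[ℝ] X} {lam0 : ℝ} {Λ : X →ₗ.[ℝ] X}
  {Pp Pm : ℝ → X → X} {a ρ : ℝ → ℝ} {κ : X →L[ℝ] ℝ}
  (hm : ReducedModel S R lam0 Λ Pp Pm a ρ κ) (hX : SpaceAssumptions X)
include hm hX

section Step

variable {g h : ℝ → X} (hg : SmoothCurve R g) (hh : RegularCurve R Λ h) {M : ℝ} (hM0 : 0 ≤ M)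
  (hM : ∀ t, 0 ≤ t → ‖ev Λ (g t)‖ + ∫ s in (0 : ℝ)..t, Delta Pp Pm Λ s (h s) ≤ M)
include hg hh hM0 hM

theorem step_eq_pow {f : X} (hf : f ∈ coneTop R) (k : ℕ) {t : ℝ} (ht : 0 ≤ t) :
    step S Λ Pp Pm a (a M) f g h t = (R ^ k) (mildSol S (a M) (evPow Λ k f)
      (fun s => evPow Λ k (source Λ Pp Pm a g h s)) t) := by
  rw [← hm.sys.mildSol_pow k hX _ (hm.locIntegrable_evPow_source hX hg hh hM k) ht,
    hm.pow_evPow (hf k)]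
  exact mildSol_congr (fun s hs => (hm.pow_evPow (hm.source_mem_top hX hg hh hM hs k)).symm) ht

theorem evPow_step {f : X} (hf : f ∈ coneTop R) (k : ℕ) {t : ℝ} (ht : 0 ≤ t) :
    evPow Λ k (step S Λ Pp Pm a (a M) f g h t) = mildSol S (a M) (evPow Λ k f)
      (fun s => evPow Λ k (source Λ Pp Pm a g h s)) t := by
  rw [hm.step_eq_pow hX hg hh hM0 hM hf k ht, hm.evPow_pow]

theorem step_nonneg {f : X} (hf : 0 ≤ f) {t : ℝ} (ht : 0 ≤ t) :
    0 ≤ step S Λ Pp Pm a (a M) f g h t :=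
  hm.sys.mildSol_nonneg hX hf (fun _ hs => hm.source_nonneg hX (hg.regular hm hX) hh hs) ht

theorem smoothCurve_step {f : X} (hf : f ∈ coneTop R) :
    SmoothCurve R (step S Λ Pp Pm a (a M) f g h) where
  meas := (hm.sys.locIntegrable_mildSol hX (hm.a_nonneg M hM0) f
    (hm.locIntegrable_evPow_source hX hg hh hM 0)).aestronglyMeasurable
  nonneg t ht := hm.step_nonneg hX hg hh hM0 hM (hm.sys.conePow_nonneg (hf 0)) ht
  le T hT := by
    have := hX.orderClosedTopology
    obtain ⟨G, hG, hle⟩ := hg.le T hT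
    refine ⟨f + ∫ t in (0 : ℝ)..T, (Pp t G + a M • ev Λ G), fun k => ?_, fun t ht => ?_⟩
    · refine hm.conePow_add (hf k) ⟨∫ t in (0 : ℝ)..T, evPow Λ k (Pp t G + a M • ev Λ G),
        integral_nonneg_cone hT fun t _ => hm.evPow_nonneg (hm.majorant_mem hG hM0 t k), ?_⟩
      rw [← ContinuousLinearMap.intervalIntegral_comp_comm _ (hm.locIntegrable_majorant hG k T hT)]
      exact intervalIntegral.integral_congr fun t _ => hm.pow_evPow (hm.majorant_mem hG hM0 t k)
    · exact hm.sys.mildSol_le hX (hm.locIntegrable_evPow_source hX hg hh hM 0)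
        (hm.locIntegrable_majorant hG 0 T hT) (hm.sys.conePow_nonneg (hf 0))
        (fun s hs => hm.source_nonneg hX (hg.regular hm hX) hh hs.1)
        (fun s hs => hm.source_le hX hg hh hs.1 hG (hle s hs) (hM s hs.1)) ht

/-- The energy inequality at level `k` for a positive functional. -/
theorem functional_step_le {f : X} (hf : f ∈ coneTop R) (k : ℕ) (φ : X →L[ℝ] ℝ) {e : ℝ → ℝ}
    (he : LocIntegrable e)
    (hφ : ∀ s, 0 ≤ s → φ (evPow Λ k (source Λ Pp Pm a g h s)) ≤
      a M * φ (evPow Λ (k + 1) (step S Λ Pp Pm a (a M) f g h s)) + e s) {t : ℝ} (ht : 0 ≤ t) :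
    φ (evPow Λ k (step S Λ Pp Pm a (a M) f g h t)) ≤ φ (evPow Λ k f) + ∫ s in (0 : ℝ)..t, e s := by
  have h1 := hm.sys.functional_mildSol_le hX φ (hm.a_nonneg M hM0) (x := evPow Λ (k + 1) f)
    (hm.locIntegrable_evPow_source hX hg hh hM (k + 1)) he (fun s hs => by
      rw [hm.R_evPow_succ (hm.source_mem_top hX hg hh hM hs (k + 1)),
        ← hm.evPow_step hX hg hh hM0 hM hf (k + 1) hs]
      exact hφ s hs) ht
  rwa [← hm.evPow_step hX hg hh hM0 hM hf (k + 1) ht, hm.R_evPow_succ (hf (k + 1)),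
    hm.R_evPow_succ (hm.smooth_mem hX (hm.smoothCurve_step hX hg hh hM0 hM hf) ht (k + 1))] at h1

/-- `φ(Λᵏ source)` is at most `φ(Λᵏ P⁺) - φ(Λᵏ P⁻) + c φ(Λᵏ⁺¹ u)` for any smooth `u ≥ g`. -/
theorem functional_source_le (k : ℕ) {φ : X →L[ℝ] ℝ} (hφ : ∀ x, 0 ≤ x → 0 ≤ φ x) {s : ℝ}
    (hs : 0 ≤ s) {u : X} (hu : u ∈ coneTop R) (hgu : g s ≤ u) :
    φ (evPow Λ k (source Λ Pp Pm a g h s)) ≤ a M * φ (evPow Λ (k + 1) u) +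
      (φ (evPow Λ k (Pp s (g s))) - φ (evPow Λ k (Pm s (g s)))) := by
  have m1 := hm.smooth_mem hX hg hs
  rw [hm.evPow_source hX (m1 (k + 1)) (hm.maps_top s m1 k), map_add, map_sub, map_smul, smul_eq_mul]
  have h1 : φ (evPow Λ (k + 1) (g s)) ≤ φ (evPow Λ (k + 1) u) := by
    have := hφ _ (sub_nonneg.2 (hm.evPow_mono hX (m1 (k + 1)) (hu (k + 1)) hgu))
    rwa [map_sub, sub_nonneg] at this
  have h2 := hm.rate_le (a := a) hh hs (hM s hs)
  have h3 := hm.rate_nonneg (g := g) hh hs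
  have h4 := mul_le_mul h2 h1 (hφ _ (hm.evPow_nonneg (m1 (k + 1)))) (h3.trans h2)
  linarith

end Step

/-- The a priori bounds pass from two consecutive iterates to the next. -/
theorem admissible_step {M K N : ℝ} (hM : 0 ≤ M) (hK : 0 ≤ K) {g h : ℝ → X}
    (hA : Admissible R Λ Pp Pm ρ κ M K N g h) {f : X} (hf : f ∈ coneTop R) (hfM : ‖ev Λ f‖ ≤ M)
    (hfK : κ (ev Λ f) ≤ K) (hfN : ‖evPow Λ 2 f‖ ≤ N)
    (hgu : ∀ t, 0 ≤ t → g t ≤ step S Λ Pp Pm a (a M) f g h t) :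
    Admissible R Λ Pp Pm ρ κ M K N (step S Λ Pp Pm a (a M) f g h) g := by
  have hg := hA.smooth_left
  have hh := hA.smooth_right.regular hm hX
  have hgr := hg.regular hm hX
  have hu := hm.smoothCurve_step hX hg hh hM hA.energy hf
  obtain ⟨ℓ, hℓ⟩ := hX.exists_mass
  have hℓ0 : ∀ x, 0 ≤ x → 0 ≤ ℓ x := fun x hx => by rw [hℓ x hx]; exact norm_nonneg x
  have hsrc := fun (k : ℕ) {φ : X →L[ℝ] ℝ} (hφ : ∀ x, 0 ≤ x → 0 ≤ φ x) (s : ℝ) (hs : 0 ≤ s) =>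
    hm.functional_source_le hX hg hh hM hA.energy k hφ hs (hm.smooth_mem hX hu hs) (hgu s hs)
  refine ⟨hu, hg, hgu, fun t ht => ?_, fun t ht => ?_, fun t ht => ?_⟩
  · have h1 := hm.functional_step_le hX hg hh hM hA.energy hf 1 ℓ
      (e := fun s => -Delta Pp Pm Λ s (g s)) (fun T hT => (hm.locIntegrable_delta hX hgr T hT).neg)
      (fun s hs => by
        refine (hsrc 1 hℓ0 s hs).trans_eq ?_
        have m1 := hm.smooth_mem hX hg hs
        rw [hℓ (evPow Λ 1 (Pp s (g s))) (hm.evPow_nonneg (hm.maps_top s m1 1)),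
          hℓ (evPow Λ 1 (Pm s (g s))) (hm.evPow_nonneg (hm.loss_mem hX (m1 2)))]
        simp only [Delta, neg_sub]
        rfl) ht
    rw [hℓ _ (hm.evPow_nonneg (hm.smooth_mem hX hu ht 1)), hℓ _ (hm.evPow_nonneg (hf 1)),
      intervalIntegral.integral_neg] at h1
    change ‖ev Λ (step S Λ Pp Pm a (a M) f g h t)‖ ≤ ‖ev Λ f‖ + _ at h1
    linarith
  · have h1 := hm.functional_step_le hX hg hh hM hA.energy hf 1 κ (e := fun s => 0)
      (locIntegrable_const 0) (fun s hs => by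
        refine (hsrc 1 hm.kappa_nonneg s hs).trans ?_
        have := hm.kappa_le s _ (hm.smooth_mem hX hg hs 2)
        change κ (evPow Λ 1 _) ≤ κ (evPow Λ 1 _) at this
        linarith) ht
    rw [intervalIntegral.integral_zero, add_zero] at h1
    exact h1.trans hfK
  · have hρ := hm.rho_nonneg K hK
    have h1 := hm.functional_step_le hX hg hh hM hA.energy hf 2 ℓ
      (e := fun s => ρ K * (N * Real.exp (ρ K * s)))
      (fun T _ => Continuous.intervalIntegrable (by fun_prop) _ _)
      (fun s hs => by
        refine (hsrc 2 hℓ0 s hs).trans ?_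
        have m1 := hm.smooth_mem hX hg hs
        rw [hℓ (evPow Λ 2 (Pp s (g s))) (hm.evPow_nonneg (hm.maps_top s m1 2)),
          hℓ (evPow Λ 2 (Pm s (g s))) (hm.evPow_nonneg (hm.loss_mem hX (m1 3)))]
        have h2 := hm.povzner s _ (m1 3)
        have h3 : ρ (κ (ev Λ (g s))) ≤ ρ K := hm.rho_mono
          (mem_Ici.2 (hm.kappa_nonneg _ (hm.ev_nonneg (m1 1)))) hK (hA.kappa s hs)
        have h4 := mul_le_mul h3 (hA.second s hs) (norm_nonneg _) hρ
        linarith) ht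
    rw [hℓ _ (hm.evPow_nonneg (hm.smooth_mem hX hu ht 2)), hℓ _ (hm.evPow_nonneg (hf 2)),
      integral_exp_mul] at h1
    linarith

/-- One step of the iteration is isotone in the initial datum and in both curves. -/
theorem step_mono {M K N : ℝ} {g h g' h' : ℝ → X}
    (hA : Admissible R Λ Pp Pm ρ κ M K N g h) (hA' : Admissible R Λ Pp Pm ρ κ M K N g' h')
    (hgg : ∀ t, 0 ≤ t → g t ≤ g' t) (hhh : ∀ t, 0 ≤ t → h t ≤ h' t) {f f' : X} (hff : f ≤ f')
    {t : ℝ} (ht : 0 ≤ t) :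
    step S Λ Pp Pm a (a M) f g h t ≤ step S Λ Pp Pm a (a M) f' g' h' t :=
  hm.sys.mildSol_mono hX
    (hm.locIntegrable_evPow_source hX hA.smooth_left (hA.smooth_right.regular hm hX) hA.energy 0)
    (hm.locIntegrable_evPow_source hX hA'.smooth_left (hA'.smooth_right.regular hm hX) hA'.energy 0)
    hff (fun _ hs => hm.source_mono hX (hA.smooth_left.regular hm hX)
      (hA.smooth_right.regular hm hX) (hA'.smooth_left.regular hm hX)
      (hA'.smooth_right.regular hm hX) hgg hhh hs) ht

end ReducedModel

/-- The pairs `(gₙ, gₙ₋₁)` of consecutive iterates, for initial data `f n`, starting at zero. -/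
def iter (S : ℝ → X →L[ℝ] X) (Λ : X →ₗ.[ℝ] X) (Pp Pm : ℝ → X → X) (a : ℝ → ℝ) (c : ℝ) (f : ℕ → X) :
    ℕ → (ℝ → X) × (ℝ → X)
  | 0 => (fun _ => 0, fun _ => 0)
  | n + 1 => (step S Λ Pp Pm a c (f n) (iter S Λ Pp Pm a c f n).1 (iter S Λ Pp Pm a c f n).2,
      (iter S Λ Pp Pm a c f n).1)

namespace ReducedModel

variable [CompleteSpace X] {S : ℝ → X →L[ℝ] X} {R : X →L[ℝ] X} {lam0 : ℝ} {Λ : X →ₗ.[ℝ] X}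
  {Pp Pm : ℝ → X → X} {a ρ : ℝ → ℝ} {κ : X →L[ℝ] ℝ}
  (hm : ReducedModel S R lam0 Λ Pp Pm a ρ κ) (hX : SpaceAssumptions X)
include hm hX

theorem smoothCurve_zero : SmoothCurve R (fun _ => (0 : X)) where
  meas := aestronglyMeasurable_const
  nonneg _ _ := le_rfl
  le _ _ := ⟨0, fun k => hm.zero_mem k, fun _ _ => le_rfl⟩

theorem iter_admissible {M K N : ℝ} (hM : 0 ≤ M) (hK : 0 ≤ K) (hN : 0 ≤ N) {f : ℕ → X}
    (hf : ∀ n, f n ∈ coneTop R) (hmono : Monotone f) (hfM : ∀ n, ‖ev Λ (f n)‖ ≤ M)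
    (hfK : ∀ n, κ (ev Λ (f n)) ≤ K) (hfN : ∀ n, ‖evPow Λ 2 (f n)‖ ≤ N) (n : ℕ) :
    Admissible R Λ Pp Pm ρ κ M K N (iter S Λ Pp Pm a (a M) f n).1 (iter S Λ Pp Pm a (a M) f n).2 ∧
      ∀ t, 0 ≤ t → (iter S Λ Pp Pm a (a M) f n).1 t ≤ (iter S Λ Pp Pm a (a M) f (n + 1)).1 t := by
  induction n with
  | zero =>
    have h0 := hm.smoothCurve_zero hX
    have hA : Admissible R Λ Pp Pm ρ κ M K N (fun _ => (0 : X)) (fun _ => (0 : X)) := by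
      refine ⟨h0, h0, fun _ _ => le_rfl, fun t _ => ?_, fun t _ => ?_, fun t _ => ?_⟩
      · simp only [hm.ev_zero, hm.delta_zero hX, norm_zero, intervalIntegral.integral_zero,
          add_zero, hM]
      · rw [hm.ev_zero, map_zero]; exact hK
      · have : evPow Λ 2 0 = (0 : X) := by simpa using hm.evPow_pow 2 0
        rw [this, norm_zero]; positivity
    exact ⟨hA, fun t ht => hm.step_nonneg hX h0 (h0.regular hm hX) hM hA.energy
      (hm.sys.conePow_nonneg (hf 0 0)) ht⟩
  | succ n ih =>
    obtain ⟨hA, hle⟩ := ih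
    have hA' := hm.admissible_step hX hM hK hA (hf n) (hfM n) (hfK n) (hfN n) hle
    exact ⟨hA', fun t ht => hm.step_mono hX hA hA' hle hA.le (hmono (Nat.le_succ n)) ht⟩

end ReducedModel

end

section

/-! ### Conservation, comparison and the limit of the iteration -/

/-- A nonnegative primitive whose density is controlled by the primitive itself vanishes. -/
theorem eq_zero_of_integral_le {φ ψ : ℝ → ℝ} {T K : ℝ} (hT : 0 ≤ T)
    (hψ : IntervalIntegrable ψ volume 0 T) (hφ0 : ∀ t ∈ Icc 0 T, 0 ≤ φ t)
    (hφ : ∀ t ∈ Icc 0 T, φ t = ∫ s in (0 : ℝ)..t, ψ s) (hle : ∀ t ∈ Icc 0 T, ψ t ≤ K * φ t)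
    {t : ℝ} (ht : t ∈ Icc 0 T) : φ t = 0 := by
  have hcont : ContinuousOn φ (Icc 0 T) := by
    have h1 := intervalIntegral.continuousOn_primitive_interval
      ((intervalIntegrable_iff' (f := ψ) (μ := volume)).1 hψ)
    rw [uIcc_of_le hT] at h1
    exact h1.congr hφ
  have hint : ∀ t ∈ Icc 0 T, IntervalIntegrable φ volume 0 t := fun t ht =>
    (hcont.mono (by rw [uIcc_of_le ht.1]; exact Icc_subset_Icc_right ht.2)).intervalIntegrable
  have hψt : ∀ t ∈ Icc 0 T, IntervalIntegrable ψ volume 0 t := fun t ht =>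
    hψ.mono_set (by rw [uIcc_of_le ht.1, uIcc_of_le hT]; exact Icc_subset_Icc_right ht.2)
  have hφΦ : ∀ t ∈ Icc 0 T, φ t ≤ K * ∫ s in (0 : ℝ)..t, φ s := by
    intro t ht
    rw [hφ t ht, ← intervalIntegral.integral_const_mul]
    exact intervalIntegral.integral_mono_on ht.1 (hψt t ht) ((hint t ht).const_mul K)
      fun s hs => hle s ⟨hs.1, hs.2.trans ht.2⟩
  have hΦc : ContinuousOn (fun t => ∫ s in (0 : ℝ)..t, φ s) (Icc 0 T) := by
    have h1 := intervalIntegral.continuousOn_primitive_interval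
      ((intervalIntegrable_iff' (f := φ) (μ := volume)).1 (hint T ⟨hT, le_rfl⟩))
    rwa [uIcc_of_le hT] at h1
  have hΦ := norm_le_gronwallBound_of_norm_deriv_right_le (f := fun t => ∫ s in (0 : ℝ)..t, φ s)
    (f' := φ) (δ := 0) (K := K) (ε := 0) (a := 0) (b := T) hΦc (fun t ht => by
      have ht' : t ∈ Icc 0 T := ⟨ht.1, ht.2.le⟩
      have hnhds : Icc 0 T ∈ 𝓝[≥] t := mem_nhdsWithin.2 ⟨Iio T, isOpen_Iio, ht.2,
          fun s hs => ⟨ht.1.trans hs.2, le_of_lt hs.1⟩⟩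
      have hnhds' : Icc 0 T ∈ 𝓝[>] t := nhdsWithin_mono t Ioi_subset_Ici_self hnhds
      refine intervalIntegral.integral_hasDerivWithinAt_right (hint t ht') (t := Ioi t)
        ?_ ((hcont t ht').mono_of_mem_nhdsWithin hnhds')
      exact ⟨Icc 0 T, hnhds', hcont.aestronglyMeasurable measurableSet_Icc⟩)
    (by simp) (fun t ht => by
      have ht' : t ∈ Icc 0 T := ⟨ht.1, ht.2.le⟩
      rw [add_zero, Real.norm_of_nonneg (hφ0 t ht'), Real.norm_of_nonneg
        (intervalIntegral.integral_nonneg ht.1 fun s hs => hφ0 s ⟨hs.1, hs.2.trans ht.2.le⟩)]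
      exact hφΦ t ht') t ht
  rw [gronwallBound_ε0_δ0, norm_le_zero_iff] at hΦ
  refine le_antisymm ?_ (hφ0 t ht)
  have := hφΦ t ht
  rwa [hΦ, mul_zero] at this

variable {X : Type*} [NormedAddCommGroup X] [NormedSpace ℝ X] [PartialOrder X]
  [IsOrderedAddMonoid X] [IsOrderedModule ℝ X]

/-- The equation `df/dt = P⁺(t, f) - P⁻(t, f)`, integrated after an application of `Λ`. -/
def SolvesReduced (Λ : X →ₗ.[ℝ] X) (Pp Pm : ℝ → X → X) (f₀ : X) (f : ℝ → X) : Prop :=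
  ∀ t, 0 ≤ t → ev Λ (f t) = ev Λ f₀ +
    ∫ s in (0 : ℝ)..t, (ev Λ (Pp s (f s)) - ev Λ (Pm s (f s)))

namespace ReducedModel

variable [CompleteSpace X] {S : ℝ → X →L[ℝ] X} {R : X →L[ℝ] X} {lam0 : ℝ} {Λ : X →ₗ.[ℝ] X}
  {Pp Pm : ℝ → X → X} {a ρ : ℝ → ℝ} {κ : X →L[ℝ] ℝ}
  (hm : ReducedModel S R lam0 Λ Pp Pm a ρ κ)
include hm

/-- Convexity bounds the increment of `a` below `M` by the slope of `a` just above `M`. -/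
theorem a_sub_le {M w : ℝ} (hw : 0 ≤ w) (hwM : w ≤ M) :
    a M - a w ≤ (a (M + 1) - a M) * (M - w) := by
  rcases eq_or_lt_of_le hwM with rfl | h
  · simp
  have h1 := hm.a_convex.slope_mono_adjacent (x := w) (y := M) (z := M + 1) hw
    (mem_Ici.2 (by linarith)) h (by linarith)
  rw [div_le_iff₀ (by linarith), add_sub_cancel_left, div_one] at h1
  exact h1

/-- A convex function on `[0, ∞)` may jump at `0`, which does not matter for sequences that approach
their limit from below. -/
theorem tendsto_a {w : ℕ → ℝ} {l : ℝ} (hw0 : ∀ n, 0 ≤ w n) (hwl : ∀ n, w n ≤ l)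
    (hw : Tendsto w atTop (𝓝 l)) : Tendsto (fun n => a (w n)) atTop (𝓝 (a l)) := by
  rcases eq_or_lt_of_le ((hw0 0).trans (hwl 0)) with h | h
  · have : ∀ n, w n = l := fun n => le_antisymm (hwl n) (h ▸ hw0 n)
    simp [this]
  · have h1 : ContinuousOn a (Ioi 0) :=
      (hm.a_convex.subset Ioi_subset_Ici_self (convex_Ioi 0)).continuousOn isOpen_Ioi
    exact ((h1.continuousAt (Ioi_mem_nhds h)).tendsto).comp hw

variable (hX : SpaceAssumptions X)
include hX

theorem locIntegrable_evPow_two {g : ℝ → X} (hg : RegularCurve R Λ g) :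
    LocIntegrable fun t => evPow Λ 2 (g t) := by
  intro T hT
  obtain ⟨K, -, h⟩ := hg.bdd T hT
  exact intervalIntegrable_of_norm_le hT (hm.aestronglyMeasurable_evPow hX 2 hg.meas hg.mem)
    (intervalIntegrable_const (c := K)) h

omit hX in
theorem R_evPow_two {g : ℝ → X} (hg : RegularCurve R Λ g) {t : ℝ} (ht : 0 ≤ t) :
    R (evPow Λ 2 (g t)) = ev Λ (g t) := hm.R_evPow_succ (k := 1) (hg.mem t ht)

theorem locIntegrable_ev {g : ℝ → X} (hg : RegularCurve R Λ g) :
    LocIntegrable fun t => ev Λ (g t) :=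
  ((hm.locIntegrable_evPow_two hX hg).clm_comp R).congr fun _ ht => hm.R_evPow_two hg ht

/-- Conservation: the mass functional turns the equation into the energy identity. -/
theorem energy_eq {f₀ : X} (hf₀ : f₀ ∈ conePow R 2) {f : ℝ → X} (hf : RegularCurve R Λ f)
    (hs : SolvesReduced Λ Pp Pm f₀ f) {t : ℝ} (ht : 0 ≤ t) :
    ‖ev Λ (f t)‖ + ∫ s in (0 : ℝ)..t, Delta Pp Pm Λ s (f s) = ‖ev Λ f₀‖ := by
  obtain ⟨ℓ, hℓ⟩ := hX.exists_mass
  have hp := hm.locIntegrable_ev_gain hX hf t ht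
  have hl := hm.locIntegrable_ev_loss hX hf t ht
  have h1 := congrArg ℓ (hs t ht)
  rw [map_add, ← ContinuousLinearMap.intervalIntegral_comp_comm _ (hp.sub hl),
    hℓ _ (hm.ev_nonneg (hm.mem_one hf ht)),
    hℓ _ (hm.ev_nonneg (hm.sys.conePow_antitone (by omega) hf₀))] at h1
  have h2 : ∫ s in (0 : ℝ)..t, ℓ (ev Λ (Pp s (f s)) - ev Λ (Pm s (f s))) =
      -∫ s in (0 : ℝ)..t, Delta Pp Pm Λ s (f s) := by
    rw [← intervalIntegral.integral_neg]
    refine intervalIntegral.integral_congr fun s hs => ?_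
    rw [uIcc_of_le ht] at hs
    have m := hf.mem s hs.1
    simp only [Delta, map_sub]
    rw [hℓ _ (hm.ev_nonneg (hm.maps_two s m)), hℓ _ (hm.ev_nonneg (hm.loss_mem hX (k := 1) m))]
    ring
  rw [h2] at h1
  linarith

/-- By conservation a regular solution satisfies the equation that the iteration solves. -/
theorem ev_eq_mildSol {f₀ : X} (hf₀ : f₀ ∈ conePow R 2) {F : ℝ → X} (hF : RegularCurve R Λ F)
    (hs : SolvesReduced Λ Pp Pm f₀ F) {t : ℝ} (ht : 0 ≤ t) :
    ev Λ (F t) = mildSol S (a ‖ev Λ f₀‖) (ev Λ f₀)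
      (fun s => ev Λ (source Λ Pp Pm a F F s)) t := by
  have hM : ∀ t, 0 ≤ t → ‖ev Λ (F t)‖ + ∫ s in (0 : ℝ)..t, Delta Pp Pm Λ s (F s) ≤ ‖ev Λ f₀‖ :=
    fun t ht => (hm.energy_eq hX hf₀ hF hs ht).le
  refine hm.sys.eq_mildSol_of_identity hX (hm.a_nonneg _ (norm_nonneg _))
    (hm.locIntegrable_ev_source hX hF hF hM) (hm.locIntegrable_ev hX hF) (fun t ht => ?_) ht
  have h2 := hm.locIntegrable_evPow_two hX hF t ht
  have h2' := (hm.locIntegrable_evPow_two hX hF).const_smul (a ‖ev Λ f₀‖) t ht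
  have h3 : ∫ s in (0 : ℝ)..t, ev Λ (source Λ Pp Pm a F F s) =
      (∫ s in (0 : ℝ)..t, (ev Λ (Pp s (F s)) - ev Λ (Pm s (F s)))) +
        a ‖ev Λ f₀‖ • ∫ s in (0 : ℝ)..t, evPow Λ 2 (F s) := by
    rw [← intervalIntegral.integral_smul, ← intervalIntegral.integral_add
      ((hm.locIntegrable_ev_gain hX hF t ht).sub (hm.locIntegrable_ev_loss hX hF t ht))
      h2']
    refine intervalIntegral.integral_congr fun s hs' => ?_
    rw [uIcc_of_le ht] at hs'
    have h4 : rate Λ Pp Pm a F F s = a ‖ev Λ f₀‖ :=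
      congrArg a (hm.energy_eq hX hf₀ hF hs hs'.1)
    simp only [hm.ev_source hX hF hs'.1, h4]
    abel
  rw [h3, ← add_assoc, ← hs t ht, map_add, map_smul,
    ← ContinuousLinearMap.intervalIntegral_comp_comm R h2]
  congr 2
  refine intervalIntegral.integral_congr fun s hs' => ?_
  rw [uIcc_of_le ht] at hs'
  exact (hm.R_evPow_two hF hs'.1).symm

/-- Every regular solution dominates the iterates. -/
theorem iter_le {K N : ℝ} (hK : 0 ≤ K) (hN : 0 ≤ N) {f₀ : X} (hf₀ : f₀ ∈ conePow R 2) {f : ℕ → X}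
    (hf : ∀ n, f n ∈ coneTop R) (hmono : Monotone f) (hff : ∀ n, f n ≤ f₀)
    (hfK : ∀ n, κ (ev Λ (f n)) ≤ K) (hfN : ∀ n, ‖evPow Λ 2 (f n)‖ ≤ N)
    {F : ℝ → X} (hF : RegularCurve R Λ F) (hs : SolvesReduced Λ Pp Pm f₀ F) (n : ℕ) :
    ∀ t, 0 ≤ t → (iter S Λ Pp Pm a (a ‖ev Λ f₀‖) f n).1 t ≤ F t ∧
      (iter S Λ Pp Pm a (a ‖ev Λ f₀‖) f n).2 t ≤ F t := by
  have h1 : f₀ ∈ conePow R 1 := hm.sys.conePow_antitone (by omega) hf₀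
  have hLf : ∀ n, ev Λ (f n) ≤ ev Λ f₀ := fun n => hm.ev_mono hX (hf n 1) h1 (hff n)
  have hfM : ∀ n, ‖ev Λ (f n)‖ ≤ ‖ev Λ f₀‖ := fun n =>
    hX.norm_le (hm.ev_nonneg (hf n 1)) (hLf n)
  have hEF : ∀ t, 0 ≤ t → ‖ev Λ (F t)‖ + ∫ s in (0 : ℝ)..t, Delta Pp Pm Λ s (F s) ≤ ‖ev Λ f₀‖ :=
    fun t ht => (hm.energy_eq hX hf₀ hF hs ht).le
  induction n with
  | zero =>
    exact fun t ht => ⟨hm.sys.conePow_nonneg (hF.mem t ht), hm.sys.conePow_nonneg (hF.mem t ht)⟩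
  | succ n ih =>
    intro t ht
    refine ⟨?_, (ih t ht).1⟩
    obtain ⟨hA, -⟩ := hm.iter_admissible hX (norm_nonneg (ev Λ f₀)) hK hN hf hmono hfM hfK hfN n
    have hg := hA.smooth_left
    have hh := hA.smooth_right.regular hm hX
    have hgr := hg.regular hm hX
    have hu := hm.smoothCurve_step hX hg hh (norm_nonneg _) hA.energy (hf n)
    have hle : ev Λ ((iter S Λ Pp Pm a (a ‖ev Λ f₀‖) f (n + 1)).1 t) ≤ ev Λ (F t) := by
      rw [hm.ev_eq_mildSol hX hf₀ hF hs ht]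
      refine (hm.evPow_step hX hg hh (norm_nonneg _) hA.energy (hf n) 1 ht).trans_le ?_
      refine hm.sys.mildSol_mono hX (hm.locIntegrable_evPow_source hX hg hh hA.energy 1)
        (hm.locIntegrable_ev_source hX hF hF hEF) (hLf n) (fun s hs' => ?_) ht
      exact hm.ev_mono hX (hm.source_mem hX hgr hh hs') (hm.source_mem hX hF hF hs')
        (hm.source_mono hX hgr hh hF hF (fun r hr => (ih r hr).1) (fun r hr => (ih r hr).2) hs')
    have h2 := hm.sys.R_mono hle
    rw [hm.R_ev (hm.mem_one hF ht)] at h2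
    exact (hm.R_ev (hm.smooth_mem hX hu ht 1)).symm.trans_le h2

/-- Passage to the limit in the nonlinear terms, by order-closedness: `Λ P(t, gₙ)` increases and is
bounded, and `R` carries its limit to that of `P(t, gₙ)`. -/
theorem tendsto_ev_of_closed {P : X → X} (hP : MonotoneOn P (conePow R 1))
    (hmaps : ∀ g ∈ conePow R 2, P g ∈ conePow R 1)
    (hclosed : ∀ (u : ℕ → X) (g h : X), (∀ n, u n ∈ conePow R 1) → Monotone u →
      Tendsto u atTop (𝓝 g) → Tendsto (fun n => P (u n)) atTop (𝓝 h) → P g = h)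
    {u : ℕ → X} {g : X} (hu : ∀ n, u n ∈ conePow R 2) (hmono : Monotone u)
    (hug : Tendsto u atTop (𝓝 g)) {B : ℝ} (hB : ∀ n, ‖ev Λ (P (u n))‖ ≤ B) :
    Tendsto (fun n => ev Λ (P (u n))) atTop (𝓝 (ev Λ (P g))) := by
  have hu1 : ∀ n, u n ∈ conePow R 1 := fun n => hm.sys.conePow_antitone (by omega) (hu n)
  have hmem : ∀ n, P (u n) ∈ conePow R 1 := fun n => hmaps _ (hu n)
  obtain ⟨y, hy⟩ := hX.exists_tendsto_of_monotone (u := fun n => ev Λ (P (u n)))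
    (fun m n hmn => hm.ev_mono hX (hmem m) (hmem n) (hP (hu1 m) (hu1 n) (hmono hmn)))
    (fun n => hm.ev_nonneg (hmem n)) hB
  have h1 : Tendsto (fun n => P (u n)) atTop (𝓝 (R y)) :=
    ((R.continuous.tendsto y).comp hy).congr fun n => hm.R_ev (hmem n)
  rw [hclosed u g (R y) hu1 hmono hug h1, hm.ev_R]
  exact hy

/-- The solution of the reduced equation: it is regular, conserves the energy, and lies below every
other regular solution. -/
theorem exists_minimal_solution {x₀ : X} (hx₀ : 0 ≤ x₀) :
    ∃ f : ℝ → X, RegularCurve R Λ f ∧ SolvesReduced Λ Pp Pm ((R ^ 2) x₀) f ∧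
      (∀ t, 0 ≤ t → ‖evPow Λ 2 (f t)‖ ≤ ‖x₀‖ * Real.exp (ρ (κ (R x₀)) * t)) ∧
      ∀ F : ℝ → X, RegularCurve R Λ F → SolvesReduced Λ Pp Pm ((R ^ 2) x₀) F →
        ∀ t, 0 ≤ t → f t ≤ F t := by
  have := hX.orderClosedTopology
  obtain ⟨x, hxmono, hxtop, hxle, hxlim⟩ := hm.sys.exists_smooth_approx hX hx₀
  set f₀ : X := (R ^ 2) x₀ with hf₀_def
  have hf₀ : f₀ ∈ conePow R 2 := ⟨x₀, hx₀, rfl⟩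
  have hLf₀ : ev Λ f₀ = R x₀ := by rw [hf₀_def, pow_succ_apply', hm.ev_R, pow_one]
  have hx0 : ∀ n, 0 ≤ x n := fun n => hm.sys.conePow_nonneg (hxtop n 0)
  set f : ℕ → X := fun n => (R ^ 2) (x n) with hf_def
  have hf : ∀ n, f n ∈ coneTop R := by
    intro n k
    obtain ⟨y, hy, hyx⟩ := hxtop n k
    refine ⟨(R ^ 2) y, hm.sys.pow_pos 2 hy, ?_⟩
    simp only [hf_def, ← hyx]
    exact congrArg (fun A : X →L[ℝ] X => A y) ((Commute.refl R).pow_pow k 2).eq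
  have hfmono : Monotone f := fun m n hmn => hm.sys.pow_mono 2 (hxmono hmn)
  have hff : ∀ n, f n ≤ f₀ := fun n => hm.sys.pow_mono 2 (hxle n)
  have hLf : ∀ n, ev Λ (f n) = R (x n) := fun n => by
    simp only [hf_def]; rw [pow_succ_apply', hm.ev_R, pow_one]
  have hLLf : ∀ n, evPow Λ 2 (f n) = x n := fun n => hm.evPow_pow 2 _
  set M := ‖ev Λ f₀‖ with hM_def
  set K := κ (R x₀) with hK_def
  set N := ‖x₀‖ with hN_def
  have hM : 0 ≤ M := norm_nonneg _
  have hK : 0 ≤ K := hm.kappa_nonneg _ (hm.sys.R_pos _ hx₀)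
  have hN : 0 ≤ N := norm_nonneg _
  have hfM : ∀ n, ‖ev Λ (f n)‖ ≤ M := fun n => by
    rw [hLf, hM_def, hLf₀]
    exact hX.norm_le (hm.sys.R_pos _ (hx0 n)) (hm.sys.R_mono (hxle n))
  have hfK : ∀ n, κ (ev Λ (f n)) ≤ K := fun n => by
    have := hm.kappa_nonneg _ (sub_nonneg.2 (hm.sys.R_mono (hxle n)))
    rw [map_sub, sub_nonneg] at this
    rwa [hLf]
  have hfN : ∀ n, ‖evPow Λ 2 (f n)‖ ≤ N := fun n => by
    rw [hLLf]; exact hX.norm_le (hx0 n) (hxle n)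
  have hadm := hm.iter_admissible hX hM hK hN hf hfmono hfM hfK hfN
  set g : ℕ → ℝ → X := fun n => (iter S Λ Pp Pm a (a M) f n).1 with hg_def
  have hsm : ∀ n, SmoothCurve R (g n) := fun n => (hadm n).1.smooth_left
  have hreg : ∀ n, RegularCurve R Λ (g n) := fun n => (hsm n).regular hm hX
  have hgmem : ∀ n t, 0 ≤ t → g n t ∈ coneTop R := fun n t ht => hm.smooth_mem hX (hsm n) ht
  have hgmono : ∀ t, 0 ≤ t → Monotone fun n => g n t := fun t ht =>
    monotone_nat_of_le_succ fun n => (hadm n).2 t ht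
  have hc : 0 ≤ a M := hm.a_nonneg M hM
  -- the second powers of the iterates increase and are bounded
  have hzb : ∀ n t, 0 ≤ t → ‖evPow Λ 2 (g n t)‖ ≤ N * Real.exp (ρ K * t) := fun n t ht =>
    (hadm n).1.second t ht
  have hzlim : ∀ t, ∃ z, 0 ≤ t → Tendsto (fun n => evPow Λ 2 (g n t)) atTop (𝓝 z) := by
    intro t
    by_cases ht : 0 ≤ t
    · obtain ⟨z, hz⟩ := hX.exists_tendsto_of_monotone (u := fun n => evPow Λ 2 (g n t))
        (fun m n hmn => hm.evPow_mono hX (hgmem m t ht 2) (hgmem n t ht 2) (hgmono t ht hmn))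
        (fun n => hm.evPow_nonneg (hgmem n t ht 2)) (fun n => hzb n t ht)
      exact ⟨z, fun _ => hz⟩
    · exact ⟨0, fun h => absurd h ht⟩
  choose z hz using hzlim
  have hz0 : ∀ t, 0 ≤ t → 0 ≤ z t := fun t ht =>
    ge_of_tendsto' (hz t ht) fun n => hm.evPow_nonneg (hgmem n t ht 2)
  set φ : ℝ → X := fun t => (R ^ 2) (z t) with hφ_def
  have hφz : ∀ t, evPow Λ 2 (φ t) = z t := fun t => hm.evPow_pow 2 _
  have hLφ : ∀ t, ev Λ (φ t) = R (z t) := fun t => by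
    simp only [hφ_def]; rw [pow_succ_apply', hm.ev_R, pow_one]
  have hbound : ∀ t, 0 ≤ t → ‖evPow Λ 2 (φ t)‖ ≤ N * Real.exp (ρ K * t) := fun t ht => by
    rw [hφz]
    exact le_of_tendsto' (hz t ht).norm fun n => hzb n t ht
  have hgφ : ∀ t, 0 ≤ t → Tendsto (fun n => g n t) atTop (𝓝 (φ t)) := fun t ht =>
    (((R ^ 2 : X →L[ℝ] X).continuous.tendsto _).comp (hz t ht)).congr fun n =>
      hm.pow_evPow (hgmem n t ht 2)
  have hLg : ∀ t, 0 ≤ t → Tendsto (fun n => ev Λ (g n t)) atTop (𝓝 (ev Λ (φ t))) := by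
    intro t ht
    rw [hLφ]
    exact ((R.continuous.tendsto _).comp (hz t ht)).congr fun n => hm.R_evPow_two (hreg n) ht
  have hgle : ∀ n t, 0 ≤ t → g n t ≤ φ t := fun n t ht => (hgmono t ht).ge_of_tendsto (hgφ t ht) n
  have hexp : ∀ {s t : ℝ}, s ≤ t → N * Real.exp (ρ K * s) ≤ N * Real.exp (ρ K * t) := fun hst =>
    mul_le_mul_of_nonneg_left (Real.exp_le_exp.2
      (mul_le_mul_of_nonneg_left hst (hm.rho_nonneg K hK))) hN
  have hφreg : RegularCurve R Λ φ := by
    refine ⟨?_, fun t ht => ⟨z t, hz0 t ht, rfl⟩, fun T hT =>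
      ⟨N * Real.exp (ρ K * T), by positivity,
      fun t ht => (hbound t ht.1).trans (hexp ht.2)⟩⟩
    exact aestronglyMeasurable_of_tendsto_ae atTop (fun n => (hreg n).meas)
      (lebPos_ae_iff.2 (Eventually.of_forall hgφ))
  -- bounds for the nonlinear terms, uniform in the iterates
  have hlossb : ∀ n t, 0 ≤ t → ‖ev Λ (Pm t (g n t))‖ ≤ a M * (N * Real.exp (ρ K * t)) := by
    intro n t ht
    refine (hm.norm_evPow_loss_le hX (k := 1) (hgmem n t ht 2)).trans ?_
    have h1 : ‖ev Λ (g n t)‖ ≤ M := by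
      have h2 := (hadm n).1.energy t ht
      have h3 := hm.integral_delta_nonneg ((hadm n).1.smooth_right.regular hm hX) ht
      exact (le_add_of_nonneg_right h3).trans h2
    exact mul_le_mul (hm.a_mono (norm_nonneg _) hM h1) (hzb n t ht) (norm_nonneg _) hc
  have hgainb : ∀ n t, 0 ≤ t → ‖ev Λ (Pp t (g n t))‖ ≤ a M * (N * Real.exp (ρ K * t)) :=
    fun n t ht => (hm.norm_gain_le hX (hgmem n t ht 2)).trans (hlossb n t ht)
  have hloss : ∀ t, 0 ≤ t → Tendsto (fun n => ev Λ (Pm t (g n t))) atTop (𝓝 (ev Λ (Pm t (φ t)))) :=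
    fun t ht => hm.tendsto_ev_of_closed hX (hm.mono_m t) (fun u hu => hm.loss_mem hX hu)
      (hm.closed_m t) (fun n => hgmem n t ht 2) (hgmono t ht) (hgφ t ht) fun n => hlossb n t ht
  have hgain : ∀ t, 0 ≤ t → Tendsto (fun n => ev Λ (Pp t (g n t))) atTop (𝓝 (ev Λ (Pp t (φ t)))) :=
    fun t ht => hm.tendsto_ev_of_closed hX (hm.mono_p t) (fun u hu => hm.maps_two t hu)
      (hm.closed_p t) (fun n => hgmem n t ht 2) (hgmono t ht) (hgφ t ht) fun n => hgainb n t ht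
  have hΔ : ∀ t, 0 ≤ t → Tendsto (fun n => ∫ s in (0 : ℝ)..t, Delta Pp Pm Λ s (g n s)) atTop
      (𝓝 (∫ s in (0 : ℝ)..t, Delta Pp Pm Λ s (φ s))) := by
    intro t ht
    refine intervalIntegral.tendsto_integral_filter_of_dominated_convergence
      (fun _ => a M * (N * Real.exp (ρ K * t))) ?_ ?_ intervalIntegrable_const ?_
    · exact Eventually.of_forall fun n =>
        (hm.locIntegrable_delta hX (hreg n) t ht).def'.aestronglyMeasurable
    · refine Eventually.of_forall fun n => Eventually.of_forall fun s hs => ?_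
      rw [uIoc_of_le ht] at hs
      have h1 := hm.delta_nonneg s _ (hgmem n s hs.1.le 2)
      rw [Real.norm_of_nonneg h1]
      have h2 := hlossb n s hs.1.le
      have h3 := mul_le_mul_of_nonneg_left (hexp hs.2) hc
      have h4 := norm_nonneg (ev Λ (Pp s (g n s)))
      simp only [Delta]
      linarith
    · refine Eventually.of_forall fun s hs => ?_
      rw [uIoc_of_le ht] at hs
      exact (hloss s hs.1.le).norm.sub (hgain s hs.1.le).norm
  have hw : ∀ t, 0 ≤ t → ‖ev Λ (φ t)‖ + ∫ s in (0 : ℝ)..t, Delta Pp Pm Λ s (φ s) ≤ M := fun t ht =>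
    le_of_tendsto' (((hLg t ht).comp (tendsto_add_atTop_nat 1)).norm.add (hΔ t ht)) fun n =>
      (hadm (n + 1)).1.energy t ht
  have hrate : ∀ t, 0 ≤ t → Tendsto (fun n => rate Λ Pp Pm a (g (n + 1)) (g n) t) atTop
      (𝓝 (rate Λ Pp Pm a φ φ t)) := by
    intro t ht
    refine hm.tendsto_a (fun n => add_nonneg (norm_nonneg _)
      (hm.integral_delta_nonneg (hreg n) ht)) (fun n => add_le_add ?_ ?_)
      (((hLg t ht).comp (tendsto_add_atTop_nat 1)).norm.add (hΔ t ht))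
    · exact hX.norm_le (hm.ev_nonneg (hgmem _ t ht 1)) (hm.ev_mono hX (hgmem _ t ht 1)
        (hm.mem_one hφreg ht) (hgle _ t ht))
    · exact hm.integral_delta_mono hX (hreg n) hφreg (hgle n) ht
  -- the limit of the integrated equation
  have heq : ∀ t, 0 ≤ t → ev Λ (φ t) + a M • ∫ s in (0 : ℝ)..t, z s =
      R x₀ + ∫ s in (0 : ℝ)..t, ev Λ (source Λ Pp Pm a φ φ s) := by
    intro t ht
    have hn : ∀ n, ev Λ (g (n + 2) t) + a M • ∫ s in (0 : ℝ)..t, evPow Λ 2 (g (n + 2) s) =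
        R (x (n + 1)) + ∫ s in (0 : ℝ)..t, ev Λ (source Λ Pp Pm a (g (n + 1)) (g n) s) := by
      intro n
      have hA := (hadm (n + 1)).1
      have hLI := hm.locIntegrable_evPow_source hX (hsm (n + 1)) (hreg n) hA.energy 2
      have h1 := hm.sys.mildSol_identity hX hc (evPow Λ 2 (f (n + 1))) hLI ht
      have h2 : ∀ s, 0 ≤ s → evPow Λ 2 (g (n + 2) s) = mildSol S (a M) (evPow Λ 2 (f (n + 1)))
          (fun r => evPow Λ 2 (source Λ Pp Pm a (g (n + 1)) (g n) r)) s := fun s hs =>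
        hm.evPow_step hX (hsm (n + 1)) (hreg n) hM hA.energy (hf (n + 1)) 2 hs
      have h3 : ∫ s in (0 : ℝ)..t, mildSol S (a M) (evPow Λ 2 (f (n + 1)))
          (fun r => evPow Λ 2 (source Λ Pp Pm a (g (n + 1)) (g n) r)) s =
          ∫ s in (0 : ℝ)..t, evPow Λ 2 (g (n + 2) s) := by
        refine intervalIntegral.integral_congr fun s hs => ?_
        rw [uIcc_of_le ht] at hs
        exact (h2 s hs.1).symm
      rw [h3, ← h2 t ht, hm.R_evPow_two (hreg _) ht, map_add, hLLf,
        ← ContinuousLinearMap.intervalIntegral_comp_comm R (hLI t ht)] at h1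
      rw [h1]
      congr 1
      refine intervalIntegral.integral_congr fun s hs => ?_
      rw [uIcc_of_le ht] at hs
      exact hm.R_evPow_succ (k := 1)
        (hm.source_mem_top hX (hsm (n + 1)) (hreg n) hA.energy hs.1 2)
    have hl1 : Tendsto (fun n => ∫ s in (0 : ℝ)..t, evPow Λ 2 (g (n + 2) s)) atTop
        (𝓝 (∫ s in (0 : ℝ)..t, z s)) := by
      refine intervalIntegral.tendsto_integral_filter_of_dominated_convergence
        (fun _ => N * Real.exp (ρ K * t)) ?_ ?_ intervalIntegrable_const ?_
      · exact Eventually.of_forall fun n =>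
          (hm.locIntegrable_evPow_two hX (hreg _) t ht).def'.aestronglyMeasurable
      · refine Eventually.of_forall fun n => Eventually.of_forall fun s hs => ?_
        rw [uIoc_of_le ht] at hs
        exact (hzb _ s hs.1.le).trans (hexp hs.2)
      · refine Eventually.of_forall fun s hs => ?_
        rw [uIoc_of_le ht] at hs
        exact (hz s hs.1.le).comp (tendsto_add_atTop_nat 2)
    have hl2 : Tendsto
        (fun n => ∫ s in (0 : ℝ)..t, ev Λ (source Λ Pp Pm a (g (n + 1)) (g n) s)) atTop
        (𝓝 (∫ s in (0 : ℝ)..t, ev Λ (source Λ Pp Pm a φ φ s))) := by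
      refine intervalIntegral.tendsto_integral_filter_of_dominated_convergence
        (fun _ => 3 * (a M * (N * Real.exp (ρ K * t)))) ?_ ?_ intervalIntegrable_const ?_
      · exact Eventually.of_forall fun n => (hm.locIntegrable_ev_source hX (hreg (n + 1)) (hreg n)
          (hadm (n + 1)).1.energy t ht).def'.aestronglyMeasurable
      · refine Eventually.of_forall fun n => Eventually.of_forall fun s hs => ?_
        rw [uIoc_of_le ht] at hs
        rw [hm.ev_source hX (hreg (n + 1)) hs.1.le]
        have e0 := mul_le_mul_of_nonneg_left (hexp hs.2) hc
        have e1 := (hgainb (n + 1) s hs.1.le).trans e0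
        have e2 := (hlossb (n + 1) s hs.1.le).trans e0
        have e3 : ‖rate Λ Pp Pm a (g (n + 1)) (g n) s • evPow Λ 2 (g (n + 1) s)‖ ≤
            a M * (N * Real.exp (ρ K * t)) := by
          rw [norm_smul, Real.norm_of_nonneg (hm.rate_nonneg (hreg n) hs.1.le)]
          exact mul_le_mul (hm.rate_le (hreg n) hs.1.le ((hadm (n + 1)).1.energy s hs.1.le))
            ((hzb _ s hs.1.le).trans (hexp hs.2)) (norm_nonneg _) hc
        have e4 := norm_add_le (ev Λ (Pp s (g (n + 1) s)))
          (rate Λ Pp Pm a (g (n + 1)) (g n) s • evPow Λ 2 (g (n + 1) s) - ev Λ (Pm s (g (n + 1) s)))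
        have e5 := norm_sub_le (rate Λ Pp Pm a (g (n + 1)) (g n) s • evPow Λ 2 (g (n + 1) s))
          (ev Λ (Pm s (g (n + 1) s)))
        linarith
      · refine Eventually.of_forall fun s hs => ?_
        rw [uIoc_of_le ht] at hs
        rw [hm.ev_source hX hφreg hs.1.le, hφz]
        simp only [hm.ev_source hX (hreg _) hs.1.le]
        exact ((hgain s hs.1.le).comp (tendsto_add_atTop_nat 1)).add
          (((hrate s hs.1.le).smul ((hz s hs.1.le).comp (tendsto_add_atTop_nat 1))).sub
          ((hloss s hs.1.le).comp (tendsto_add_atTop_nat 1)))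
    have hl3 := ((hLg t ht).comp (tendsto_add_atTop_nat 2)).add (hl1.const_smul (a M))
    have hl4 := ((R.continuous.tendsto _).comp (hxlim.comp (tendsto_add_atTop_nat 1))).add hl2
    exact tendsto_nhds_unique (hl3.congr hn) hl4
  have hzLI : LocIntegrable z :=
    (hm.locIntegrable_evPow_two hX hφreg).congr fun t _ => hφz t
  have hratez := hm.locIntegrable_rate_smul hX hφreg hφreg hw
  -- the defect of energy satisfies a linear integral inequality, hence vanishes
  have hrate_eq : ∀ t, 0 ≤ t → rate Λ Pp Pm a φ φ t = a M := by
    intro T hT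
    obtain ⟨ℓ, hℓ⟩ := hX.exists_mass
    have hψ : LocIntegrable fun s => ℓ (a M • z s - rate Λ Pp Pm a φ φ s • evPow Λ 2 (φ s)) :=
      ((hzLI.const_smul (a M)).sub hratez).clm_comp ℓ
    have hdefect : ∀ t ∈ Icc 0 T, M - (‖ev Λ (φ t)‖ + ∫ s in (0 : ℝ)..t, Delta Pp Pm Λ s (φ s)) =
        ∫ s in (0 : ℝ)..t, ℓ (a M • z s - rate Λ Pp Pm a φ φ s • evPow Λ 2 (φ s)) := by
      intro t ht
      have h1 := congrArg ℓ (heq t ht.1)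
      have hsrc := hm.locIntegrable_ev_source hX hφreg hφreg hw t ht.1
      rw [map_add, map_add, hℓ _ (hm.ev_nonneg (hm.mem_one hφreg ht.1)),
        hℓ _ (hm.sys.R_pos _ hx₀), ← hLf₀, ← hM_def, ← intervalIntegral.integral_smul,
        ← ContinuousLinearMap.intervalIntegral_comp_comm ℓ (hzLI.const_smul (a M) t ht.1),
        ← ContinuousLinearMap.intervalIntegral_comp_comm ℓ hsrc] at h1
      have h2 : ∫ s in (0 : ℝ)..t, ℓ (a M • z s - rate Λ Pp Pm a φ φ s • evPow Λ 2 (φ s)) =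
          (∫ s in (0 : ℝ)..t, ℓ (a M • z s)) -
          ((∫ s in (0 : ℝ)..t, ℓ (ev Λ (source Λ Pp Pm a φ φ s))) +
            ∫ s in (0 : ℝ)..t, Delta Pp Pm Λ s (φ s)) := by
        have i1 := (hzLI.const_smul (a M) t ht.1).clm_comp ℓ
        have i2 := hsrc.clm_comp ℓ
        have i3 := hm.locIntegrable_delta hX hφreg t ht.1
        rw [← intervalIntegral.integral_add i2 i3, ← intervalIntegral.integral_sub i1 (i2.add i3)]
        refine intervalIntegral.integral_congr fun s hs => ?_
        rw [uIcc_of_le ht.1] at hs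
        have m := hφreg.mem s hs.1
        simp only [hm.ev_source hX hφreg hs.1, map_sub, map_add, Delta]
        rw [hℓ _ (hm.ev_nonneg (hm.maps_two s m)), hℓ _ (hm.ev_nonneg (hm.loss_mem hX (k := 1) m))]
        ring
      rw [h2]
      linarith
    have hzero := eq_zero_of_integral_le (K := (a (M + 1) - a M) * (N * Real.exp (ρ K * T))) hT
      (hψ T hT) (fun t ht => sub_nonneg.2 (hw t ht.1)) hdefect (fun t ht => by
        have h0 := add_nonneg (norm_nonneg (ev Λ (φ t))) (hm.integral_delta_nonneg hφreg ht.1)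
        have h1 := hm.a_sub_le h0 (hw t ht.1)
        have h2 := (hbound t ht.1).trans (hexp ht.2)
        have h3 : a M ≤ a (M + 1) :=
          hm.a_mono hM (mem_Ici.2 (by linarith)) (by linarith)
        rw [hφz, ← sub_smul, map_smul, hℓ _ (hz0 t ht.1), smul_eq_mul]
        rw [hφz] at h2
        have h4 := mul_le_mul h1 h2 (norm_nonneg _)
          (mul_nonneg (sub_nonneg.2 h3) (sub_nonneg.2 (hw t ht.1)))
        refine h4.trans_eq ?_
        ring) (t := T) ⟨hT, le_rfl⟩
    exact congrArg a (sub_eq_zero.1 hzero).symm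
  refine ⟨φ, hφreg, fun t ht => ?_, hbound, fun F hF hFs t ht => ?_⟩
  · have h1 := heq t ht
    have hp := hm.locIntegrable_ev_gain hX hφreg t ht
    have hl := hm.locIntegrable_ev_loss hX hφreg t ht
    have h2 : ∫ s in (0 : ℝ)..t, ev Λ (source Λ Pp Pm a φ φ s) =
        (∫ s in (0 : ℝ)..t, (ev Λ (Pp s (φ s)) - ev Λ (Pm s (φ s)))) +
          a M • ∫ s in (0 : ℝ)..t, z s := by
      rw [← intervalIntegral.integral_smul, ← intervalIntegral.integral_add (hp.sub hl)
        (hzLI.const_smul (a M) t ht)]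
      refine intervalIntegral.integral_congr fun s hs => ?_
      rw [uIcc_of_le ht] at hs
      simp only [hm.ev_source hX hφreg hs.1, hrate_eq s hs.1, hφz]
      abel
    rw [h2, ← add_assoc] at h1
    rw [hLf₀]
    exact add_right_cancel h1
  · exact le_of_tendsto' (hgφ t ht) fun n =>
      (hm.iter_le hX hK hN hf₀ hf hfmono hff hfK hfN hF hFs n t ht).1

/-- A regular solution is determined by its initial datum: of two solutions one of which dominates
the other, conservation forces equality. -/
theorem eq_of_le {f₀ : X} (hf₀ : f₀ ∈ conePow R 2) {f F : ℝ → X} (hf : RegularCurve R Λ f)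
    (hfs : SolvesReduced Λ Pp Pm f₀ f) (hF : RegularCurve R Λ F)
    (hFs : SolvesReduced Λ Pp Pm f₀ F) (hle : ∀ t, 0 ≤ t → f t ≤ F t) {t : ℝ} (ht : 0 ≤ t) :
    F t = f t := by
  have h1 := hm.energy_eq hX hf₀ hf hfs ht
  have h2 := hm.energy_eq hX hf₀ hF hFs ht
  have h3 := hm.integral_delta_mono hX hf hF hle ht
  have m1 := hm.mem_one hf ht
  have m2 := hm.mem_one hF ht
  have h4 := hm.ev_mono hX m1 m2 (hle t ht)
  have h5 := hX.norm_sub (hm.ev_nonneg m1) h4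
  have h6 : ‖ev Λ (F t) - ev Λ (f t)‖ ≤ 0 := by linarith
  have h7 := sub_eq_zero.1 (norm_le_zero_iff.1 h6)
  rw [← hm.R_ev m1, ← hm.R_ev m2, h7]

end ReducedModel

end

section

/-! ### Domains of the powers of `Λ` -/

variable {X : Type*} [NormedAddCommGroup X] [NormedSpace ℝ X]

section Domains

variable {R : X →L[ℝ] X} {Λ : X →ₗ.[ℝ] X}

theorem pow_evPow_of_mem_domPow (hR : ∀ g y, (g ∈ Λ.domain ∧ ev Λ g = y) ↔ g = R y) {k : ℕ}
    {g : X} (hg : g ∈ domPow Λ k) : (R ^ k) (evPow Λ k g) = g := by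
  induction k with
  | zero => rfl
  | succ k ih =>
    rw [pow_succ_apply]
    change (R ^ k) (R (ev Λ (evPow Λ k g))) = g
    rw [← (hR _ _).1 ⟨hg.2, rfl⟩, ih hg.1]

theorem pow_mem_domPow (hR : ∀ g y, (g ∈ Λ.domain ∧ ev Λ g = y) ↔ g = R y) (k : ℕ) (x : X) :
    (R ^ k) x ∈ domPow Λ k := by
  have hev : ∀ x, ev Λ (R x) = x := fun x => ((hR _ _).2 rfl).2
  induction k generalizing x with
  | zero => trivial
  | succ k ih =>
    rw [pow_succ_apply]
    refine ⟨ih _, ?_⟩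
    rw [evPow_pow_apply hev]
    exact ((hR _ x).2 rfl).1

variable [PartialOrder X] [IsOrderedAddMonoid X] [IsOrderedModule ℝ X] [CompleteSpace X]

/-- The inverse of `Rᵏ` is positive as well, so that positive elements of `𝒟(Λᵏ)` have positive
preimages. -/
theorem domPowPos_eq_conePow (hX : SpaceAssumptions X) {S : ℝ → X →L[ℝ] X} {lam0 : ℝ}
    (hsys : ResolventSystem S R lam0) (hR : ∀ g y, (g ∈ Λ.domain ∧ ev Λ g = y) ↔ g = R y)
    (k : ℕ) : domPowPos Λ k = conePow R k := by
  ext g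
  constructor
  · rintro ⟨h1, h2⟩
    have h3 := pow_evPow_of_mem_domPow hR h1
    exact ⟨evPow Λ k g, hsys.nonneg_of_pow_nonneg hX k (by rwa [h3]), h3⟩
  · rintro ⟨x, hx, rfl⟩
    exact ⟨pow_mem_domPow hR k x, hsys.pow_pos k hx⟩

theorem domTopPos_eq_coneTop (hX : SpaceAssumptions X) {S : ℝ → X →L[ℝ] X} {lam0 : ℝ}
    (hsys : ResolventSystem S R lam0) (hR : ∀ g y, (g ∈ Λ.domain ∧ ev Λ g = y) ↔ g = R y) :
    domTopPos Λ = coneTop R := by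
  ext g
  refine ⟨fun h k => ?_, fun h => ⟨fun k => ?_, ?_⟩⟩
  · rw [← domPowPos_eq_conePow hX hsys hR]
    exact ⟨h.1 k, h.2⟩
  · have := h k
    rw [← domPowPos_eq_conePow hX hsys hR] at this
    exact this.1
  · exact hsys.conePow_nonneg (h 0)

end Domains

/-! ### Groups of positive isometries commuting with `Λ` -/

variable [PartialOrder X]

/-- A strongly continuous group of positive operators that preserve the norm of positive elements
and commute with `R`. -/
structure CommutingGroup (U : ℝ → X →L[ℝ] X) (R : X →L[ℝ] X) : Prop where
  group : IsC0Group U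
  continuous : Continuous fun p : ℝ × X => U p.1 p.2
  pos : ∀ (t : ℝ) (g : X), 0 ≤ g → 0 ≤ U t g
  norm : ∀ (t : ℝ) (g : X), 0 ≤ g → ‖U t g‖ = ‖g‖
  comm : ∀ (t : ℝ) (x : X), U t (R x) = R (U t x)

theorem IsC0Group.inv_apply {U : ℝ → X →L[ℝ] X} (hU : IsC0Group U) (t : ℝ) (x : X) :
    U (-t) (U t x) = x := by
  have := hU.add (-t) t
  rw [neg_add_cancel, hU.zero] at this
  exact (congrArg (fun T : X →L[ℝ] X => T x) this).symm

theorem IsC0Group.apply_inv {U : ℝ → X →L[ℝ] X} (hU : IsC0Group U) (t : ℝ) (x : X) :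
    U t (U (-t) x) = x := by
  simpa using hU.inv_apply (-t) x

theorem IsC0Group.continuous {U : ℝ → X →L[ℝ] X} (hU : IsC0Group U) (x : X) :
    Continuous fun t => U t x := by
  rw [continuous_iff_continuousAt]
  intro t
  have h1 : Tendsto (fun s : ℝ => s - t) (𝓝 t) (𝓝 0) := by
    have : Continuous fun s : ℝ => s - t := by fun_prop
    simpa using this.tendsto t
  have h2 := ((U t).continuous.tendsto x).comp ((hU.tendsto x).comp h1)
  refine h2.congr fun s => ?_
  have := hU.add t (s - t)
  rw [add_sub_cancel] at this
  simp [this]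

variable [IsOrderedAddMonoid X] [IsOrderedModule ℝ X]

/-- Commutation with `Λ` at positive times extends to all times, because `Uᵗ` is invertible. -/
theorem commutingGroup [CompleteSpace X] (hX : SpaceAssumptions X) {U : ℝ → X →L[ℝ] X}
    (hU : IsC0Group U) (hUpos : ∀ (t : ℝ) (g : X), 0 ≤ g → 0 ≤ U t g)
    (hUiso : ∀ (t : ℝ) (g : X), 0 ≤ g → ‖U t g‖ = ‖g‖) {R : X →L[ℝ] X} {Λ : X →ₗ.[ℝ] X}
    (hR : ∀ g y, (g ∈ Λ.domain ∧ ev Λ g = y) ↔ g = R y)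
    (hdom : ∀ t : ℝ, U t '' (Λ.domain : Set X) = (Λ.domain : Set X))
    (hcomm : ∀ t : ℝ, 0 < t → ∀ g ∈ Λ.domain, U t (ev Λ g) = ev Λ (U t g)) :
    CommutingGroup U R where
  group := hU
  continuous := by
    obtain ⟨C, -, h⟩ := hX.exists_norm_bound
    exact continuous_uncurry_of_norm_le hU.continuous
      fun t x => h (U t) (fun g hg => (hUiso t g hg).le) x
  pos := hUpos
  norm := hUiso
  comm := by
    have hpos : ∀ t : ℝ, 0 < t → ∀ x, U t (R x) = R (U t x) := by
      intro t ht x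
      obtain ⟨h1, h2⟩ := (hR (R x) x).2 rfl
      refine (hR _ _).1 ⟨?_, ?_⟩
      · have : U t (R x) ∈ U t '' (Λ.domain : Set X) := mem_image_of_mem _ h1
        rw [hdom t] at this
        exact this
      · rw [← hcomm t ht _ h1, h2]
    intro t x
    rcases lt_trichotomy t 0 with ht | rfl | ht
    · have := hpos (-t) (by linarith) (U t x)
      rw [hU.inv_apply] at this
      rw [← this, hU.apply_inv]
    · simp [hU.zero]
    · exact hpos t ht x

namespace CommutingGroup

variable {U : ℝ → X →L[ℝ] X} {R : X →L[ℝ] X} (hc : CommutingGroup U R)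
include hc

theorem mono (t : ℝ) {g h : X} (hgh : g ≤ h) : U t g ≤ U t h := by
  have := hc.pos t _ (sub_nonneg.2 hgh)
  rwa [map_sub, sub_nonneg] at this

theorem comm_pow (k : ℕ) (t : ℝ) (x : X) : U t ((R ^ k) x) = (R ^ k) (U t x) := by
  induction k with
  | zero => simp
  | succ k ih => rw [pow_succ_apply', pow_succ_apply', hc.comm, ih]

theorem mem (t : ℝ) {k : ℕ} {g : X} (hg : g ∈ conePow R k) : U t g ∈ conePow R k := by
  obtain ⟨x, hx, rfl⟩ := hg
  exact ⟨U t x, hc.pos t x hx, (hc.comm_pow k t x).symm⟩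

theorem mem_top (t : ℝ) {g : X} (hg : g ∈ coneTop R) : U t g ∈ coneTop R :=
  fun k => hc.mem t (hg k)

theorem evPow_apply {Λ : X →ₗ.[ℝ] X} (hev : ∀ x, ev Λ (R x) = x) (t : ℝ) {k : ℕ} {g : X}
    (hg : g ∈ conePow R k) : evPow Λ k (U t g) = U t (evPow Λ k g) := by
  obtain ⟨x, hx, rfl⟩ := hg
  rw [hc.comm_pow, evPow_pow_apply hev, evPow_pow_apply hev]

theorem norm_evPow {Λ : X →ₗ.[ℝ] X} (hev : ∀ x, ev Λ (R x) = x) (t : ℝ) {k : ℕ} {g : X}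
    (hg : g ∈ conePow R k) : ‖evPow Λ k (U t g)‖ = ‖evPow Λ k g‖ := by
  rw [hc.evPow_apply hev t hg]
  obtain ⟨x, hx, rfl⟩ := hg
  rw [evPow_pow_apply hev, hc.norm t x hx]

theorem aestronglyMeasurable {μ : Measure ℝ} {c : ℝ → ℝ} (hcc : Continuous c) {g : ℝ → X}
    (hg : AEStronglyMeasurable g μ) : AEStronglyMeasurable (fun t => U (c t) (g t)) μ :=
  hc.continuous.comp_aestronglyMeasurable (hcc.aestronglyMeasurable.prodMk hg)

theorem continuousOn {c : ℝ → ℝ} (hcc : Continuous c) {s : Set ℝ} {g : ℝ → X}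
    (hg : ContinuousOn g s) : ContinuousOn (fun t => U (c t) (g t)) s :=
  hc.continuous.comp_continuousOn (hcc.continuousOn.prodMk hg)

end CommutingGroup

/-! ### The functional given by `Λ₁` -/

/-- By additivity of the norm, `x ↦ ‖Λ₁ R x‖` is a positive additive functional on the
cone, hence automatically bounded; it is invariant under the group. -/
theorem exists_functional_of_cone_operator [CompleteSpace X] (hX : SpaceAssumptions X)
    {R : X →L[ℝ] X} {D₁ : Submodule ℝ≥0 X} {Λ₁ : D₁ →ₗ[ℝ≥0] X} (hpos : ∀ g : D₁, 0 ≤ Λ₁ g)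
    (hsub : conePow R 1 ⊆ (D₁ : Set X)) {U : ℝ → X →L[ℝ] X} (hc : CommutingGroup U R)
    (hU : ∀ t : ℝ, 0 < t → ∀ g ∈ D₁, U t (evCone Λ₁ g) = evCone Λ₁ (U t g)) :
    ∃ κ : X →L[ℝ] ℝ, (∀ x, 0 ≤ x → κ x = ‖evCone Λ₁ (R x)‖) ∧
      ∀ t x, 0 ≤ x → κ (U t x) = κ x := by
  have hmem : ∀ x, 0 ≤ x → R x ∈ D₁ := fun x hx => hsub ⟨x, hx, by rw [pow_one]⟩
  have hval : ∀ x (hx : 0 ≤ x), evCone Λ₁ (R x) = Λ₁ ⟨R x, hmem x hx⟩ := fun x hx => by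
    simp [evCone, hmem x hx]
  obtain ⟨κ, hκ⟩ := hX.exists_functional (fun x => ‖evCone Λ₁ (R x)‖)
    (fun _ _ => norm_nonneg _) (fun g h hg hh => by
      rw [hval g hg, hval h hh, hval _ (add_nonneg hg hh), ← hX.norm_add _ _ (hpos _) (hpos _),
        ← map_add]
      congr 2
      exact Subtype.ext (map_add R g h))
    (fun r g hr hg => by
      rw [hval g hg, hval _ (smul_nonneg hr hg)]
      have : (⟨R (r • g), hmem _ (smul_nonneg hr hg)⟩ : D₁) = r.toNNReal • ⟨R g, hmem g hg⟩ :=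
        Subtype.ext (by
          change R (r • g) = r.toNNReal • R g
          rw [map_smul, NNReal.smul_def, Real.coe_toNNReal r hr])
      rw [this, map_smul, NNReal.smul_def, Real.coe_toNNReal r hr, norm_smul,
        Real.norm_of_nonneg hr]
      rfl)
  have hinv : ∀ t : ℝ, 0 < t → ∀ x, 0 ≤ x → κ (U t x) = κ x := by
    intro t ht x hx
    rw [hκ _ (hc.pos t x hx), hκ x hx, ← hc.comm, ← hU t ht _ (hmem x hx)]
    refine hc.norm t _ ?_
    rw [hval x hx]
    exact hpos _
  refine ⟨κ, hκ, fun t x hx => ?_⟩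
  rcases lt_trichotomy t 0 with ht | rfl | ht
  · have := hinv (-t) (by linarith) (U t x) (hc.pos t x hx)
    rw [hc.group.inv_apply] at this
    exact this.symm
  · simp [hc.group.zero]
  · exact hinv t ht x hx

end

section

/-! ### Removing the group -/

variable {X : Type*} [NormedAddCommGroup X] [NormedSpace ℝ X] [PartialOrder X]

/-- The pointwise conditions at the time `t`, which hold for almost every `t ≥ 0`. -/
structure GoodTime (𝒟 : Set X) (Qp Qm : ℝ → X → X) (Λ : X →ₗ.[ℝ] X) (R : X →L[ℝ] X)
    (a ρ : ℝ → ℝ) (κ : X →L[ℝ] ℝ) (t : ℝ) : Prop where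
  pos : 0 ≤ t
  mono_p : MonotoneOn (Qp t) 𝒟
  mono_m : MonotoneOn (Qm t) 𝒟
  closed_p : OClosed (Qp t) 𝒟
  closed_m : OClosed (Qm t) 𝒟
  maps_two : MapsTo (Qp t) (conePow R 2) (conePow R 1)
  maps_top : MapsTo (Qp t) (coneTop R) (coneTop R)
  maps_two_m : MapsTo (Qm t) (conePow R 2) (conePow R 1)
  maps_three : MapsTo (Qp t) (conePow R 3) (conePow R 2)
  maps_three_m : MapsTo (Qm t) (conePow R 3) (conePow R 2)
  bound : ∀ g ∈ conePow R 1, Qm t g ≤ a ‖ev Λ g‖ • ev Λ g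
  bound_mono : MonotoneOn (fun g => a ‖ev Λ g‖ • ev Λ g - Qm t g) (conePow R 1)
  delta_nonneg : ∀ g ∈ conePow R 2, 0 ≤ Delta Qp Qm Λ t g
  delta_mono : MonotoneOn (Delta Qp Qm Λ t) (conePow R 2)
  kappa_le : ∀ g ∈ conePow R 2, κ (ev Λ (Qp t g)) ≤ κ (ev Λ (Qm t g))
  povzner : ∀ g ∈ conePow R 3,
    ‖evPow Λ 2 (Qp t g)‖ ≤ ‖evPow Λ 2 (Qm t g)‖ + ρ (κ (ev Λ g)) * ‖evPow Λ 2 g‖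

open Classical in
/-- The operator `g ↦ U⁻ᵗ Q(t, Uᵗ g)` at the times `t ∈ N`, and the zero operator at the other
times, so that conditions imposed for almost every time hold at every time. -/
def pull (U : ℝ → X →L[ℝ] X) (N : Set ℝ) (Q : ℝ → X → X) (t : ℝ) (g : X) : X :=
  if t ∈ N then U (-t) (Q t (U t g)) else 0

theorem pull_of_mem {U : ℝ → X →L[ℝ] X} {N : Set ℝ} {Q : ℝ → X → X} {t : ℝ} (ht : t ∈ N) :
    pull U N Q t = fun g => U (-t) (Q t (U t g)) := by
  funext g; simp [pull, ht]

theorem pull_of_notMem {U : ℝ → X →L[ℝ] X} {N : Set ℝ} {Q : ℝ → X → X} {t : ℝ} (ht : t ∉ N) :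
    pull U N Q t = fun _ => 0 := by
  funext g; simp [pull, ht]

variable [IsOrderedAddMonoid X] [IsOrderedModule ℝ X]

section

variable {𝒟 : Set X} {Q : ℝ → X → X} {U : ℝ → X →L[ℝ] X} {R : X →L[ℝ] X} {N : Set ℝ}

theorem pull_aestronglyMeasurable (hQ : GeneralAssumptions 𝒟 Q) (hc : CommutingGroup U R)
    (h𝒟 : ∀ g ∈ 𝒟, 0 ≤ g) (hsub : conePow R 1 ⊆ 𝒟) (hN : ∀ᵐ t ∂lebPos, t ∈ N) {g : ℝ → X}
    (hg : AEStronglyMeasurable g lebPos) (hmem : ∀ t, 0 ≤ t → g t ∈ conePow R 1) :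
    AEStronglyMeasurable (fun t => pull U N Q t (g t)) lebPos := by
  have h0 : ∀ t, 0 ≤ t → U t (g t) ∈ 𝒟 := fun t ht => hsub (hc.mem t (hmem t ht))
  have h1 := hQ.measurable (fun t => U t (g t)) (hc.aestronglyMeasurable continuous_id hg)
    (fun t ht => h𝒟 _ (h0 t ht)) (lebPos_ae_iff.2 (Eventually.of_forall h0))
  refine (hc.aestronglyMeasurable continuous_neg h1).congr ?_
  filter_upwards [hN] with t ht
  rw [pull_of_mem ht]

theorem pull_monotoneOn (hc : CommutingGroup U R) {C : Set X} (hC : ∀ t, MapsTo (U t) C C)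
    (h : ∀ t ∈ N, MonotoneOn (Q t) C) (t : ℝ) : MonotoneOn (pull U N Q t) C := by
  by_cases ht : t ∈ N
  · rw [pull_of_mem ht]
    exact fun g hg g' hg' hgg => hc.mono _ (h t ht (hC t hg) (hC t hg') (hc.mono t hgg))
  · rw [pull_of_notMem ht]
    exact fun _ _ _ _ _ => le_rfl

theorem pull_closed (hc : CommutingGroup U R) (hsub : conePow R 1 ⊆ 𝒟)
    (h : ∀ t ∈ N, OClosed (Q t) 𝒟) (t : ℝ) (u : ℕ → X) (g z : X)
    (hu : ∀ n, u n ∈ conePow R 1) (hmono : Monotone u) (hlim : Tendsto u atTop (𝓝 g))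
    (hz : Tendsto (fun n => pull U N Q t (u n)) atTop (𝓝 z)) : pull U N Q t g = z := by
  by_cases ht : t ∈ N
  · rw [pull_of_mem ht] at hz ⊢
    have h1 := ((U t).continuous.tendsto z).comp hz
    simp only [Function.comp_def, hc.group.apply_inv] at h1
    have h2 := (h t ht (fun n => U t (u n)) (U t g) (U t z) (fun n => hsub (hc.mem t (hu n)))
      (fun m n hmn => hc.mono t (hmono hmn)) (((U t).continuous.tendsto g).comp hlim) h1).2
    simp only [h2, hc.group.inv_apply]
  · rw [pull_of_notMem ht] at hz ⊢
    exact tendsto_nhds_unique tendsto_const_nhds hz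

theorem pull_mapsTo (hc : CommutingGroup U R) {k l : ℕ}
    (h : ∀ t ∈ N, MapsTo (Q t) (conePow R k) (conePow R l)) (t : ℝ) :
    MapsTo (pull U N Q t) (conePow R k) (conePow R l) := by
  intro g hg
  by_cases ht : t ∈ N
  · rw [pull_of_mem ht]
    exact hc.mem _ (h t ht (hc.mem t hg))
  · rw [pull_of_notMem ht]
    exact ⟨0, le_rfl, map_zero _⟩

theorem evPow_pull (hc : CommutingGroup U R) {Λ : X →ₗ.[ℝ] X} (hev : ∀ x, ev Λ (R x) = x)
    {t : ℝ} (ht : t ∈ N) {k : ℕ} {g : X} (hg : Q t (U t g) ∈ conePow R k) :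
    evPow Λ k (pull U N Q t g) = U (-t) (evPow Λ k (Q t (U t g))) := by
  rw [pull_of_mem ht]
  exact hc.evPow_apply hev _ hg

theorem norm_evPow_pull (hc : CommutingGroup U R) {Λ : X →ₗ.[ℝ] X} (hev : ∀ x, ev Λ (R x) = x)
    {t : ℝ} (ht : t ∈ N) {k : ℕ} {g : X} (hg : Q t (U t g) ∈ conePow R k) :
    ‖evPow Λ k (pull U N Q t g)‖ = ‖evPow Λ k (Q t (U t g))‖ := by
  rw [pull_of_mem ht]
  exact hc.norm_evPow hev _ hg

theorem pull_locIntegrable (hX : SpaceAssumptions X) [CompleteSpace X] (hc : CommutingGroup U R)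
    {Λ : X →ₗ.[ℝ] X} (hev : ∀ x, ev Λ (R x) = x) (hN : ∀ᵐ t ∂lebPos, t ∈ N)
    (htop : ∀ t ∈ N, MapsTo (Q t) (coneTop R) (coneTop R)) {k : ℕ} {g : X} (hg : g ∈ coneTop R)
    (hint : LocallyIntegrableOn (fun t => evPow Λ k (Q t (U t g))) (Ici 0)) :
    LocIntegrable fun t => evPow Λ k (pull U N Q t g) := by
  obtain ⟨C, -, hC⟩ := hX.exists_norm_bound
  intro T hT
  have h1 : IntegrableOn (fun t => evPow Λ k (Q t (U t g))) (Icc 0 T) :=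
    hint.integrableOn_compact_subset (fun t ht => ht.1) isCompact_Icc
  have h2 : IntervalIntegrable (fun t => evPow Λ k (Q t (U t g))) volume 0 T := by
    rw [intervalIntegrable_iff_integrableOn_Icc_of_le hT]
    exact h1
  have h3 : IntervalIntegrable (fun t => U (-t) (evPow Λ k (Q t (U t g)))) volume 0 T :=
    (h2.norm.const_mul C).mono_fun'
      (hc.aestronglyMeasurable continuous_neg (intervalIntegrable_iff.1 h2).aestronglyMeasurable)
      (Eventually.of_forall fun t => hC (U (-t)) (fun x hx => (hc.norm _ x hx).le) _)
  refine h3.congr_ae ?_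
  filter_upwards [ae_mono (restrict_le_lebPos hT) hN] with t ht
  exact (evPow_pull hc hev ht (htop t ht (hc.mem_top t hg) k)).symm

end

section

variable [CompleteSpace X] {𝒟 : Set X} {Qp Qm : ℝ → X → X} {U : ℝ → X →L[ℝ] X}
  {S : ℝ → X →L[ℝ] X} {R : X →L[ℝ] X} {lam0 : ℝ} {Λ : X →ₗ.[ℝ] X} {a ρ : ℝ → ℝ} {κ : X →L[ℝ] ℝ}
  {N : Set ℝ}

theorem Delta_pull (hc : CommutingGroup U R) (hev : ∀ x, ev Λ (R x) = x)
    (hN : ∀ t ∈ N, GoodTime 𝒟 Qp Qm Λ R a ρ κ t) {t : ℝ} (ht : t ∈ N) {g : X}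
    (hg : g ∈ conePow R 2) :
    Delta (pull U N Qp) (pull U N Qm) Λ t g = Delta Qp Qm Λ t (U t g) := by
  have h1 := norm_evPow_pull (k := 1) hc hev ht ((hN t ht).maps_two (hc.mem t hg))
  have h2 := norm_evPow_pull (k := 1) hc hev ht ((hN t ht).maps_two_m (hc.mem t hg))
  exact congrArg₂ (· - ·) h2 h1

/-- The hypotheses are invariant under conjugation with the group, and the zero operator, used at the
exceptional times, satisfies all of them. -/
theorem reducedModel_pull (hX : SpaceAssumptions X) (h𝒟 : ∀ g ∈ 𝒟, 0 ≤ g)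
    (hQp : GeneralAssumptions 𝒟 Qp) (hQm : GeneralAssumptions 𝒟 Qm)
    (hsys : ResolventSystem S R lam0) (hev : ∀ x, ev Λ (R x) = x) (hsub : conePow R 1 ⊆ 𝒟)
    (hc : CommutingGroup U R) (ha0 : ∀ x : ℝ, 0 ≤ x → 0 ≤ a x) (ha1 : MonotoneOn a (Ici 0))
    (ha2 : ConvexOn ℝ (Ici 0) a) (hρ0 : ∀ x : ℝ, 0 ≤ x → 0 ≤ ρ x) (hρ1 : MonotoneOn ρ (Ici 0))
    (hκ0 : ∀ x, 0 ≤ x → 0 ≤ κ x) (hκ : ∀ t x, 0 ≤ x → κ (U t x) = κ x)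
    (hN : ∀ t ∈ N, GoodTime 𝒟 Qp Qm Λ R a ρ κ t) (hNae : ∀ᵐ t ∂lebPos, t ∈ N)
    (hint : ∀ k : ℕ, 1 ≤ k → ∀ g ∈ coneTop R,
      LocallyIntegrableOn (fun t => evPow Λ k (Qp t (U t g))) (Ici 0)) :
    ReducedModel S R lam0 Λ (pull U N Qp) (pull U N Qm) a ρ κ := by
  have hzero : ev Λ (0 : X) = 0 := by simpa using hev 0
  have hmaps : ∀ t k, MapsTo (U t) (conePow R k) (conePow R k) := fun t k g hg => hc.mem t hg
  have hevU : ∀ t, ∀ g ∈ conePow R 1, ev Λ (U t g) = U t (ev Λ g) := fun t g hg =>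
    hc.evPow_apply (k := 1) hev t hg
  have hev0 : ∀ g ∈ conePow R 1, 0 ≤ ev Λ g := by
    rintro _ ⟨x, hx, rfl⟩
    rwa [pow_one, hev]
  have hevmono : ∀ g ∈ conePow R 1, ∀ h ∈ conePow R 1, g ≤ h → ev Λ g ≤ ev Λ h := by
    rintro _ ⟨x, hx, rfl⟩ _ ⟨y, hy, rfl⟩ h
    rw [pow_one, hev, hev]
    exact hsys.le_of_R_le hX (by rwa [pow_one] at h)
  have hnormU : ∀ t, ∀ g ∈ conePow R 1, ‖ev Λ (U t g)‖ = ‖ev Λ g‖ := fun t g hg => by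
    rw [hevU t g hg, hc.norm t _ (hev0 g hg)]
  have hκev : ∀ t, ∀ g ∈ conePow R 1, κ (ev Λ (U t g)) = κ (ev Λ g) := fun t g hg => by
    rw [hevU t g hg, hκ t _ (hev0 g hg)]
  have hmain : ∀ t ∈ N, ∀ g ∈ conePow R 1, a ‖ev Λ g‖ • ev Λ g =
      U (-t) (a ‖ev Λ (U t g)‖ • ev Λ (U t g)) := fun t _ g hg => by
    rw [hnormU t g hg, hevU t g hg, map_smul, hc.group.inv_apply]
  have hsub' : ∀ t, ∀ g ∈ conePow R 1, U t g ∈ 𝒟 := fun t g hg => hsub (hc.mem t hg)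
  have hpull0 : ∀ t ∉ N, ∀ g, pull U N Qm t g = 0 := fun t ht g => by rw [pull_of_notMem ht]
  have hpull0' : ∀ t ∉ N, ∀ g, pull U N Qp t g = 0 := fun t ht g => by rw [pull_of_notMem ht]
  have hdelta0 : ∀ t ∉ N, ∀ g, Delta (pull U N Qp) (pull U N Qm) Λ t g = 0 := fun t ht g => by
    rw [Delta, hpull0 t ht, hpull0' t ht, sub_self]
  refine
    { sys := hsys
      ev_R := hev
      nonneg_m := fun t g hg => ?_
      meas_p := fun g hg hmem => pull_aestronglyMeasurable hQp hc h𝒟 hsub hNae hg hmem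
      meas_m := fun g hg hmem => pull_aestronglyMeasurable hQm hc h𝒟 hsub hNae hg hmem
      mono_p := pull_monotoneOn hc (fun t => hmaps t 1) fun t ht => (hN t ht).mono_p.mono hsub
      mono_m := pull_monotoneOn hc (fun t => hmaps t 1) fun t ht => (hN t ht).mono_m.mono hsub
      closed_p := pull_closed hc hsub fun t ht => (hN t ht).closed_p
      closed_m := pull_closed hc hsub fun t ht => (hN t ht).closed_m
      maps_two := pull_mapsTo hc fun t ht => (hN t ht).maps_two
      maps_top := fun t g hg => ?_
      a_nonneg := ha0
      a_mono := ha1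
      a_convex := ha2
      bound := fun t g hg => ?_
      bound_mono := fun t g hg h hh hgh => ?_
      delta_nonneg := fun t g hg => ?_
      delta_mono := fun t g hg h hh hgh => ?_
      rho_nonneg := hρ0
      rho_mono := hρ1
      kappa_nonneg := hκ0
      kappa_le := fun t g hg => ?_
      povzner := fun t g hg => ?_
      integrable := fun k hk g hg => pull_locIntegrable hX hc hev hNae
        (fun t ht => (hN t ht).maps_top) hg (hint k hk g hg) }
  · by_cases ht : t ∈ N
    · rw [pull_of_mem ht]
      exact hc.pos _ _ (hQm.nonneg t (hN t ht).pos _ (hsub' t g hg))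
    · rw [hpull0 t ht]
  · by_cases ht : t ∈ N
    · rw [pull_of_mem ht]
      exact hc.mem_top _ ((hN t ht).maps_top (hc.mem_top t hg))
    · rw [hpull0' t ht]
      exact fun k => ⟨0, le_rfl, map_zero _⟩
  · by_cases ht : t ∈ N
    · rw [pull_of_mem ht, hmain t ht g hg]
      exact hc.mono _ ((hN t ht).bound _ (hc.mem t hg))
    · rw [hpull0 t ht]
      exact smul_nonneg (ha0 _ (norm_nonneg _)) (hev0 g hg)
  · by_cases ht : t ∈ N
    · simp only [pull_of_mem ht]
      rw [hmain t ht g hg, hmain t ht h hh, ← map_sub, ← map_sub]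
      exact hc.mono _ ((hN t ht).bound_mono (hc.mem t hg) (hc.mem t hh) (hc.mono t hgh))
    · simp only [hpull0 t ht, sub_zero]
      have h1 := hevmono g hg h hh hgh
      exact (smul_le_smul_of_nonneg_left h1 (ha0 _ (norm_nonneg _))).trans
        (smul_le_smul_of_nonneg_right
          (ha1 (norm_nonneg _) (mem_Ici.2 (norm_nonneg _)) (hX.norm_le (hev0 g hg) h1))
          (hev0 h hh))
  · by_cases ht : t ∈ N
    · rw [Delta_pull hc hev hN ht hg]
      exact (hN t ht).delta_nonneg _ (hc.mem t hg)
    · rw [hdelta0 t ht]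
  · by_cases ht : t ∈ N
    · rw [Delta_pull hc hev hN ht hg, Delta_pull hc hev hN ht hh]
      exact (hN t ht).delta_mono (hc.mem t hg) (hc.mem t hh) (hc.mono t hgh)
    · rw [hdelta0 t ht, hdelta0 t ht]
  · by_cases ht : t ∈ N
    · simp only [pull_of_mem ht]
      rw [hκev _ _ ((hN t ht).maps_two (hc.mem t hg)),
        hκev _ _ ((hN t ht).maps_two_m (hc.mem t hg))]
      exact (hN t ht).kappa_le _ (hc.mem t hg)
    · rw [hpull0 t ht, hpull0' t ht]
  · by_cases ht : t ∈ N
    · rw [norm_evPow_pull hc hev ht ((hN t ht).maps_three (hc.mem t hg)),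
        norm_evPow_pull hc hev ht ((hN t ht).maps_three_m (hc.mem t hg))]
      have h1 := (hN t ht).povzner _ (hc.mem t hg)
      rwa [hκev t g (hsys.conePow_antitone (by omega) hg),
        hc.norm_evPow hev t (hsys.conePow_antitone (by omega : 2 ≤ 3) hg)] at h1
    · rw [hpull0 t ht, hpull0' t ht]
      have h2 : 0 ≤ ρ (κ (ev Λ g)) :=
        hρ0 _ (hκ0 _ (hev0 g (hsys.conePow_antitone (by omega) hg)))
      have := mul_nonneg h2 (norm_nonneg (evPow Λ 2 g))
      linarith

end

end

section

/-! ### Equivalent forms of the equation -/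

variable {X : Type*} [NormedAddCommGroup X] [NormedSpace ℝ X] [PartialOrder X]
  [IsOrderedAddMonoid X] [IsOrderedModule ℝ X]

namespace ReducedModel

variable [CompleteSpace X] {S : ℝ → X →L[ℝ] X} {R : X →L[ℝ] X} {lam0 : ℝ} {Λ : X →ₗ.[ℝ] X}
  {Pp Pm : ℝ → X → X} {a ρ : ℝ → ℝ} {κ : X →L[ℝ] ℝ}
  (hm : ReducedModel S R lam0 Λ Pp Pm a ρ κ) (hX : SpaceAssumptions X)
include hm hX

theorem R_ev_rhs {f : ℝ → X} (hf : RegularCurve R Λ f) {t : ℝ} (ht : 0 ≤ t) :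
    R (ev Λ (Pp t (f t)) - ev Λ (Pm t (f t))) = Pp t (f t) - Pm t (f t) := by
  rw [map_sub, hm.R_ev (hm.maps_two t (hf.mem t ht)), hm.R_ev (hm.loss_mem hX (hf.mem t ht))]

theorem locIntegrable_rhs {f : ℝ → X} (hf : RegularCurve R Λ f) :
    LocIntegrable fun t => Pp t (f t) - Pm t (f t) :=
  (((hm.locIntegrable_ev_gain hX hf).sub (hm.locIntegrable_ev_loss hX hf)).clm_comp R).congr
    fun _ ht => hm.R_ev_rhs hX hf ht

/-- For regular curves the equation and its image under `Λ` are equivalent. -/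
theorem solvesReduced_iff {f₀ : X} (hf₀ : f₀ ∈ conePow R 1) {f : ℝ → X}
    (hf : RegularCurve R Λ f) : SolvesReduced Λ Pp Pm f₀ f ↔
      ∀ t, 0 ≤ t → f t = f₀ + ∫ s in (0 : ℝ)..t, (Pp s (f s) - Pm s (f s)) := by
  refine forall₂_congr fun t ht => ?_
  have hint := ((hm.locIntegrable_ev_gain hX hf).sub (hm.locIntegrable_ev_loss hX hf)) t ht
  have h1 : R (ev Λ f₀ + ∫ s in (0 : ℝ)..t, (ev Λ (Pp s (f s)) - ev Λ (Pm s (f s)))) =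
      f₀ + ∫ s in (0 : ℝ)..t, (Pp s (f s) - Pm s (f s)) := by
    rw [map_add, hm.R_ev hf₀, ← ContinuousLinearMap.intervalIntegral_comp_comm _ hint]
    congr 1
    refine intervalIntegral.integral_congr fun s hs => ?_
    rw [uIcc_of_le ht] at hs
    exact hm.R_ev_rhs hX hf hs.1
  rw [← h1, ← hm.sys.injective.eq_iff, hm.R_ev (hm.mem_one hf ht)]

theorem continuousOn_ev {f₀ : X} {f : ℝ → X} (hf : RegularCurve R Λ f)
    (hs : SolvesReduced Λ Pp Pm f₀ f) : ContinuousOn (fun t => ev Λ (f t)) (Ici 0) := by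
  have h1 := ((hm.locIntegrable_ev_gain hX hf).sub
    (hm.locIntegrable_ev_loss hX hf)).continuousOn_integral
  exact (continuousOn_const.add h1).congr fun t ht => hs t ht

end ReducedModel

section

variable {𝒟 : Set X} {Qp Qm : ℝ → X → X} {U : ℝ → X →L[ℝ] X} {R : X →L[ℝ] X} {N : Set ℝ}

/-- The integrand of the mild equation along `s ↦ Uˢ f(s)`. -/
theorem apply_pull_sub (hc : CommutingGroup U R) {s : ℝ} (hs : s ∈ N) (t : ℝ) (g : X) :
    U t (pull U N Qp s g - pull U N Qm s g) =
      U (t - s) (Qp s (U s g) - Qm s (U s g)) := by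
  rw [pull_of_mem hs, pull_of_mem hs, ← map_sub, sub_eq_add_neg t s, hc.group.add]
  rfl

theorem ae_apply_pull_sub (hc : CommutingGroup U R) (hN : ∀ᵐ t ∂lebPos, t ∈ N) {t : ℝ}
    (ht : 0 ≤ t) {F f : ℝ → X} (hF : ∀ s, 0 ≤ s → F s = U s (f s)) :
    ∀ᵐ s : ℝ, s ∈ uIoc 0 t → U t (pull U N Qp s (f s) - pull U N Qm s (f s)) =
      U (t - s) (Qp s (F s) - Qm s (F s)) := by
  filter_upwards [lebPos_ae_iff.1 hN] with s hs hst
  rw [uIoc_of_le ht] at hst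
  rw [hF s hst.1.le, apply_pull_sub hc (hs hst.1.le)]

variable [CompleteSpace X] {S : ℝ → X →L[ℝ] X} {lam0 : ℝ} {Λ : X →ₗ.[ℝ] X} {a ρ : ℝ → ℝ}
  {κ : X →L[ℝ] ℝ}

/-- The substitution `F(t) = Uᵗ f(t)` turns the equation without group into the mild equation. -/
theorem mild_eq_iff (hX : SpaceAssumptions X) (hc : CommutingGroup U R)
    (hN : ∀ᵐ t ∂lebPos, t ∈ N)
    (hm : ReducedModel S R lam0 Λ (pull U N Qp) (pull U N Qm) a ρ κ) {f₀ : X} {F f : ℝ → X}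
    (hf : RegularCurve R Λ f) (hF : ∀ s, 0 ≤ s → F s = U s (f s)) {t : ℝ} (ht : 0 ≤ t) :
    f t = f₀ + ∫ s in (0 : ℝ)..t, (pull U N Qp s (f s) - pull U N Qm s (f s)) ↔
      F t = U t f₀ + ∫ s in (0 : ℝ)..t, U (t - s) (Qp s (F s) - Qm s (F s)) := by
  have hinj : Function.Injective (U t) := fun x y h => by
    rw [← hc.group.inv_apply t x, h, hc.group.inv_apply]
  rw [← hinj.eq_iff, map_add, ← ContinuousLinearMap.intervalIntegral_comp_comm _
    (hm.locIntegrable_rhs hX hf t ht),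
    intervalIntegral.integral_congr_ae (ae_apply_pull_sub hc hN ht hF), hF t ht]

theorem mild_intervalIntegrable (hX : SpaceAssumptions X) (hc : CommutingGroup U R)
    (hN : ∀ᵐ t ∂lebPos, t ∈ N)
    (hm : ReducedModel S R lam0 Λ (pull U N Qp) (pull U N Qm) a ρ κ) {F f : ℝ → X}
    (hf : RegularCurve R Λ f) (hF : ∀ s, 0 ≤ s → F s = U s (f s)) {t : ℝ} (ht : 0 ≤ t) :
    IntervalIntegrable (fun s => U (t - s) (Qp s (F s) - Qm s (F s))) volume 0 t :=
  ((hm.locIntegrable_rhs hX hf t ht).clm_comp (U t)).congr_ae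
    ((ae_restrict_iff' measurableSet_uIoc).2 (ae_apply_pull_sub hc hN ht hF))

end

/-! ### Well-posedness -/

section

variable [CompleteSpace X] {𝒟 : Set X} {Qp Qm : ℝ → X → X} {U : ℝ → X →L[ℝ] X}
  {S : ℝ → X →L[ℝ] X} {R : X →L[ℝ] X} {lam0 : ℝ} {Λ : X →ₗ.[ℝ] X} {a ρ : ℝ → ℝ} {κ : X →L[ℝ] ℝ}
  {N : Set ℝ}

/-- A regular mild solution, transported back by the group, is a regular curve. -/
theorem IsRegularMildSolution.regularCurve (hc : CommutingGroup U R)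
    (hev : ∀ x, ev Λ (R x) = x) (hdom : domPowPos Λ 2 = conePow R 2) {f₀ : X} {F : ℝ → X}
    (hF : IsRegularMildSolution U 𝒟 Qp Qm Λ f₀ F) : RegularCurve R Λ fun t => U (-t) (F t) where
  meas := hc.aestronglyMeasurable continuous_neg
    (hF.mild.continuousOn.aestronglyMeasurable measurableSet_Ici)
  mem t ht := hc.mem _ (hdom ▸ hF.mem t ht)
  bdd T hT := by
    obtain ⟨K, hK⟩ := hF.locBdd T
    have h1 : ∀ t ∈ Icc 0 T, ‖evPow Λ 2 (U (-t) (F t))‖ ≤ K := fun t ht => by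
      rw [hc.norm_evPow hev _ (hdom ▸ hF.mem t ht.1)]
      exact hK (mem_image_of_mem _ ht)
    exact ⟨K, (norm_nonneg _).trans (h1 0 ⟨le_rfl, hT⟩), h1⟩

/-- The solution of the reduced equation, transported by the group, is a regular mild solution. -/
theorem isRegularMildSolution (hX : SpaceAssumptions X) (hc : CommutingGroup U R)
    (hN : ∀ᵐ t ∂lebPos, t ∈ N)
    (hm : ReducedModel S R lam0 Λ (pull U N Qp) (pull U N Qm) a ρ κ) (hsub : conePow R 1 ⊆ 𝒟)
    (hdom : domPowPos Λ 2 = conePow R 2) {f₀ : X} (hf₀ : f₀ ∈ conePow R 1) {f : ℝ → X}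
    (hf : RegularCurve R Λ f) (hs : SolvesReduced Λ (pull U N Qp) (pull U N Qm) f₀ f) :
    IsRegularMildSolution U 𝒟 Qp Qm Λ f₀ fun t => U t (f t) where
  mild :=
    { continuousOn := by
        refine hc.continuousOn continuous_id ?_
        have h1 := R.continuous.comp_continuousOn (hm.continuousOn_ev hX hf hs)
        exact h1.congr fun t ht => (hm.R_ev (hm.mem_one hf ht)).symm
      nonneg := fun t ht => hc.pos t _ (hm.sys.conePow_nonneg (hf.mem t ht))
      mem_dom := lebPos_ae_iff.2 (Eventually.of_forall fun t ht =>
        hsub (hc.mem t (hm.mem_one hf ht)))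
      integrable := fun t ht => mild_intervalIntegrable hX hc hN hm hf (fun _ _ => rfl) ht
      eq := fun t ht => (mild_eq_iff hX hc hN hm hf (fun _ _ => rfl) ht).1
        ((hm.solvesReduced_iff hX hf₀ hf).1 hs t ht) }
  mem t ht := hdom ▸ hc.mem t (hf.mem t ht)
  locBdd T := by
    rcases lt_or_ge T 0 with hT | hT
    · rw [Icc_eq_empty (not_le.2 hT), image_empty]
      exact bddAbove_empty
    · obtain ⟨K, -, hK⟩ := hf.bdd T hT
      refine ⟨K, ?_⟩
      rintro _ ⟨t, ht, rfl⟩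
      simp only
      rw [hc.norm_evPow hm.ev_R t (hf.mem t ht.1)]
      exact hK t ht

/-- Well-posedness, the energy identity and the second-order bound, for the initial datum `R² x₀` and
in terms of the equation without group. -/
theorem exists_regularMildSolution (hX : SpaceAssumptions X) (hc : CommutingGroup U R)
    (hNae : ∀ᵐ t ∂lebPos, t ∈ N) (hN : ∀ t ∈ N, GoodTime 𝒟 Qp Qm Λ R a ρ κ t)
    (hm : ReducedModel S R lam0 Λ (pull U N Qp) (pull U N Qm) a ρ κ) (hsub : conePow R 1 ⊆ 𝒟)
    (hdom : domPowPos Λ 2 = conePow R 2) {x₀ : X} (hx₀ : 0 ≤ x₀) :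
    ∃ f : ℝ → X,
      IsRegularMildSolution U 𝒟 Qp Qm Λ ((R ^ 2) x₀) f ∧
      (∀ F : ℝ → X, IsRegularMildSolution U 𝒟 Qp Qm Λ ((R ^ 2) x₀) F → EqOn F f (Ici 0)) ∧
      (ContinuousOn (fun t => ev Λ (f t)) (Ici 0) ∧ ∀ t : ℝ, 0 ≤ t → 0 ≤ ev Λ (f t)) ∧
      (∀ t : ℝ, 0 ≤ t →
        IntervalIntegrable (fun s => Delta Qp Qm Λ s (f s)) volume 0 t ∧
        ‖ev Λ (f t)‖ + ∫ s in (0 : ℝ)..t, Delta Qp Qm Λ s (f s) = ‖ev Λ ((R ^ 2) x₀)‖) ∧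
      (∀ t : ℝ, 0 ≤ t → ‖evPow Λ 2 (f t)‖ ≤ ‖x₀‖ * Real.exp (ρ (κ (R x₀)) * t)) := by
  obtain ⟨f, hf, hs, hbd, hmin⟩ := hm.exists_minimal_solution hX hx₀
  have h2 : (R ^ 2) x₀ ∈ conePow R 2 := ⟨x₀, hx₀, rfl⟩
  have h1 : (R ^ 2) x₀ ∈ conePow R 1 := hm.sys.conePow_antitone (by omega) h2
  have hevU : ∀ t, 0 ≤ t → ev Λ (U t (f t)) = U t (ev Λ (f t)) := fun t ht =>
    hc.evPow_apply (k := 1) hm.ev_R t (hm.mem_one hf ht)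
  have hdelta : ∀ t, 0 ≤ t → ∀ᵐ s : ℝ, s ∈ uIoc 0 t →
      Delta (pull U N Qp) (pull U N Qm) Λ s (f s) = Delta Qp Qm Λ s (U s (f s)) := by
    intro t ht
    filter_upwards [lebPos_ae_iff.1 hNae] with s hs hst
    rw [uIoc_of_le ht] at hst
    exact Delta_pull hc hm.ev_R hN (hs hst.1.le) (hf.mem s hst.1.le)
  refine ⟨fun t => U t (f t), isRegularMildSolution hX hc hNae hm hsub hdom h1 hf hs, ?_,
    ⟨?_, ?_⟩, fun t ht => ⟨?_, ?_⟩, fun t ht => ?_⟩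
  · intro F hF t ht
    have hFU : ∀ s, 0 ≤ s → F s = U s (U (-s) (F s)) := fun s _ => (hc.group.apply_inv s _).symm
    have hreg := hF.regularCurve hc hm.ev_R hdom
    have hsol : SolvesReduced Λ (pull U N Qp) (pull U N Qm) ((R ^ 2) x₀) fun s => U (-s) (F s) :=
      (hm.solvesReduced_iff hX h1 hreg).2 fun t ht =>
        (mild_eq_iff hX hc hNae hm hreg hFU ht).2 (hF.mild.eq t ht)
    have := hm.eq_of_le hX h2 hf hs hreg hsol (hmin _ hreg hsol) ht
    simp only at this ⊢
    rw [← this, hc.group.apply_inv]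
  · exact (hc.continuousOn continuous_id (hm.continuousOn_ev hX hf hs)).congr fun t ht =>
      hevU t ht
  · intro t ht
    simp only
    rw [hevU t ht]
    exact hc.pos t _ (hm.ev_nonneg (hm.mem_one hf ht))
  · exact (hm.locIntegrable_delta hX hf t ht).congr_ae
      ((ae_restrict_iff' measurableSet_uIoc).2 (hdelta t ht))
  · simp only
    rw [hevU t ht, hc.norm t _ (hm.ev_nonneg (hm.mem_one hf ht)),
      ← intervalIntegral.integral_congr_ae (hdelta t ht)]
    exact hm.energy_eq hX h2 hf hs ht
  · simp only
    rw [hc.norm_evPow hm.ev_R t (hf.mem t ht)]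
    exact hbd t ht

end

end

end OrderedEvolution

end

open OrderedEvolution in
theorem corollary3p1 {X : Type*} [NormedAddCommGroup X] [NormedSpace ℝ X] [CompleteSpace X]
    [TopologicalSpace.SeparableSpace X] [PartialOrder X] [IsOrderedAddMonoid X]
    [IsOrderedModule ℝ X] (hX : SpaceAssumptions X)
    -- the model
    (𝒟 : Set X) (h𝒟 : DomainAssumptions 𝒟) (Qp Qm : ℝ → X → X)
    (hQp : GeneralAssumptions 𝒟 Qp) (hQm : GeneralAssumptions 𝒟 Qm)
    (Λ : X →ₗ.[ℝ] X) (hΛ : OperatorAssumption 𝒟 Qp Qm Λ)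
    (lam0 : ℝ) (hA0 : AssumptionA0 Λ lam0)
    (a : ℝ → ℝ) (hA1 : AssumptionA1 Qm Λ a)
    (hA2 : AssumptionA2 Qp Qm Λ)
    (D₁ : Submodule ℝ≥0 X) (Λ₁ : D₁ →ₗ[ℝ≥0] X) (ρ : ℝ → ℝ)
    (hA3 : AssumptionA3 Qp Qm Λ D₁ Λ₁ ρ)
    -- the `C₀` group of positive isometries generated by `A`
    (U : ℝ → X →L[ℝ] X) (hU : IsC0Group U)
    (A : X →ₗ.[ℝ] X) (hA : IsGroupGenerator U A)
    (hUpos : ∀ (t : ℝ) (g : X), 0 ≤ g → 0 ≤ U t g)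
    (hUiso : ∀ (t : ℝ) (g : X), 0 ≤ g → ‖U t g‖ = ‖g‖)
    -- compatibility of the group with `Λ` and `Λ₁`
    (hUΛdom : ∀ t : ℝ, U t '' (Λ.domain : Set X) = (Λ.domain : Set X))
    (hUΛ₁dom : ∀ t : ℝ, U t '' (D₁ : Set X) = (D₁ : Set X))
    (hUΛ : ∀ t : ℝ, 0 < t → ∀ g ∈ Λ.domain, U t (ev Λ g) = ev Λ (U t g))
    (hUΛ₁ : ∀ t : ℝ, 0 < t → ∀ g ∈ D₁, U t (evCone Λ₁ g) = evCone Λ₁ (U t g))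
    -- the initial datum, and the conditions on `Q⁺`
    (f₀ : X) (hf₀ : f₀ ∈ domPowPos Λ 2)
    (hQinf : ∀ᵐ t ∂lebPos, MapsTo (Qp t) (domTopPos Λ) (domTopPos Λ))
    (hQint : ∀ k : ℕ, 1 ≤ k → ∀ g ∈ domTopPos Λ,
      LocallyIntegrableOn (fun t => evPow Λ k (Qp t (U t g))) (Ici 0)) :
    ∃ f : ℝ → X,
      IsRegularMildSolution U 𝒟 Qp Qm Λ f₀ f ∧
      (∀ F : ℝ → X, IsRegularMildSolution U 𝒟 Qp Qm Λ f₀ F → EqOn F f (Ici 0)) ∧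
      (ContinuousOn (fun t => ev Λ (f t)) (Ici 0) ∧ ∀ t : ℝ, 0 ≤ t → 0 ≤ ev Λ (f t)) ∧
      (∀ t : ℝ, 0 ≤ t →
        IntervalIntegrable (fun s => Delta Qp Qm Λ s (f s)) volume 0 t ∧
        ‖ev Λ (f t)‖ + ∫ s in (0 : ℝ)..t, Delta Qp Qm Λ s (f s) = ‖ev Λ f₀‖) ∧
      (∀ t : ℝ, 0 ≤ t →
        ‖evPow Λ 2 (f t)‖ ≤ ‖evPow Λ 2 f₀‖ * Real.exp (ρ ‖evCone Λ₁ f₀‖ * t)) := by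
  obtain ⟨S₀, hS₀, hS₀pos, hgen⟩ := hΛ.generator
  obtain ⟨S, R, hsys, hR⟩ := exists_resolventSystem hS₀ hgen hX hS₀pos hA0
  have hev : ∀ x, ev Λ (R x) = x := fun x => ((hR _ _).2 rfl).2
  have hdom := domPowPos_eq_conePow hX hsys hR
  have htop := domTopPos_eq_coneTop hX hsys hR
  have hc := commutingGroup hX hU hUpos hUiso hR hUΛdom hUΛ
  have hsub : conePow R 1 ⊆ 𝒟 := hdom 1 ▸ hΛ.dom_subset
  obtain ⟨κ, hκ, hκU⟩ := exists_functional_of_cone_operator hX hA3.nonneg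
    (hdom 1 ▸ hA3.dom_subset) hc hUΛ₁
  have hκΛ : ∀ g ∈ conePow R 1, κ (ev Λ g) = ‖evCone Λ₁ g‖ := by
    rintro _ ⟨x, hx, rfl⟩
    rw [pow_one, hev, hκ x hx]
  have hgood : ∀ᵐ t ∂lebPos, t ∈ {t | GoodTime 𝒟 Qp Qm Λ R a ρ κ t} := by
    have hpos : ∀ᵐ t ∂lebPos, 0 ≤ t := lebPos_ae_iff.2 (Eventually.of_forall fun _ => id)
    filter_upwards [hpos, hQp.isotone, hQm.isotone, hQp.oclosed, hQm.oclosed,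
      hΛ.mapsTo_plus 2 (by simp), hΛ.mapsTo_plus 3 (by simp), hΛ.mapsTo_minus 2 (by simp),
      hΛ.mapsTo_minus 3 (by simp), hQinf, hA1.bound, hA1.isotone, hA2.nonneg, hA2.isotone,
      hA3.dissipative, hA3.povzner] with t p1 p2 p3 p4 p5 p6 p7 p8 p9 p10 p11 p12 p13 p14 p15 p16
    simp only [hdom, htop, Nat.add_one_sub_one] at p6 p7 p8 p9 p10 p11 p12 p13 p14
    simp only [hdom] at p15 p16
    exact
      { pos := p1
        mono_p := p2
        mono_m := p3
        closed_p := p4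
        closed_m := p5
        maps_two := p6
        maps_top := p10
        maps_two_m := p8
        maps_three := p7
        maps_three_m := p9
        bound := fun g hg => (p11 g hg).2
        bound_mono := p12
        delta_nonneg := p13
        delta_mono := p14
        kappa_le := fun g hg => by
          rw [hκΛ _ (p6 hg), hκΛ _ (p8 hg)]
          exact sub_nonneg.1 (p15 g hg)
        povzner := fun g hg => by
          rw [hκΛ _ (hsys.conePow_antitone (by omega) hg)]
          exact p16 g hg }
  have hm := reducedModel_pull hX h𝒟.nonneg hQp hQm hsys hev hsub hc hA1.nonneg hA1.mono
    hA1.convex hA3.rho_nonneg hA3.rho_mono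
    (fun x hx => (norm_nonneg _).trans_eq (hκ x hx).symm) hκU (fun _ ht => ht) hgood
    (htop ▸ hQint)
  rw [hdom 2] at hf₀
  obtain ⟨x₀, hx₀, rfl⟩ := hf₀
  obtain ⟨f, p1, p2, p3, p4, p5⟩ :=
    exists_regularMildSolution hX hc hgood (fun _ ht => ht) hm hsub (hdom 2) hx₀
  refine ⟨f, p1, p2, p3, p4, fun t ht => ?_⟩
  rw [evPow_pow_apply hev, pow_succ_apply', pow_one, ← hκ _ (hsys.R_pos x₀ hx₀)]
  exact p5 t ht
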